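/- **Setting.** Fix a class $\mathbf{Dia}$ of small categories that contains all countable posets and is closed under isomorphism, finite products, and the slices $J_{/k}$, $J_{k/}$ of functors $u\colon J\to K$ in $\mathbf{Dia}$ (for instance all posets, or all small categories); $e$ is the terminal category. A *prederivator* $\mathbb D$ is a strict 2-functor $\mathbf{Dia}^{op}\to\mathbf{CAT}$, $u\mapsto u^*$. It is a *derivator* if: (Der1) $\mathbb D(\coprod_i K_i)\to\prod_i\mathbb D(K_i)$ is an equivalence for every small family of categories in $\mathbf{Dia}$ whose coproduct lies in $\mathbf{Dia}$; (Der2) a map in $\mathbb D(K)$ is invertible as soon as its restrictions to all objects of $K$ are; (Der3) every $u^*$ has a left adjoint $u_!$ and a right adjoint $u_*$; (Der4) these are computed pointwise by the canonical maps $\pi_!\,\mathrm{pr}^*\to k^*u_!$ over $J_{/k}$ and $k^*u_*\to\pi_*\,\mathrm{pr}^*$ over $J_{k/}$. Morphisms of prederivators are pseudonatural transformations, and their 2-cells are modifications. Write $\mathbb D^A(K)=\mathbb D(K\times A)$. A derivator is *pointed* if $\mathbb D(e)$ has a zero object. In that case let $\square=\{0,1\}^2$, $i_\ulcorner\colon\ulcorner\to\square$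 the inclusion of $\square\smallsetminus\{(1,1)\}$, $i_\lrcorner\colon\lrcorner\to\square$ the inclusion of $\square\smallsetminus\{(0,0)\}$, and $$\Sigma=(1,1)^*\,i_{\ulcorner!}\,(0,0)_*,\qquad \Omega=(0,0)^*\,i_{\lrcorner*}\,(1,1)_!\colon\ \mathbb D\to\mathbb D .$$ A derivator is *stable* if it is pointed and $(\Sigma,\Omega)$ is an adjoint equivalence: there is an adjunction $\Sigma\dashv\Omega$ of morphisms of derivators, and the unit and counit of every such adjunction are invertible modifications. A derivator is *regular* if for every filtered $C\in\mathbf{Dia}$, every finite $A\in\mathbf{Dia}$ and every $Y\in\mathbb D(C\times A)$ the canonical map $$\pi_{C,!}\,(\mathrm{id}_C\times\pi_A)_*\,Y\longrightarrow\pi_{A,*}\,(\pi_C\times\mathrm{id}_A)_!\,Y$$ is an isomorphism. Here *finite* means that the nerve of $A$ has finitely many nondegenerate simplices (finitely many objects and morphisms, and no cycles of nonidentity morphisms); a derivator satisfying the condition for all categories with finitely many morphisms is a fortiori regular in this sense. Let $V\subset\mathbb Z^2$ be the subposet of all $(i,j)$ with $|i-j|\le1$, and $\partial V\subset V$ the part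 with $|i-j|=1$. Let $\sigma\colon V\to V$, $\sigma(i,j)=(j+1,i+1)$, and let $w\colon\square\times V\to V$ be given by $$w(0,0,i,j)=(i,j),\quad w(1,0,i,j)=(j+1,j),\quad w(0,1,i,j)=(i,i+1),\quad w(1,1,i,j)=(j+1,i+1).$$ For a pointed derivator $\mathbb D$, an object $X\in\mathbb D(K\times V)$ is a *prespectrum* if its restriction to $K\times\partial V$ is zero. Then $w^*X\in\mathbb D^V(K\times\square)$ is a square in $\mathbb D^V(K)$ with corner $X$ at $(0,0)$, corner $\sigma^*X$ at $(1,1)$ and zero objects at the two other corners, and the unit of $(i_\lrcorner^*,i_{\lrcorner*})$ induces a canonical map $\phi_X\colon X\to\Omega\sigma^*X$. The prespectrum $X$ is an *$\Omega$-spectrum* if $\phi_X$ is an isomorphism. The $\Omega$-spectra form a full subprederivator $\mathrm{St}\,\mathbb D\subset\mathbb D^V$, with $\mathrm{St}\,\mathbb D(K)\subset\mathbb D(K\times V)$, on which $\sigma^*$ acts. **Proposition.** Let $\mathbb D$ be a regular pointed derivator. Then $\mathrm{St}\,\mathbb D$ is a derivator, it is pointed, and $(\Sigma,\Omega)$ is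 an adjoint equivalence on $\mathrm{St}\,\mathbb D$; that is, $\mathrm{St}\,\mathbb D$ is a stable derivator. **Corollary.** On $\mathrm{St}\,\mathbb D$ the morphisms $\Sigma$ and $\sigma^*$ are canonically isomorphic: for every adjunction $\Sigma\dashv\Omega$ on $\mathrm{St}\,\mathbb D$, with unit $\eta$, there is an invertible modification $\theta\colon\Sigma\to\sigma^*$ with $\Omega(\theta_X)\circ\eta_X=\phi_X$ for all $X$, where $\phi_X\colon X\to\Omega\sigma^*X$ is the canonical map formed from the square $w^*X$ inside $\mathrm{St}\,\mathbb D$. -/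

import Mathlib

open CategoryTheory Limits

universe w v u v' u'

/-- A domain of diagrams for derivators: a class of small categories that contains all countable
partially ordered sets and is closed under isomorphism, binary products and slices. -/
structure DiagramDomain where
  mem : ∀ (K : Type w) [SmallCategory.{w} K], Prop
  mem_of_iso : ∀ {J K : Type w} [SmallCategory.{w} J] [SmallCategory.{w} K] (F : J ⥤ K) (G : K ⥤ J),
    F ⋙ G = 𝟭 J → G ⋙ F = 𝟭 K → mem J → mem K
  mem_of_poset : ∀ (P : Type w) [PartialOrder P] [Countable P], mem P
  mem_prod : ∀ {J K : Type w} [SmallCategory.{w} J] [SmallCategory.{w} K],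
    mem J → mem K → mem (J × K)
  mem_costructuredArrow : ∀ {J K : Type w} [SmallCategory.{w} J] [SmallCategory.{w} K]
    (u : J ⥤ K) (k : K), mem J → mem K → mem (CostructuredArrow u k)
  mem_structuredArrow : ∀ {J K : Type w} [SmallCategory.{w} J] [SmallCategory.{w} K]
    (u : J ⥤ K) (k : K), mem J → mem K → mem (StructuredArrow k u)

/-- A small category that belongs to the domain of diagrams. -/
structure Shape (Dia : DiagramDomain.{w}) where
  carrier : Type w
  [cat : SmallCategory.{w} carrier]
  mem : Dia.mem carrier

namespace Shape
variable {Dia : DiagramDomain.{w}}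

instance : CoeSort (Shape Dia) (Type w) := ⟨Shape.carrier⟩
attribute [instance] Shape.cat

theorem mem_point (Dia : DiagramDomain.{w}) : Dia.mem (Discrete PUnit.{w + 1}) :=
  Dia.mem_of_iso (J := PUnit.{w + 1}) (Functor.star _) ((Functor.const _).obj PUnit.unit)
    rfl (Functor.punit_ext' _ _) (Dia.mem_of_poset PUnit.{w + 1})

/-- The terminal category `e`. -/
abbrev point (Dia : DiagramDomain.{w}) : Shape Dia := ⟨Discrete PUnit.{w + 1}, mem_point Dia⟩

abbrev prod (J K : Shape Dia) : Shape Dia := ⟨J × K, Dia.mem_prod J.mem K.mem⟩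

abbrev poset (Dia : DiagramDomain.{w}) (P : Type w) [PartialOrder P] [Countable P] : Shape Dia :=
  ⟨P, Dia.mem_of_poset P⟩

abbrev slice {J K : Shape Dia} (u : J ⥤ K) (k : K) : Shape Dia :=
  ⟨CostructuredArrow u k, Dia.mem_costructuredArrow u k J.mem K.mem⟩

abbrev coslice {J K : Shape Dia} (u : J ⥤ K) (k : K) : Shape Dia :=
  ⟨StructuredArrow k u, Dia.mem_structuredArrow u k J.mem K.mem⟩

abbrev toPoint (K : Shape Dia) : K ⥤ point Dia := Functor.star K
abbrev incl {K : Shape Dia} (k : K) : point Dia ⥤ K := Functor.fromPUnit k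

/-- The product of two functors. -/
abbrev prodMap {J K A B : Shape Dia} (u : J ⥤ K) (f : A ⥤ B) : J.prod A ⥤ K.prod B where
  obj x := (u.obj x.1, f.obj x.2)
  map g := (u.map g.1, f.map g.2)
  map_id x := Prod.ext (u.map_id x.1) (f.map_id x.2)
  map_comp g h := Prod.ext (u.map_comp g.1 h.1) (f.map_comp g.2 h.2)

/-- The product of a natural transformation with a shape. -/
abbrev prodWhisker {J K : Shape Dia} {u v : J ⥤ K} (α : u ⟶ v) (A : Shape Dia) :
    prodMap u (𝟭 A) ⟶ prodMap v (𝟭 A) where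
  app x := (α.app x.1, 𝟙 x.2)
  naturality _ _ g := Prod.ext (α.naturality g.1) ((Category.comp_id _).trans (Category.id_comp _).symm)

/-- The inclusion of `J` into `J × A` at an object of `A`. -/
abbrev sect (J : Shape Dia) {A : Shape Dia} (a : A) : J ⥤ J.prod A where
  obj j := (j, a)
  map g := (g, 𝟙 a)
  map_id _ := rfl
  map_comp _ _ := Prod.ext rfl (Category.comp_id _).symm

end Shape

/-- A prederivator: a strict 2-functor from the shapes, with the direction of functors reversed and
the direction of natural transformations kept, to categories. The functor `map u` is the
restriction `u^*`. -/
structure Prederivator (Dia : DiagramDomain.{w}) where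
  obj : Shape Dia → Type u
  [cat : ∀ K, Category.{v} (obj K)]
  map : ∀ {J K : Shape Dia}, (J ⥤ K) → (obj K ⥤ obj J)
  map_id : ∀ K : Shape Dia, map (𝟭 K) = 𝟭 (obj K)
  map_comp : ∀ {I J K : Shape Dia} (u : I ⥤ J) (v : J ⥤ K), map (u ⋙ v) = map v ⋙ map u
  map₂ : ∀ {J K : Shape Dia} {u v : J ⥤ K}, (u ⟶ v) → (map u ⟶ map v)
  map₂_id : ∀ {J K : Shape Dia} (u : J ⥤ K), map₂ (𝟙 u) = 𝟙 (map u)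
  map₂_comp : ∀ {J K : Shape Dia} {u v t : J ⥤ K} (α : u ⟶ v) (β : v ⟶ t),
    map₂ (α ≫ β) = map₂ α ≫ map₂ β
  map₂_whiskerLeft : ∀ {I J K : Shape Dia} (u : I ⥤ J) {v v' : J ⥤ K} (α : v ⟶ v'),
    map₂ (Functor.whiskerLeft u α) = eqToHom (map_comp u v) ≫
      Functor.whiskerRight (map₂ α) (map u) ≫ eqToHom (map_comp u v').symm
  map₂_whiskerRight : ∀ {I J K : Shape Dia} {u u' : I ⥤ J} (α : u ⟶ u') (v : J ⥤ K),
    map₂ (Functor.whiskerRight α v) = eqToHom (map_comp u v) ≫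
      Functor.whiskerLeft (map v) (map₂ α) ≫ eqToHom (map_comp u' v).symm

namespace Prederivator
variable {Dia : DiagramDomain.{w}} (D : Prederivator.{w, v, u} Dia)
attribute [instance] Prederivator.cat

/-- The identity `(u ⋙ v)^* = v^* ⋙ u^*`, as an isomorphism. -/
def mapComp {I J K : Shape Dia} (u : I ⥤ J) (v : J ⥤ K) : D.map (u ⋙ v) ≅ D.map v ⋙ D.map u :=
  eqToIso (D.map_comp u v)

/-- The shifted prederivator `K ↦ D (K × A)`. -/
def shift (A : Shape Dia) : Prederivator.{w, v, u} Dia where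
  obj K := D.obj (K.prod A)
  map u := D.map (Shape.prodMap u (𝟭 A))
  map_id K := D.map_id (K.prod A)
  map_comp u v := D.map_comp (Shape.prodMap u (𝟭 A)) (Shape.prodMap v (𝟭 A))
  map₂ α := D.map₂ (Shape.prodWhisker α A)
  map₂_id u := D.map₂_id _
  map₂_comp α β := by
    rw [← D.map₂_comp]
    congr 1
    ext x
    · rfl
    · exact (Category.comp_id _).symm
  map₂_whiskerLeft u _ _ α :=
    D.map₂_whiskerLeft (Shape.prodMap u (𝟭 A)) (Shape.prodWhisker α A)
  map₂_whiskerRight α v :=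
    D.map₂_whiskerRight (Shape.prodWhisker α A) (Shape.prodMap v (𝟭 A))

variable {D}

theorem lift_eqToHom {C : Type*} [Category C] {C' : Type*} [Category C'] (P : ObjectProperty C) (P' : ObjectProperty C')
    {F F' : C ⥤ C'} (e : F = F') (h : ∀ X, P X → P' (F.obj X)) (h' : ∀ X, P X → P' (F'.obj X)) :
    P'.lift (P.ι ⋙ F) (fun X => h _ X.property) = P'.lift (P.ι ⋙ F') (fun X => h' _ X.property) := by
  subst e; rfl

/-- The full subprederivator on a family of properties of objects that is stable under
restriction. -/
def full (P : ∀ K, ObjectProperty (D.obj K))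
    (hP : ∀ {J K : Shape Dia} (u : J ⥤ K) (X : D.obj K), P K X → P J ((D.map u).obj X)) :
    Prederivator.{w, v, u} Dia where
  obj K := (P K).FullSubcategory
  map {J K} u := (P J).lift ((P K).ι ⋙ D.map u) (fun X => hP u _ X.property)
  map_id K := by
    rw [lift_eqToHom (P K) (P K) (D.map_id K) (hP _) (fun X h => h)]; rfl
  map_comp {I J K} u v := by
    rw [lift_eqToHom (P K) (P I) (D.map_comp u v) (hP _) (fun X h => hP _ _ (hP _ _ h))]; rfl
  map₂ α := { app X := ObjectProperty.homMk ((D.map₂ α).app X.obj)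
              naturality X Y f := by ext; exact (D.map₂ α).naturality f.hom }
  map₂_id u := by ext X; simp [D.map₂_id]
  map₂_comp α β := by ext X; simp [D.map₂_comp]
  map₂_whiskerLeft u _ _ α := by
    ext X
    simp [D.map₂_whiskerLeft, eqToHom_app]
  map₂_whiskerRight α v := by
    ext X
    simp [D.map₂_whiskerRight, eqToHom_app]



section coherence
variable {I J K L : Shape Dia} (D)

theorem map₂_whiskerLeft_app (u : I ⥤ J) {v v' : J ⥤ K} (α : v ⟶ v') (X : D.obj K) :
    (D.map₂ (Functor.whiskerLeft u α)).app X = (D.mapComp u v).hom.app X ≫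
      (D.map u).map ((D.map₂ α).app X) ≫ (D.mapComp u v').inv.app X := by
  simp [map₂_whiskerLeft, mapComp]

theorem map₂_whiskerRight_app {u u' : I ⥤ J} (α : u ⟶ u') (v : J ⥤ K) (X : D.obj K) :
    (D.map₂ (Functor.whiskerRight α v)).app X = (D.mapComp u v).hom.app X ≫
      (D.map₂ α).app ((D.map v).obj X) ≫ (D.mapComp u' v).inv.app X := by
  simp [map₂_whiskerRight, mapComp]

theorem mapComp_inv_hom (u : I ⥤ J) (v : J ⥤ K) (t : K ⥤ L) (X : D.obj L) :
    (D.mapComp u (v ⋙ t)).inv.app X ≫ (D.mapComp (u ⋙ v) t).hom.app X =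
      (D.map u).map ((D.mapComp v t).hom.app X) ≫ (D.mapComp u v).inv.app ((D.map t).obj X) := by
  simp [mapComp, eqToHom_app, eqToHom_map]

theorem mapComp_inv_hom_assoc (u : I ⥤ J) (v : J ⥤ K) (t : K ⥤ L) (X : D.obj L) {Z : D.obj I}
    (h : _ ⟶ Z) :
    (D.mapComp u (v ⋙ t)).inv.app X ≫ (D.mapComp (u ⋙ v) t).hom.app X ≫ h =
      (D.map u).map ((D.mapComp v t).hom.app X) ≫ (D.mapComp u v).inv.app ((D.map t).obj X) ≫ h := by
  rw [← Category.assoc, mapComp_inv_hom, Category.assoc]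

theorem mapComp_inv_hom' (u : I ⥤ J) (v : J ⥤ K) (t : K ⥤ L) (X : D.obj L) :
    (D.mapComp (u ⋙ v) t).inv.app X ≫ (D.mapComp u (v ⋙ t)).hom.app X =
      (D.mapComp u v).hom.app ((D.map t).obj X) ≫ (D.map u).map ((D.mapComp v t).inv.app X) := by
  simp [mapComp, eqToHom_app, eqToHom_map]

theorem mapComp_inv_hom'_assoc (u : I ⥤ J) (v : J ⥤ K) (t : K ⥤ L) (X : D.obj L) {Z : D.obj I}
    (h : _ ⟶ Z) :
    (D.mapComp (u ⋙ v) t).inv.app X ≫ (D.mapComp u (v ⋙ t)).hom.app X ≫ h =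
      (D.mapComp u v).hom.app ((D.map t).obj X) ≫ (D.map u).map ((D.mapComp v t).inv.app X) ≫ h := by
  rw [← Category.assoc, mapComp_inv_hom', Category.assoc]

end coherence

/-- All restriction functors have left and right adjoints. -/
class HasKan (D : Prederivator.{w, v, u} Dia) : Prop where
  left : ∀ {J K : Shape Dia} (u : J ⥤ K), (D.map u).IsRightAdjoint
  right : ∀ {J K : Shape Dia} (u : J ⥤ K), (D.map u).IsLeftAdjoint

attribute [instance] HasKan.left HasKan.right

section
variable (D) [HasKan D] {J K : Shape Dia} (u : J ⥤ K)

/-- The left Kan extension `u_!`. -/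
noncomputable def lan : D.obj J ⥤ D.obj K := (D.map u).leftAdjoint
/-- The right Kan extension `u_*`. -/
noncomputable def ran : D.obj J ⥤ D.obj K := (D.map u).rightAdjoint
/-- The adjunction of `u_!` and `u^*`. -/
noncomputable def lanAdj : D.lan u ⊣ D.map u := Adjunction.ofIsRightAdjoint _
/-- The adjunction of `u^*` and `u_*`. -/
noncomputable def ranAdj : D.map u ⊣ D.ran u := Adjunction.ofIsLeftAdjoint _
end

section mates
variable (D) {J₁ J₂ K₁ K₂ : Shape Dia} {v : J₁ ⥤ J₂} {u₁ : J₁ ⥤ K₁} {u₂ : J₂ ⥤ K₂} {t : K₁ ⥤ K₂}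

/-- The transformation `v^* u₂^* ⟶ u₁^* t^*` of a square with a 2-cell. -/
def sqL (δ : v ⋙ u₂ ⟶ u₁ ⋙ t) : D.map u₂ ⋙ D.map v ⟶ D.map t ⋙ D.map u₁ :=
  (D.mapComp v u₂).inv ≫ D.map₂ δ ≫ (D.mapComp u₁ t).hom

/-- The transformation `u₁^* t^* ⟶ v^* u₂^*` of a square with a 2-cell in the other direction. -/
def sqR (δ : u₁ ⋙ t ⟶ v ⋙ u₂) : D.map t ⋙ D.map u₁ ⟶ D.map u₂ ⋙ D.map v :=
  (D.mapComp u₁ t).inv ≫ D.map₂ δ ≫ (D.mapComp v u₂).hom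

theorem sqL_paste {J K : Shape Dia} {v' : J ⥤ J₁} {u₀ : J ⥤ K} {t' : K ⥤ K₁}
    (δ : v ⋙ u₂ ⟶ u₁ ⋙ t) (δ' : v' ⋙ u₁ ⟶ u₀ ⋙ t') (Y : D.obj K₂)
    (ε : (v' ⋙ v) ⋙ u₂ ⟶ u₀ ⋙ (t' ⋙ t))
    (hε : ε = Functor.whiskerLeft v' δ ≫ Functor.whiskerRight δ' t) :
    (D.mapComp v' v).hom.app _ ≫ (D.map v').map ((D.sqL δ).app Y) ≫ (D.sqL δ').app _ =
      (D.sqL ε).app Y ≫ (D.map u₀).map ((D.mapComp t' t).hom.app Y) := by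
  subst hε
  have e4 := D.map₂_whiskerLeft_app v' δ Y
  have e5 := D.map₂_whiskerRight_app δ' t Y
  simp only [sqL, map₂_comp, NatTrans.comp_app, Functor.map_comp, Category.assoc]
  erw [e4, e5]
  simp only [Category.assoc]
  rw [mapComp_inv_hom_assoc, mapComp_inv_hom'_assoc]
  erw [mapComp_inv_hom'_assoc]
  simp only [← Functor.map_comp_assoc]; simp

theorem sqR_paste {J K : Shape Dia} {v' : J ⥤ J₁} {u₀ : J ⥤ K} {t' : K ⥤ K₁}
    (δ : u₁ ⋙ t ⟶ v ⋙ u₂) (δ' : u₀ ⋙ t' ⟶ v' ⋙ u₁) (Y : D.obj K₂)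
    (ε : u₀ ⋙ (t' ⋙ t) ⟶ (v' ⋙ v) ⋙ u₂)
    (hε : ε = Functor.whiskerRight δ' t ≫ Functor.whiskerLeft v' δ) :
    (D.sqR δ').app _ ≫ (D.map v').map ((D.sqR δ).app Y) ≫ (D.mapComp v' v).inv.app _ =
      (D.map u₀).map ((D.mapComp t' t).inv.app Y) ≫ (D.sqR ε).app Y := by
  subst hε
  have e4 := D.map₂_whiskerLeft_app v' δ Y
  have e5 := D.map₂_whiskerRight_app δ' t Y
  simp only [sqR, map₂_comp, NatTrans.comp_app, Functor.map_comp, Category.assoc]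
  erw [e4, e5]
  simp only [Category.assoc]
  rw [mapComp_inv_hom_assoc]
  erw [mapComp_inv_hom'_assoc, mapComp_inv_hom]
  simp only [← Functor.map_comp_assoc]; simp

variable [HasKan D]

/-- The left mate `u₁_! v^* ⟶ t^* u₂_!`. -/
noncomputable def lmate (δ : v ⋙ u₂ ⟶ u₁ ⋙ t) : D.map v ⋙ D.lan u₁ ⟶ D.lan u₂ ⋙ D.map t :=
  ((mateEquiv (D.lanAdj u₂) (D.lanAdj u₁)).symm (.mk _ _ _ _ (D.sqL δ))).natTrans

/-- The right mate `t^* u₂_* ⟶ u₁_* v^*`. -/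
noncomputable def rmate (δ : u₁ ⋙ t ⟶ v ⋙ u₂) : D.ran u₂ ⋙ D.map t ⟶ D.map v ⋙ D.ran u₁ :=
  (mateEquiv (D.ranAdj u₂) (D.ranAdj u₁) (.mk _ _ _ _ (D.sqR δ))).natTrans

theorem lmate_unit (δ : v ⋙ u₂ ⟶ u₁ ⋙ t) (X : D.obj J₂) :
    (D.lanAdj u₁).unit.app _ ≫ (D.map u₁).map ((D.lmate δ).app X) =
      (D.map v).map ((D.lanAdj u₂).unit.app X) ≫ (D.sqL δ).app _ :=
  (unit_mateEquiv_symm (D.lanAdj u₂) (D.lanAdj u₁) (.mk _ _ _ _ (D.sqL δ)) X).symm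

theorem rmate_counit (δ : u₁ ⋙ t ⟶ v ⋙ u₂) (X : D.obj J₂) :
    (D.map u₁).map ((D.rmate δ).app X) ≫ (D.ranAdj u₁).counit.app _ =
      (D.sqR δ).app _ ≫ (D.map v).map ((D.ranAdj u₂).counit.app X) :=
  mateEquiv_counit (D.ranAdj u₂) (D.ranAdj u₁) (.mk _ _ _ _ (D.sqR δ)) X

end mates

/-- The projection from a slice. -/
abbrev _root_.Shape.proj {J K : Shape Dia} (u : J ⥤ K) (k : K) : Shape.slice u k ⥤ J :=
  CostructuredArrow.proj u k
/-- The projection from a coslice. -/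
abbrev _root_.Shape.coproj {J K : Shape Dia} (u : J ⥤ K) (k : K) : Shape.coslice u k ⥤ J :=
  StructuredArrow.proj k u

/-- The 2-cell of the comma square of `u` and an object `k`. -/
def sliceCell {J K : Shape Dia} (u : J ⥤ K) (k : K) :
    Shape.proj u k ⋙ u ⟶ (Shape.slice u k).toPoint ⋙ Shape.incl k where
  app x := x.hom
  naturality _ _ f := (CostructuredArrow.w f).trans (Category.comp_id _).symm

/-- The 2-cell of the comma square of an object `k` and `u`. -/
def cosliceCell {J K : Shape Dia} (u : J ⥤ K) (k : K) :
    (Shape.coslice u k).toPoint ⋙ Shape.incl k ⟶ Shape.coproj u k ⋙ u where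
  app x := x.hom
  naturality _ _ f := (Category.id_comp _).trans (StructuredArrow.w f).symm

/-- A derivator. The axioms: coproducts of shapes go to products of categories (via the canonical
functor), isomorphisms are detected at the objects of the shape, Kan extensions exist, and
they are computed pointwise by the canonical base change along slices. -/
class IsDerivator (D : Prederivator.{w, v, u} Dia) : Prop extends HasKan D where
  der1 : ∀ {I : Type w} (K : I → Shape Dia) (h : Dia.mem (Σ i, K i)),
    (Functor.pi' fun i => D.map (J := K i) (K := ⟨Σ i, K i, h⟩) 
      (Sigma.incl (C := fun i => K i) i)).IsEquivalence
  der2 : ∀ {K : Shape Dia} {X Y : D.obj K} (f : X ⟶ Y),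
    (∀ k : K, IsIso ((D.map (Shape.incl k)).map f)) → IsIso f
  der4_left : ∀ {J K : Shape Dia} (u : J ⥤ K) (k : K), IsIso (D.lmate (sliceCell u k))
  der4_right : ∀ {J K : Shape Dia} (u : J ⥤ K) (k : K), IsIso (D.rmate (cosliceCell u k))


/-! ### Universal property -/
section left
variable {J K : Shape Dia}

/-- The arrow `c` exhibits `Y` as a left Kan extension of `X`. -/
def IsLan (u : J ⥤ K) {X : D.obj J} {Y : D.obj K} (c : X ⟶ (D.map u).obj Y) : Prop :=
  ∀ Z, Function.Bijective fun g : Y ⟶ Z => c ≫ (D.map u).map g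

variable {u : J ⥤ K} {X : D.obj J} {Y : D.obj K} {c : X ⟶ (D.map u).obj Y}

theorem isLan_unit [HasKan D] (X : D.obj J) : 
    IsLan u (X := X) ((D.lanAdj u).unit.app X) := fun Z =>
  ((D.lanAdj u).homEquiv X Z).bijective

theorem IsLan.comp_iso (h : IsLan u c) {Y' : D.obj K} (e : Y ⟶ Y') [IsIso e] :
    IsLan u (c ≫ (D.map u).map e) := fun Z => by
  have h2 : Function.Bijective fun g : Y' ⟶ Z => e ≫ g :=
    ⟨fun a b hab => (cancel_epi e).1 hab, fun g => ⟨inv e ≫ g, by simp⟩⟩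
  convert (h Z).comp h2 using 2
  simp

theorem IsLan.iso_comp (h : IsLan u c) {X' : D.obj J} (e : X' ⟶ X) [IsIso e] :
    IsLan u (e ≫ c) := fun Z => by
  have h2 : Function.Bijective fun g : X ⟶ (D.map u).obj Z => e ≫ g :=
    ⟨fun a b hab => (cancel_epi e).1 hab, fun g => ⟨inv e ≫ g, by simp⟩⟩
  convert h2.comp (h Z) using 2
  simp

theorem IsLan.isIso (h : IsLan u c) {Y' : D.obj K} {f : Y ⟶ Y'}
    (h' : IsLan u (c ≫ (D.map u).map f)) : IsIso f := by
  obtain ⟨g, hg⟩ := (h' Y).surjective c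
  simp only [Category.assoc, ← Functor.map_comp] at hg
  have h1 : f ≫ g = 𝟙 _ := (h Y).injective (by simpa using hg)
  refine ⟨g, h1, (h' _).injective ?_⟩
  simp only [Category.assoc, ← Functor.map_comp, reassoc_of% h1, Category.comp_id]

/-- Base change of an arrow `X ⟶ u^* Y` along a square. -/
def bcL {J' K' : Shape Dia} {v : J' ⥤ J} {u' : J' ⥤ K'} {t : K' ⥤ K} (δ : v ⋙ u ⟶ u' ⋙ t)
    (c : X ⟶ (D.map u).obj Y) : (D.map v).obj X ⟶ (D.map u').obj ((D.map t).obj Y) :=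
  (D.map v).map c ≫ (D.sqL δ).app Y

variable {J' K' : Shape Dia} {v : J' ⥤ J} {u' : J' ⥤ K'} {t : K' ⥤ K}

theorem bcL_comp (δ : v ⋙ u ⟶ u' ⋙ t) (c : X ⟶ (D.map u).obj Y) {Z : D.obj K} (g : Y ⟶ Z) :
    bcL δ (c ≫ (D.map u).map g) = bcL δ c ≫ (D.map u').map ((D.map t).map g) := by
  have := (D.sqL δ).naturality g
  simp only [Functor.comp_map] at this
  simp [bcL, this]

theorem isLan_bcL_iff_isIso [HasKan D] (δ : v ⋙ u ⟶ u' ⋙ t) (h : IsLan u c) :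
    IsLan u' (bcL δ c) ↔ IsIso ((D.lmate δ).app X) := by
  obtain ⟨f, hf⟩ := (isLan_unit (u := u) X Y).surjective c
  dsimp only at hf
  have : IsIso f := (isLan_unit X).isIso (by rwa [hf])
  rw [← hf, bcL_comp]
  have key : bcL δ ((D.lanAdj u).unit.app X) =
    (D.lanAdj u').unit.app _ ≫ (D.map u').map ((D.lmate δ).app X) := (lmate_unit D δ X).symm
  constructor
  · intro H
    have := H.comp_iso (inv ((D.map t).map f))
    simp only [Category.assoc, ← Functor.map_comp, IsIso.hom_inv_id, Category.comp_id, key] at this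
    exact (isLan_unit _).isIso this
  · intro H
    rw [key]
    exact ((isLan_unit _).comp_iso _).comp_iso _

/-- Base change is compatible with pasting of squares. -/
theorem bcL_bcL {J'' K'' : Shape Dia} {v' : J'' ⥤ J'} {u'' : J'' ⥤ K''} {t' : K'' ⥤ K'}
    (δ : v ⋙ u ⟶ u' ⋙ t) (δ' : v' ⋙ u' ⟶ u'' ⋙ t')  (c : X ⟶ (D.map u).obj Y)
    (ε : (v' ⋙ v) ⋙ u ⟶ u'' ⋙ (t' ⋙ t))
    (hε : ε = Functor.whiskerLeft v' δ ≫ Functor.whiskerRight δ' t) :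
    (D.mapComp v' v).hom.app X ≫ bcL δ' (bcL δ c) =
      bcL ε c ≫ (D.map u'').map ((D.mapComp t' t).hom.app Y) := by
  rw [bcL, bcL, bcL, Functor.map_comp, Category.assoc, Category.assoc, ← D.sqL_paste δ δ' Y ε hε]
  exact (D.mapComp v' v).hom.naturality_assoc c _ |>.symm

theorem isIso_map₂ {v₁ v₂ : J ⥤ K} (α : v₁ ⟶ v₂) (h : IsIso α) : IsIso (D.map₂ α) :=
  ⟨D.map₂ (inv α), by rw [← map₂_comp, IsIso.hom_inv_id, map₂_id],
    by rw [← map₂_comp, IsIso.inv_hom_id, map₂_id]⟩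

theorem bcL_whisker (δ : v ⋙ u ⟶ u' ⋙ t) (c : X ⟶ (D.map u).obj Y) {t' : K' ⥤ K} (φ : t ⟶ t')
    (ε : v ⋙ u ⟶ u' ⋙ t') (hε : ε = δ ≫ Functor.whiskerLeft u' φ) :
    bcL ε c = bcL δ c ≫ (D.map u').map ((D.map₂ φ).app Y) := by
  have := D.map₂_whiskerLeft_app u' φ Y
  simp only [bcL, sqL, hε, map₂_comp, NatTrans.comp_app, Category.assoc, this]
  simp

theorem IsLan.slice [IsDerivator D] (h : IsLan u c) (k : K) : IsLan _ (bcL (sliceCell u k) c) :=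
  (isLan_bcL_iff_isIso _ h).2 (by have := IsDerivator.der4_left (D := D) u k; infer_instance)

theorem isLan_of_slice [IsDerivator D] (h : ∀ k : K, IsLan _ (bcL (sliceCell u k) c)) :
    IsLan u c := by
  obtain ⟨f, hf⟩ := (isLan_unit (u := u) X Y).surjective c
  dsimp only at hf
  have : IsIso f := IsDerivator.der2 _ fun k => by
    refine ((isLan_unit (u := u) X).slice k).isIso (f := (D.map (Shape.incl k)).map f) ?_
    rw [← bcL_comp, hf]
    exact h k
  rw [← hf]
  exact (isLan_unit X).comp_iso f

/-- An adjunction of shapes gives an adjunction of restriction functors. -/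
noncomputable def mapAdj {I L : Shape Dia} {Λ : L ⥤ I} {S : I ⥤ L} (adj : Λ ⊣ S) :
    D.map S ⊣ D.map Λ := Adjunction.mkOfUnitCounit
  { unit := eqToHom (D.map_id L).symm ≫ D.map₂ adj.unit ≫ (D.mapComp Λ S).hom
    counit := (D.mapComp S Λ).inv ≫ D.map₂ adj.counit ≫ eqToHom (D.map_id I)
    left_triangle := by
      ext X
      have h : Functor.whiskerLeft S adj.unit ≫ Functor.whiskerRight adj.counit S = 𝟙 S := by
        ext x; exact adj.right_triangle_components x
      have h1 := congr_arg (fun f => (D.map₂ f).app X) h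
      have h2 := D.map₂_whiskerLeft_app S adj.unit X
      have h3 := D.map₂_whiskerRight_app adj.counit S X
      erw [map₂_comp, NatTrans.comp_app, h2, h3] at h1
      have h4 := D.mapComp_inv_hom S Λ S X
      simp only [Category.assoc] at h1
      erw [reassoc_of% h4] at h1
      simp [mapComp, eqToHom_app, eqToHom_map] at h1 ⊢
      exact h1.trans (congr_arg (fun f => NatTrans.app f X) (D.map₂_id _))
    right_triangle := by
      ext X
      have h : Functor.whiskerRight adj.unit Λ ≫ Functor.whiskerLeft Λ adj.counit = 𝟙 Λ := by
        ext x; exact adj.left_triangle_components x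
      have h1 := congr_arg (fun f => (D.map₂ f).app X) h
      have h2 := D.map₂_whiskerRight_app adj.unit Λ X
      have h3 := D.map₂_whiskerLeft_app Λ adj.counit X
      erw [map₂_comp, NatTrans.comp_app, h2, h3] at h1
      have h4 := D.mapComp_inv_hom' Λ S Λ X
      simp only [Category.assoc] at h1
      erw [reassoc_of% h4] at h1
      simp [mapComp, eqToHom_app, eqToHom_map] at h1 ⊢
      exact h1.trans (congr_arg (fun f => NatTrans.app f X) (D.map₂_id _)) }


theorem isIso_toPoint {L : Shape Dia} {F G : L ⥤ Shape.point Dia} (α : F ⟶ G) : IsIso α := by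
  have : ∀ x, IsIso (α.app x) := fun x => inferInstance
  exact NatIso.isIso_of_isIso_app α

theorem isIso_mapAdj_unit {I L : Shape Dia} {S : I ⥤ L} {Λ : L ⥤ I} (adj : Λ ⊣ S)
    (Z : D.obj (.point Dia)) :
    IsIso ((mapAdj (D := D) adj).unit.app ((D.map L.toPoint).obj Z)) := by
  have h := D.map₂_whiskerRight_app adj.unit L.toPoint Z
  have h1 := isIso_map₂ (D := D) _ (isIso_toPoint (Functor.whiskerRight adj.unit L.toPoint))
  have h2 : IsIso ((D.map₂ adj.unit).app ((D.map L.toPoint).obj Z)) := by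
    have h3 : (D.map₂ adj.unit).app ((D.map L.toPoint).obj Z) =
      (D.mapComp (𝟭 _) L.toPoint).inv.app Z ≫
        (D.map₂ (Functor.whiskerRight adj.unit L.toPoint)).app Z ≫
        (D.mapComp (Λ ⋙ S) L.toPoint).hom.app Z := by
      rw [h]; simp
    rw [h3]
    infer_instance
  simp only [mapAdj, Adjunction.mkOfUnitCounit_unit, NatTrans.comp_app]
  infer_instance

theorem bijective_comp_iso {C : Type*} [Category C] (X : C) {Y Z : C} (f : Y ⟶ Z) [IsIso f] :
    Function.Bijective fun g : X ⟶ Y => g ≫ f :=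
  ⟨fun a b hab => (cancel_mono f).1 hab, fun g => ⟨g ≫ inv f, by simp⟩⟩

theorem bcL_point_bijective {I L : Shape Dia} {S : I ⥤ L} (hS : S.IsRightAdjoint)
    (δ : S ⋙ L.toPoint ⟶ I.toPoint ⋙ 𝟭 _) (X : D.obj L) (Z : D.obj (.point Dia)) :
    Function.Bijective fun f : X ⟶ (D.map L.toPoint).obj Z => bcL δ f := by
  obtain ⟨Λ, ⟨adj⟩⟩ := hS
  have h1 := isIso_map₂ (D := D) δ (isIso_toPoint δ)
  have h2 : IsIso ((D.sqL δ).app Z) := by unfold sqL; infer_instance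
  have h3 := isIso_mapAdj_unit (D := D) adj Z
  have h4 : Function.Bijective fun f : X ⟶ (D.map L.toPoint).obj Z => (D.map S).map f := by
    refine (Function.Bijective.of_comp_iff' ((mapAdj (D := D) adj).homEquiv _ _).bijective _).1 ?_
    have : (((mapAdj (D := D) adj).homEquiv X _) ∘
        fun f : X ⟶ (D.map L.toPoint).obj Z => (D.map S).map f) =
        fun f => f ≫ (mapAdj (D := D) adj).unit.app ((D.map L.toPoint).obj Z) := by
      funext f
      simp [Adjunction.homEquiv_unit]
    rw [this]
    exact bijective_comp_iso _ _
  exact (bijective_comp_iso _ ((D.sqL δ).app Z)).comp h4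

theorem bijective_map_id {K : Shape Dia} (X Y : D.obj K) :
    Function.Bijective fun f : X ⟶ Y => (D.map (𝟭 K)).map f := by
  rw [D.map_id]; exact Function.bijective_id

theorem isLan_restrict {I L : Shape Dia} {S : I ⥤ L} (hS : S.IsRightAdjoint)
    {X : D.obj L} {Y : D.obj (.point Dia)} (δ : S ⋙ L.toPoint ⟶ I.toPoint ⋙ 𝟭 _)
    (c : X ⟶ (D.map L.toPoint).obj Y) :
    IsLan _ (bcL δ c) ↔ IsLan _ c := by
  have key : ∀ Z, (Function.Bijective fun g : (D.map (𝟭 _)).obj Y ⟶ (D.map (𝟭 _)).obj Z =>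
      bcL δ c ≫ (D.map I.toPoint).map g) ↔
      Function.Bijective fun g : Y ⟶ Z => c ≫ (D.map L.toPoint).map g := fun Z => by
    rw [← Function.Bijective.of_comp_iff _ (bijective_map_id Y Z),
      ← Function.Bijective.of_comp_iff' (bcL_point_bijective hS δ X Z)]
    simp only [Function.comp_def, bcL_comp]
  refine ⟨fun h Z => (key Z).1 (h _), fun h Z => ?_⟩
  have h1 := (key Z).2 (h Z)
  generalize hZ : (D.map (𝟭 _)).obj Z = Z' at h1
  obtain rfl : Z' = Z := by rw [← hZ, D.map_id]; rfl
  exact h1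

/-! ### Exact squares -/

/-- The square `δ` satisfies the Beck–Chevalley condition in `D`. -/
def IsExact (D : Prederivator.{w, v, u} Dia) {J K J' K' : Shape Dia} {u : J ⥤ K} {v : J' ⥤ J}
    {u' : J' ⥤ K'} {t : K' ⥤ K} (δ : v ⋙ u ⟶ u' ⋙ t) : Prop :=
  ∀ ⦃X : D.obj J⦄ ⦃Y : D.obj K⦄ (c : X ⟶ (D.map u).obj Y), IsLan u c → IsLan u' (bcL δ c)

theorem isExact_iff_lmate [HasKan D] (δ : v ⋙ u ⟶ u' ⋙ t) :
    D.IsExact δ ↔ IsIso (D.lmate δ) := by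
  refine ⟨fun h => ?_, fun h X Y c hc => (isLan_bcL_iff_isIso δ hc).2 inferInstance⟩
  have : ∀ X, IsIso ((D.lmate δ).app X) := fun X =>
    (isLan_bcL_iff_isIso δ (isLan_unit X)).1 (h _ (isLan_unit X))
  exact NatIso.isIso_of_isIso_app _

theorem isExact_iff_rmate [HasKan D] (δ : v ⋙ u ⟶ u' ⋙ t) :
    D.IsExact δ ↔ IsIso (D.rmate δ) := by
  rw [isExact_iff_lmate]
  have h := iterated_mateEquiv_conjugateEquiv (D.lanAdj u) (D.lanAdj u') (D.ranAdj v) (D.ranAdj t)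
    ((mateEquiv (D.lanAdj u) (D.lanAdj u')).symm (.mk _ _ _ _ (D.sqL δ)))
  rw [Equiv.apply_symm_apply] at h
  change D.rmate δ = conjugateEquiv _ _ (D.lmate δ) at h
  rw [h]
  exact ⟨fun _ => inferInstance, fun _ => conjugateEquiv_of_iso (((D.lanAdj u).comp (D.ranAdj t))) ((D.ranAdj v).comp (D.lanAdj u')) (D.lmate δ)⟩

theorem isExact_of_slice [IsDerivator D] (δ : v ⋙ u ⟶ u' ⋙ t)
    (h : ∀ k : K', D.IsExact (v := Shape.proj u' k ⋙ v) (u' := (Shape.slice u' k).toPoint) (t := Shape.incl k ⋙ t)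
      (Functor.whiskerLeft (Shape.proj u' k) δ ≫ Functor.whiskerRight (sliceCell u' k) t)) :
    D.IsExact δ := fun X Y c hc => isLan_of_slice fun k => by
  have h1 := bcL_bcL δ (sliceCell u' k) c _ rfl
  have h2 := ((h k) c hc).comp_iso ((D.mapComp (Shape.incl k) t).hom.app Y)
  rw [← h1] at h2
  have h3 := h2.iso_comp ((D.mapComp (Shape.proj u' k) v).inv.app X)
  simpa using h3

theorem isLan_comp_iso_iff {Y' : D.obj K} (e : Y ⟶ Y') [IsIso e] :
    IsLan u (c ≫ (D.map u).map e) ↔ IsLan u c :=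
  ⟨fun h => by simpa [← Functor.map_comp] using h.comp_iso (inv e), fun h => h.comp_iso e⟩

theorem isLan_iso_comp_iff {X' : D.obj J} (e : X' ⟶ X) [IsIso e] :
    IsLan u (e ≫ c) ↔ IsLan u c :=
  ⟨fun h => by simpa using h.iso_comp (inv e), fun h => h.iso_comp e⟩

theorem isLan_point_iff {I L : Shape Dia} {S : I ⥤ L} (hS : S.IsRightAdjoint) {p : L ⥤ J}
    {t₀ t₁ : Shape.point Dia ⥤ K} (δ : p ⋙ u ⟶ L.toPoint ⋙ t₀) {q : I ⥤ J} (hq : S ⋙ p = q)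
    (ε : q ⋙ u ⟶ I.toPoint ⋙ t₁) (φ : t₀ ⟶ t₁) [IsIso φ]
    (hε : ∀ x, ε.app x = u.map (eqToHom (Functor.congr_obj hq.symm x)) ≫ δ.app (S.obj x) ≫
      φ.app ⟨PUnit.unit⟩) :
    IsLan I.toPoint (bcL ε c) ↔ IsLan L.toPoint (bcL δ c) := by
  subst hq
  let η : S ⋙ L.toPoint ⟶ I.toPoint ⋙ 𝟭 _ := (Functor.punitExt _ _).hom
  let φ' : 𝟭 (Shape.point Dia) ⋙ t₀ ⟶ t₁ := φ
  have hφ' : IsIso φ' := ‹_›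
  rw [← isLan_restrict hS η]
  let ε₀ : (S ⋙ p) ⋙ u ⟶ I.toPoint ⋙ (𝟭 (Shape.point Dia) ⋙ t₀) :=
    Functor.whiskerLeft S δ ≫ Functor.whiskerRight η t₀
  have h3 := bcL_bcL δ η c ε₀ rfl
  have h4 := bcL_whisker ε₀ c φ' ε (by
    ext x
    have := hε x
    simp only [Functor.comp_obj, eqToHom_refl] at this
    have h5 : ε₀.app x = δ.app (S.obj x) := by
      change δ.app (S.obj x) ≫ t₀.map (η.app x) = _
      rw [Subsingleton.elim (η.app x) (𝟙 _)]
      exact (congr_arg _ (t₀.map_id _)).trans (Category.comp_id _)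
    rw [this]
    erw [u.map_id, Category.id_comp]
    exact congr_arg (fun f => f ≫ φ.app ⟨PUnit.unit⟩) h5.symm)
  have := isIso_map₂ (D := D) φ' inferInstance
  rw [h4, isLan_comp_iso_iff, ← isLan_comp_iso_iff (c := bcL ε₀ c) ((D.mapComp (𝟭 _) t₀).hom.app Y)]
  exact h3 ▸ isLan_iso_comp_iff _

/-- A square is exact if the induced functors on slices are right adjoints. -/
theorem isExact_of_comparison [IsDerivator D] (δ : v ⋙ u ⟶ u' ⋙ t)
    (T : ∀ k : K', Shape.slice u' k ⥤ Shape.slice u (t.obj k)) (hT : ∀ k, (T k).IsRightAdjoint)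
    (hv : ∀ k, T k ⋙ Shape.proj u (t.obj k) = Shape.proj u' k ⋙ v)
    (hδ : ∀ k (x : Shape.slice u' k), δ.app x.left ≫ t.map x.hom =
      u.map (eqToHom (Functor.congr_obj (hv k).symm x)) ≫ ((T k).obj x).hom) :
    D.IsExact δ := by
  refine isExact_of_slice δ fun k X Y c hc => ?_
  let e : Shape.incl (t.obj k) ≅ Shape.incl k ⋙ t :=
    Discrete.natIso fun _ => Iso.refl _
  refine (isLan_point_iff (hT k) (sliceCell u (t.obj k)) (hv k) _ e.hom fun x => ?_).2
    (hc.slice (t.obj k))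
  exact (hδ k x).trans (congr_arg _ (Category.comp_id _).symm)

/-- The square comparing `u : J ⥤ K` and `u × A` along the sections at `a`. -/
def sectCell (u : J ⥤ K) {A : Shape Dia} (a : A) :
    J.sect a ⋙ Shape.prodMap u (𝟭 A) ⟶ u ⋙ K.sect a where
  app j := 𝟙 (u.obj j, a)
  naturality _ _ _ := Prod.ext ((Category.comp_id _).trans (Category.id_comp _).symm) rfl

theorem isExact_sectCell [IsDerivator D] (u : J ⥤ K) {A : Shape Dia} (a : A) :
    D.IsExact (sectCell u a) := by
  let T (k : K) : CostructuredArrow u k ⥤ Shape.slice (Shape.prodMap u (𝟭 A)) (k, a) :=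
    { obj x := CostructuredArrow.mk (S := Shape.prodMap u (𝟭 A)) (Y := (x.left, a)) (x.hom, 𝟙 a)
      map f := CostructuredArrow.homMk (f.left, 𝟙 a) 
        (Prod.ext (CostructuredArrow.w f) (Category.comp_id _)) 
      map_comp f g := CommaMorphism.ext (Prod.ext rfl (Category.comp_id _).symm) rfl }
  let Λ (k : K) : Shape.slice (Shape.prodMap u (𝟭 A)) (k, a) ⥤ CostructuredArrow u k :=
    { obj x := CostructuredArrow.mk (Y := x.left.1) x.hom.1
      map f := CostructuredArrow.homMk f.left.1 (congr_arg Prod.fst (CostructuredArrow.w f)) }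
  have adj (k : K) : Λ k ⊣ T k := Adjunction.mkOfHomEquiv
    { homEquiv x y :=
        { toFun f := CostructuredArrow.homMk (f.left, x.hom.2) 
            (Prod.ext (CostructuredArrow.w f) (Category.comp_id _))
          invFun f := CostructuredArrow.homMk f.left.1 (congr_arg Prod.fst (CostructuredArrow.w f))
          left_inv f := rfl
          right_inv f := by
            have h : f.left.2 ≫ 𝟙 a = x.hom.2 := congr_arg Prod.snd (CostructuredArrow.w f)
            exact CommaMorphism.ext
              (Prod.ext rfl (h.symm.trans (Category.comp_id (Y := a) f.left.2))) rfl }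
      homEquiv_naturality_left_symm _ _ := by ext; rfl
      homEquiv_naturality_right _ _ :=
        CommaMorphism.ext (Prod.ext rfl (Category.comp_id _).symm) rfl }
  refine isExact_of_comparison _ T (fun k => ⟨_, ⟨adj k⟩⟩) (fun k => rfl) fun k x => ?_
  refine Prod.ext ?_ ?_
  · change 𝟙 _ ≫ x.hom = u.map (𝟙 _) ≫ x.hom
    simp
  · change 𝟙 a ≫ 𝟙 a = 𝟙 a ≫ 𝟙 a
    rfl

theorem isExact_paste {J'' K'' : Shape Dia} {v' : J'' ⥤ J'} {u'' : J'' ⥤ K''} {t' : K'' ⥤ K'}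
    (δ : v ⋙ u ⟶ u' ⋙ t) (δ' : v' ⋙ u' ⟶ u'' ⋙ t')
    (ε : (v' ⋙ v) ⋙ u ⟶ u'' ⋙ (t' ⋙ t))
    (hε : ε = Functor.whiskerLeft v' δ ≫ Functor.whiskerRight δ' t)
    (h : D.IsExact δ) (h' : D.IsExact δ') : D.IsExact ε := fun X Y c hc => by
  have := h' _ (h c hc)
  rwa [← isLan_iso_comp_iff ((D.mapComp v' v).hom.app X), bcL_bcL δ δ' c ε hε,
    isLan_comp_iso_iff] at this

/-- A square is exact if it becomes exact after pasting with a jointly conservative family of exact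
squares. -/
theorem isExact_of_paste [HasKan D] {ι : Type*} {J'' K'' : ι → Shape Dia} {v' : ∀ i, J'' i ⥤ J'}
    {u'' : ∀ i, J'' i ⥤ K'' i} {t' : ∀ i, K'' i ⥤ K'}
    (δ : v ⋙ u ⟶ u' ⋙ t) (δ' : ∀ i, v' i ⋙ u' ⟶ u'' i ⋙ t' i)
    (ht : ∀ {X Y : D.obj K'} (f : X ⟶ Y), (∀ i, IsIso ((D.map (t' i)).map f)) → IsIso f)
    (h' : ∀ i, D.IsExact (δ' i))
    (h : ∀ i, D.IsExact (v := v' i ⋙ v) (t := t' i ⋙ t)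
      (Functor.whiskerLeft (v' i) δ ≫ Functor.whiskerRight (δ' i) t)) :
    D.IsExact δ := fun X Y c hc => by
  obtain ⟨f, hf⟩ := (isLan_unit (u := u') ((D.map v).obj X) _).surjective (bcL δ c)
  dsimp only at hf
  have : IsIso f := ht _ fun i => by
    have h1 := h' i _ (isLan_unit (u := u') ((D.map v).obj X))
    refine h1.isIso ?_
    rw [← bcL_comp, hf, ← isLan_iso_comp_iff ((D.mapComp (v' i) v).hom.app X),
      bcL_bcL δ (δ' i) c _ rfl, isLan_comp_iso_iff]
    exact h i c hc
  rw [← hf]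
  exact (isLan_unit _).comp_iso f

theorem isIso_map_comp_iff {I J K : Shape Dia} (u : I ⥤ J) (v : J ⥤ K) {X Y : D.obj K}
    (f : X ⟶ Y) : IsIso ((D.map (u ⋙ v)).map f) ↔ IsIso ((D.map u).map ((D.map v).map f)) :=
  NatIso.isIso_map_iff (D.mapComp u v) f

theorem isIso_map_congr_iff {J K : Shape Dia} {u v : J ⥤ K} (e : u ≅ v) {X Y : D.obj K}
    (f : X ⟶ Y) : IsIso ((D.map u).map f) ↔ IsIso ((D.map v).map f) :=
  have := isIso_map₂ (D := D) e.hom inferInstance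
  NatIso.isIso_map_iff (asIso (D.map₂ e.hom)) f

theorem isIso_of_sect [IsDerivator D] {K A : Shape Dia} {X Y : D.obj (K.prod A)} (f : X ⟶ Y)
    (h : ∀ a : A, IsIso ((D.map (K.sect a)).map f)) : IsIso f :=
  IsDerivator.der2 f fun x => by
    have := h x.2
    let e : Shape.incl x.1 ⋙ K.sect x.2 ≅ Shape.incl x := Discrete.natIso fun _ => Iso.refl _
    rw [← isIso_map_congr_iff e, isIso_map_comp_iff]
    infer_instance

theorem isIso_of_prodMap_incl [IsDerivator D] {K A : Shape Dia} {X Y : D.obj (K.prod A)} (f : X ⟶ Y)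
    (h : ∀ k : K, IsIso ((D.map (Shape.prodMap (Shape.incl k) (𝟭 A))).map f)) : IsIso f :=
  IsDerivator.der2 f fun x => by
    have := h x.1
    let e : Shape.incl (⟨⟨⟩⟩, x.2) ⋙ Shape.prodMap (Shape.incl x.1) (𝟭 A) ≅ Shape.incl x :=
      Discrete.natIso fun _ => Iso.refl _
    rw [← isIso_map_congr_iff e, isIso_map_comp_iff]
    infer_instance

theorem isExact_shift [IsDerivator D] (δ : v ⋙ u ⟶ u' ⋙ t) (h : D.IsExact δ) (A : Shape Dia) :
    (D.shift A).IsExact δ := by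
  change D.IsExact (v := Shape.prodMap v (𝟭 A)) (u := Shape.prodMap u (𝟭 A))
    (u' := Shape.prodMap u' (𝟭 A)) (t := Shape.prodMap t (𝟭 A)) (Shape.prodWhisker δ A)
  refine isExact_of_paste (ι := A) _ (fun a => sectCell u' a) isIso_of_sect
    (fun a => isExact_sectCell u' a) fun a => ?_
  refine isExact_paste (sectCell u a) δ _ ?_ (isExact_sectCell u a) h
  ext x
  · simp [sectCell]
  · simp [sectCell]

instance [IsDerivator D] (A : Shape Dia) : (D.shift A).HasKan where
  left u := HasKan.left (D := D) (Shape.prodMap u (𝟭 A))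
  right u := HasKan.right (D := D) (Shape.prodMap u (𝟭 A))

theorem isEquivalence_map {J K : Shape Dia} (F : J ⥤ K) (G : K ⥤ J) (h : F ⋙ G = 𝟭 _)
    (h' : G ⋙ F = 𝟭 _) : (D.map F).IsEquivalence :=
  (CategoryTheory.Equivalence.mk (D.map F) (D.map G) (eqToIso (by rw [← map_comp, h', map_id]))
    (eqToIso (by rw [← map_comp, h, map_id]))).isEquivalence_functor

theorem isEquivalence_shift [IsDerivator D] (A : Shape Dia) {I : Type w} (K : I → Shape Dia)
    (h : Dia.mem (Σ i, K i)) :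
    (Functor.pi' fun i => (D.shift A).map (J := K i) (K := ⟨Σ i, K i, h⟩)
      (Sigma.incl (C := fun i => K i) i)).IsEquivalence := by
  let S : Shape Dia := ⟨Σ i, K i, h⟩
  let G : S.prod A ⥤ Σ i, (K i).prod A :=
    { obj x := ⟨x.1.1, (x.1.2, x.2)⟩
      map {x y} f := match x, y, f with
        | (⟨i, _⟩, _), (⟨_, _⟩, _), (.mk f, g) => .mk (f, g)
      map_id _ := rfl
      map_comp {x y z} f g := by
        obtain ⟨⟨i, _⟩, _⟩ := x
        obtain ⟨⟨_, _⟩, _⟩ := y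
        obtain ⟨⟨_, _⟩, _⟩ := z
        obtain ⟨⟨f⟩, f'⟩ := f
        obtain ⟨⟨g⟩, g'⟩ := g
        rfl }
  let F : (Σ i, (K i).prod A) ⥤ S.prod A :=
    Sigma.desc fun i => Shape.prodMap (K := S) (Sigma.incl (C := fun i => K i) i) (𝟭 A)
  have hGF : G ⋙ F = 𝟭 _ := by
    refine CategoryTheory.Functor.ext (fun _ => rfl) fun x y f => ?_
    obtain ⟨⟨i, _⟩, _⟩ := x
    obtain ⟨⟨_, _⟩, _⟩ := y
    obtain ⟨⟨f⟩, f'⟩ := f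
    exact ((Category.id_comp _).trans (Category.comp_id _)).symm
  have hFG : F ⋙ G = 𝟭 _ := by
    refine CategoryTheory.Functor.ext (fun _ => rfl) fun x y f => ?_
    obtain ⟨i, _⟩ := x
    obtain ⟨_, _⟩ := y
    obtain ⟨f⟩ := f
    exact ((Category.id_comp _).trans (Category.comp_id _)).symm
  have h' : Dia.mem (Σ i, (K i).prod A) := Dia.mem_of_iso G F hGF hFG (S.prod A).mem
  have h1 := IsDerivator.der1 (D := D) (fun i => (K i).prod A) h'
  have h2 := isEquivalence_map (D := D) (J := ⟨_, h'⟩) F G hFG hGF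
  have h3 : D.map (J := ⟨_, h'⟩) F ⋙ (Functor.pi' fun i => D.map (J := (K i).prod A) 
      (K := ⟨Σ i, (K i).prod A, h'⟩) (Sigma.incl (C := fun i => (K i).prod A) i)) = 
      Functor.pi' fun i => (D.shift A).map (J := K i) (K := ⟨Σ i, K i, h⟩)
      (Sigma.incl (C := fun i => K i) i) :=
    congr_arg Functor.pi' (funext fun i => (D.map_comp (J := ⟨_, h'⟩) (K := S.prod A)
      (Sigma.incl (C := fun i => (K i).prod A) i) F).symm)
  rw [← h3]
  exact @Functor.isEquivalence_trans _ _ _ _ _ _ _ _ h2 h1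

theorem isDerivator_shift [IsDerivator D] (A : Shape Dia) : (D.shift A).IsDerivator where
  der1 K h := isEquivalence_shift A K h
  der2 f h := isIso_of_prodMap_incl f h
  der4_left u k := (isExact_iff_lmate _).1 (isExact_shift _
    ((isExact_iff_lmate _).2 (IsDerivator.der4_left u k)) A)
  der4_right u k := (isExact_iff_rmate (D := D.shift A) _).1 (isExact_shift _
    ((isExact_iff_rmate _).2 (IsDerivator.der4_right u k)) A)

theorem isExact_of_isEquivalence [IsDerivator D] (δ : v ⋙ u ⟶ u' ⋙ t) [IsIso δ]
    (hv : v.IsEquivalence) (hf : t.Full) (hf' : t.Faithful) : D.IsExact δ :=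
  isExact_of_comparison δ (fun k => CostructuredArrow.map₂ δ (𝟙 (t.obj k)))
    (fun _ => inferInstance) (fun _ => rfl) fun k x => by
    simp
    erw [u.map_id, Category.id_comp]

theorem IsExact.congr {v₁ : J' ⥤ J} {t₁ : K' ⥤ K} {δ : v ⋙ u ⟶ u' ⋙ t} (h : D.IsExact δ)
    (hv : v₁ = v) (ht : t₁ = t) {δ₁ : v₁ ⋙ u ⟶ u' ⋙ t₁}
    (hδ : δ₁ = eqToHom (by rw [hv]) ≫ δ ≫ eqToHom (by rw [ht])) : D.IsExact δ₁ := by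
  subst hv ht
  simpa [hδ] using h

/-- The two orientations of the square of `u × P`, `u × Q`, `J × f` and `K × f`. -/
abbrev prodCell (u : J ⥤ K) {P Q : Shape Dia} (f : P ⥤ Q) :
    Shape.prodMap u (𝟭 P) ⋙ Shape.prodMap (𝟭 K) f ⟶ Shape.prodMap (𝟭 J) f ⋙ Shape.prodMap u (𝟭 Q) :=
  𝟙 (Shape.prodMap u f)

abbrev prodCell' (u : J ⥤ K) {P Q : Shape Dia} (f : P ⥤ Q) :
    Shape.prodMap (𝟭 J) f ⋙ Shape.prodMap u (𝟭 Q) ⟶ Shape.prodMap u (𝟭 P) ⋙ Shape.prodMap (𝟭 K) f :=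
  𝟙 (Shape.prodMap u f)

theorem isExact_prodCell' [IsDerivator D] (u : J ⥤ K) {P Q : Shape Dia} (f : P ⥤ Q) :
    D.IsExact (prodCell' u f) := by
  refine isExact_of_paste (D := D) (ι := P) (prodCell' u f) (fun p => sectCell u p) (fun f h => isIso_of_sect f h)
    (fun p => isExact_sectCell u p) fun p => ?_
  refine (isExact_sectCell (D := D) u (f.obj p)).congr ?_ ?_ ?_
  · exact CategoryTheory.Functor.ext (fun _ => rfl) fun _ _ g => by simp
  · exact CategoryTheory.Functor.ext (fun _ => rfl) fun _ _ g => by simp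
  · ext x <;> simp [sectCell, eqToHom_app]

/-- Exchange of factors. -/
abbrev _root_.Shape.swap (J K : Shape Dia) : J.prod K ⥤ K.prod J where
  obj x := (x.2, x.1)
  map g := (g.2, g.1)

theorem _root_.Shape.isEquivalence_swap (J K : Shape Dia) : (J.swap K).IsEquivalence :=
  (CategoryTheory.Equivalence.mk (J.swap K) (K.swap J) (Iso.refl _) (Iso.refl _)).isEquivalence_functor

/-- The inclusion of `P` into `J × P` at an object of `J`. -/
abbrev _root_.Shape.sectR (P : Shape Dia) {J : Shape Dia} (j : J) : P ⥤ J.prod P :=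
  P.sect j ⋙ P.swap J

theorem isExact_sectR [IsDerivator D] {P Q : Shape Dia} (f : P ⥤ Q) (j : J) :
    D.IsExact (v := P.sectR j) (u := Shape.prodMap (𝟭 J) f) (u' := f) (t := Q.sectR j)
      (Functor.whiskerRight (sectCell f j) (Q.swap J)) :=
  isExact_paste (u := Shape.prodMap (𝟭 J) f) (u' := Shape.prodMap f (𝟭 J)) (v := P.swap J)
    (t := Q.swap J) (𝟙 _) (sectCell f j) _ (by ext x <;> simp)
    (isExact_of_isEquivalence _ (Shape.isEquivalence_swap _ _)
      (have := Shape.isEquivalence_swap Q J; inferInstance)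
      (have := Shape.isEquivalence_swap Q J; inferInstance))
    (isExact_sectCell f j)

theorem isIso_of_sectR [IsDerivator D] {P : Shape Dia} {X Y : D.obj (J.prod P)} (f : X ⟶ Y)
    (h : ∀ j : J, IsIso ((D.map (P.sectR j)).map f)) : IsIso f :=
  IsDerivator.der2 f fun x => by
    have := h x.1
    let e : Shape.incl x.2 ⋙ P.sectR x.1 ≅ Shape.incl x := Discrete.natIso fun _ => Iso.refl _
    rw [← isIso_map_congr_iff e, isIso_map_comp_iff]
    infer_instance

theorem isExact_prodCell [IsDerivator D] (u : J ⥤ K) {P Q : Shape Dia} (f : P ⥤ Q) :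
    D.IsExact (prodCell u f) := by
  refine isExact_of_paste (D := D) (ι := J) (prodCell u f) _ (fun f h => isIso_of_sectR f h)
    (fun j => isExact_sectR f j) fun j => ?_
  refine (isExact_sectR (D := D) f (u.obj j)).congr ?_ ?_ ?_
  · exact CategoryTheory.Functor.ext (fun _ => rfl) fun _ _ g => by simp
  · exact CategoryTheory.Functor.ext (fun _ => rfl) fun _ _ g => by simp
  · ext x <;> simp [sectCell, eqToHom_app]

theorem map₂_comp_bcL {v₁ : J' ⥤ J} (α : v ⟶ v₁) (δ₁ : v₁ ⋙ u ⟶ u' ⋙ t)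
    (c : X ⟶ (D.map u).obj Y) (ε : v ⋙ u ⟶ u' ⋙ t) (hε : ε = Functor.whiskerRight α u ≫ δ₁) :
    (D.map₂ α).app X ≫ bcL δ₁ c = bcL ε c := by
  have h := D.map₂_whiskerRight_app α u Y
  have h1 := (D.map₂ α).naturality c
  simp only [bcL, sqL, hε, map₂_comp, NatTrans.comp_app, Category.assoc, h]
  rw [← reassoc_of% h1]
  simp

section
variable [HasKan D]

theorem lan_hom_ext {Z : D.obj K} {f g : (D.lan u).obj X ⟶ Z}
    (h : (D.lanAdj u).unit.app X ≫ (D.map u).map f = (D.lanAdj u).unit.app X ≫ (D.map u).map g) :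
    f = g :=
  (isLan_unit X Z).injective h

theorem ran_hom_ext {Z : D.obj K} {f g : Z ⟶ (D.ran u).obj X}
    (h : (D.map u).map f ≫ (D.ranAdj u).counit.app X =
      (D.map u).map g ≫ (D.ranAdj u).counit.app X) : f = g :=
  ((D.ranAdj u).homEquiv Z X).symm.injective (by simpa [Adjunction.homEquiv_counit] using h)

theorem lmate_paste {J'' K'' : Shape Dia} {v' : J'' ⥤ J'} {u'' : J'' ⥤ K''} {t' : K'' ⥤ K'}
    (δ : v ⋙ u ⟶ u' ⋙ t) (δ' : v' ⋙ u' ⟶ u'' ⋙ t') (ε : (v' ⋙ v) ⋙ u ⟶ u'' ⋙ (t' ⋙ t))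
    (hε : ε = Functor.whiskerLeft v' δ ≫ Functor.whiskerRight δ' t) (X : D.obj J) :
    (D.lmate ε).app X ≫ (D.mapComp t' t).hom.app _ =
      (D.lan u'').map ((D.mapComp v' v).hom.app X) ≫ (D.lmate δ').app _ ≫
        (D.map t').map ((D.lmate δ).app X) := by
  apply lan_hom_ext
  simp only [Functor.map_comp]
  have h1 := D.lmate_unit ε X
  have h2 := D.lmate_unit δ' ((D.map v).obj X)
  have h3 := D.lmate_unit δ X
  have h4 := (D.lanAdj u'').unit.naturality ((D.mapComp v' v).hom.app X)
  have h5 := bcL_bcL δ δ' ((D.lanAdj u).unit.app X) ε hε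
  have h6 := bcL_comp δ' ((D.lanAdj u').unit.app ((D.map v).obj X)) ((D.lmate δ).app X)
  rw [h3] at h6
  change _ = bcL δ' _ ≫ _ at h6
  change _ ≫ bcL δ' (bcL δ _) = _ at h5
  change _ = bcL ε _ at h1
  change _ = bcL δ' _ at h2
  erw [reassoc_of% h1, ← h5, ← reassoc_of% h4, reassoc_of% h2, ← h6]
  rfl

theorem lmate_nat {v₁ : J' ⥤ J} {t₁ : K' ⥤ K} (α : v ⟶ v₁) (β : t ⟶ t₁) (δ : v ⋙ u ⟶ u' ⋙ t)
    (δ₁ : v₁ ⋙ u ⟶ u' ⋙ t₁)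
    (h : Functor.whiskerRight α u ≫ δ₁ = δ ≫ Functor.whiskerLeft u' β) (X : D.obj J) :
    (D.lan u').map ((D.map₂ α).app X) ≫ (D.lmate δ₁).app X =
      (D.lmate δ).app X ≫ (D.map₂ β).app _ := by
  apply lan_hom_ext
  simp only [Functor.map_comp]
  have h1 := D.lmate_unit δ X
  have h2 := D.lmate_unit δ₁ X
  have h3 := (D.lanAdj u').unit.naturality ((D.map₂ α).app X)
  have h4 := map₂_comp_bcL α δ₁ ((D.lanAdj u).unit.app X) _ rfl
  have h5 := bcL_whisker δ ((D.lanAdj u).unit.app X) β _ rfl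
  change _ = bcL δ _ at h1
  change _ = bcL δ₁ _ at h2
  erw [reassoc_of% h1, ← reassoc_of% h3, h2, ← h5, h4, h]

theorem rmate_paste {J₁ J₂ K₁ K₂ : Shape Dia} {v : J₁ ⥤ J₂} {u₁ : J₁ ⥤ K₁} {u₂ : J₂ ⥤ K₂}
    {t : K₁ ⥤ K₂} {v' : J ⥤ J₁} {u₀ : J ⥤ K} {t' : K ⥤ K₁}
    (δ : u₁ ⋙ t ⟶ v ⋙ u₂) (δ' : u₀ ⋙ t' ⟶ v' ⋙ u₁) (ε : u₀ ⋙ (t' ⋙ t) ⟶ (v' ⋙ v) ⋙ u₂)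
    (hε : ε = Functor.whiskerRight δ' t ≫ Functor.whiskerLeft v' δ) (X : D.obj J₂) :
    (D.mapComp t' t).inv.app _ ≫ (D.rmate ε).app X =
      (D.map t').map ((D.rmate δ).app X) ≫ (D.rmate δ').app _ ≫
        (D.ran u₀).map ((D.mapComp v' v).inv.app X) := by
  apply ran_hom_ext
  simp only [Functor.map_comp, Category.assoc]
  have h1 := D.rmate_counit ε X
  have h2 := D.rmate_counit δ' ((D.map v).obj X)
  have h3 := D.rmate_counit δ X
  have h4 := (D.ranAdj u₀).counit.naturality ((D.mapComp v' v).inv.app X)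
  have h5 := D.sqR_paste δ δ' ((D.ran u₂).obj X) ε hε
  have h6 := (D.sqR δ').naturality ((D.rmate δ).app X)
  have h7 := (D.mapComp v' v).inv.naturality ((D.ranAdj u₂).counit.app X)
  have h8 := congr_arg (D.map v').map h3
  simp only [Functor.map_comp, Functor.comp_map] at h6 h7 h8
  erw [h1, h4, reassoc_of% h2, reassoc_of% h6, reassoc_of% h8, h7, ← reassoc_of% h5]
  rfl

theorem rmate_nat {J₁ J₂ K₁ K₂ : Shape Dia} {v v₁ : J₁ ⥤ J₂} {u₁ : J₁ ⥤ K₁} {u₂ : J₂ ⥤ K₂}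
    {t t₁ : K₁ ⥤ K₂} (α : v ⟶ v₁) (β : t ⟶ t₁) (δ : u₁ ⋙ t ⟶ v ⋙ u₂) (δ₁ : u₁ ⋙ t₁ ⟶ v₁ ⋙ u₂)
    (h : Functor.whiskerLeft u₁ β ≫ δ₁ = δ ≫ Functor.whiskerRight α u₂) (X : D.obj J₂) :
    (D.map₂ β).app _ ≫ (D.rmate δ₁).app X =
      (D.rmate δ).app X ≫ (D.ran u₁).map ((D.map₂ α).app X) := by
  apply ran_hom_ext
  simp only [Functor.map_comp, Category.assoc]
  have h1 := D.rmate_counit δ X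
  have h2 := D.rmate_counit δ₁ X
  have h3 := (D.ranAdj u₁).counit.naturality ((D.map₂ α).app X)
  have h4 := (D.map₂ α).naturality ((D.ranAdj u₂).counit.app X)
  have h5 := D.map₂_whiskerLeft_app u₁ β ((D.ran u₂).obj X)
  have h6 := D.map₂_whiskerRight_app α u₂ ((D.ran u₂).obj X)
  have h7 := congr_arg (fun f => (D.map₂ f).app ((D.ran u₂).obj X)) h
  simp only [map₂_comp, NatTrans.comp_app] at h7
  rw [h5, h6] at h7
  have h8 : (D.map u₁).map ((D.map₂ β).app _) ≫ (D.sqR δ₁).app ((D.ran u₂).obj X) =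
      (D.sqR δ).app _ ≫ (D.map₂ α).app _ := by
    simp only [sqR, NatTrans.comp_app, Category.assoc]
    rw [← cancel_epi ((D.mapComp u₁ t).hom.app _), ← cancel_mono ((D.mapComp v₁ u₂).inv.app _)]
    simpa using h7
  erw [h2, h3, reassoc_of% h1, reassoc_of% h8, ← h4]
  rfl

end

section
variable [HasKan D]

theorem rmate_paste_iso {J K J₁ J₂ K₁ K₂ : Shape Dia} {v : J₁ ⥤ J₂} {u₁ : J₁ ⥤ K₁} {u₂ : J₂ ⥤ K₂}
    {t : K₁ ⥤ K₂} {v' : J ⥤ J₁} {u₀ : J ⥤ K} {t' : K ⥤ K₁}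
    (δ : u₁ ⋙ t ⟶ v ⋙ u₂) (δ' : u₀ ⋙ t' ⟶ v' ⋙ u₁) (ε : u₀ ⋙ (t' ⋙ t) ⟶ (v' ⋙ v) ⋙ u₂)
    (hε : ε = Functor.whiskerRight δ' t ≫ Functor.whiskerLeft v' δ) (X : D.obj J₂)
    (r₁ : D.ran u₂ ⋙ D.map t ≅ D.map v ⋙ D.ran u₁) (h₁ : r₁.hom = D.rmate δ)
    (r₂ : D.ran u₁ ⋙ D.map t' ≅ D.map v' ⋙ D.ran u₀) (h₂ : r₂.hom = D.rmate δ')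
    (r₃ : D.ran u₂ ⋙ D.map (t' ⋙ t) ≅ D.map (v' ⋙ v) ⋙ D.ran u₀) (h₃ : r₃.hom = D.rmate ε) :
    r₃.inv.app X ≫ (D.mapComp t' t).hom.app _ = (D.ran u₀).map ((D.mapComp v' v).hom.app X) ≫
      r₂.inv.app _ ≫ (D.map t').map (r₁.inv.app X) := by
  have h := rmate_paste δ δ' ε hε X
  rw [← h₁, ← h₂, ← h₃] at h
  have h4 : r₁.hom.app X ≫ r₁.inv.app X = 𝟙 _ := r₁.hom_inv_id_app X
  have h5 : r₂.hom.app ((D.map v).obj X) ≫ r₂.inv.app _ = 𝟙 _ := r₂.hom_inv_id_app _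
  rw [← cancel_epi (r₃.hom.app X), ← cancel_epi ((D.mapComp t' t).inv.app _),
    Iso.hom_inv_id_app_assoc, Iso.inv_hom_id_app, reassoc_of% h, ← Functor.map_comp_assoc,
    Iso.inv_hom_id_app]
  erw [(D.ran u₀).map_id, Category.id_comp, reassoc_of% h5]
  rw [← Functor.map_comp, h4]
  exact ((D.map t').map_id _).symm

theorem rmate_nat_iso {J₁ J₂ K₁ K₂ : Shape Dia} {v v₁ : J₁ ⥤ J₂} {u₁ : J₁ ⥤ K₁} {u₂ : J₂ ⥤ K₂}
    {t t₁ : K₁ ⥤ K₂} (α : v ⟶ v₁) (β : t ⟶ t₁) (δ : u₁ ⋙ t ⟶ v ⋙ u₂) (δ₁ : u₁ ⋙ t₁ ⟶ v₁ ⋙ u₂)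
    (h : Functor.whiskerLeft u₁ β ≫ δ₁ = δ ≫ Functor.whiskerRight α u₂) (X : D.obj J₂)
    (r : D.ran u₂ ⋙ D.map t ≅ D.map v ⋙ D.ran u₁) (h₁ : r.hom = D.rmate δ)
    (r₁ : D.ran u₂ ⋙ D.map t₁ ≅ D.map v₁ ⋙ D.ran u₁) (h₂ : r₁.hom = D.rmate δ₁) :
    (D.ran u₁).map ((D.map₂ α).app X) ≫ r₁.inv.app X = r.inv.app X ≫ (D.map₂ β).app _ := by
  have h := rmate_nat α β δ δ₁ h X
  rw [← h₁, ← h₂] at h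
  rw [← cancel_epi (r.hom.app X), ← reassoc_of% h]
  simp

end

end left

/-! ### Morphisms of prederivators -/

/-- A morphism of prederivators, that is, a pseudonatural transformation. Compatibility of `γ` with
identity functors is automatic, since the `γ u` are invertible. -/
structure Morphism (D E : Prederivator.{w, v, u} Dia) where
  app : ∀ K : Shape Dia, D.obj K ⥤ E.obj K
  γ : ∀ {J K : Shape Dia} (u : J ⥤ K), D.map u ⋙ app J ≅ app K ⋙ E.map u
  γ_comp : ∀ {I J K : Shape Dia} (u : I ⥤ J) (v : J ⥤ K) (X : D.obj K),
    (γ (u ⋙ v)).hom.app X ≫ (E.mapComp u v).hom.app ((app K).obj X) =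
      (app I).map ((D.mapComp u v).hom.app X) ≫ (γ u).hom.app ((D.map v).obj X) ≫
        (E.map u).map ((γ v).hom.app X)
  γ_naturality : ∀ {J K : Shape Dia} {u v : J ⥤ K} (α : u ⟶ v) (X : D.obj K),
    (app J).map ((D.map₂ α).app X) ≫ (γ v).hom.app X =
      (γ u).hom.app X ≫ (E.map₂ α).app ((app K).obj X)

namespace Morphism
variable {D E F : Prederivator.{w, v, u} Dia}

theorem eq_eqToHom {C : Type*} [Category C] {X X' Y Y' Z : C} (g : X ⟶ Y) [IsIso g]
    (f : X' ⟶ Z) (p : Y = Y') (q : X = X') {r : Z = X} {s : Y = Y'}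
    (h : g ≫ eqToHom p = eqToHom q ≫ f ≫ eqToHom r ≫ g ≫ eqToHom s) (t : X' = Z) :
    f = eqToHom t := by
  subst p q r
  have : f ≫ g = 𝟙 _ ≫ g := by simpa using h.symm
  simpa using (cancel_mono g).1 this

theorem γ_id (Φ : Morphism D E) {K : Shape Dia} (X : D.obj K) :
    (Φ.γ (𝟭 K)).hom.app X = (Φ.app K).map (eqToHom (Functor.congr_obj (D.map_id K) X)) ≫
      eqToHom (Functor.congr_obj (E.map_id K) _).symm := by
  have key : ∀ Y, (D.map (𝟭 K)).obj X = Y → (Φ.γ (𝟭 K)).hom.app Y =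
      (Φ.app K).map (eqToHom (Functor.congr_obj (D.map_id K) Y)) ≫
        eqToHom (Functor.congr_obj (E.map_id K) _).symm := by
    rintro _ rfl
    have h := Φ.γ_comp (𝟭 K) (𝟭 K) X
    have h1 := Functor.congr_hom (E.map_id K) ((Φ.γ (𝟭 K)).hom.app X)
    change (Φ.γ (𝟭 K)).hom.app X ≫ _ = _ at h
    rw [h1] at h
    simp only [mapComp, eqToIso.hom, eqToHom_app, eqToHom_map] at h ⊢
    simp only [Functor.id_map] at h
    exact (eq_eqToHom _ _ _ _ h ((Functor.congr_obj (E.map_id K) _).symm.trans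
      (by rw [D.map_id]; rfl))).trans (by simp)
  exact key X (by rw [D.map_id]; rfl)

/-- A morphism whose structure isomorphisms are identities. -/
def ofEq (app : ∀ K : Shape Dia, D.obj K ⥤ E.obj K)
    (h : ∀ {J K : Shape Dia} (u : J ⥤ K), D.map u ⋙ app J = app K ⋙ E.map u)
    (h₂ : ∀ {J K : Shape Dia} {u v : J ⥤ K} (α : u ⟶ v) (X : D.obj K),
      (app J).map ((D.map₂ α).app X) ≫ eqToHom (Functor.congr_obj (h v) X) =
        eqToHom (Functor.congr_obj (h u) X) ≫ (E.map₂ α).app ((app K).obj X)) :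
    Morphism D E where
  app := app
  γ u := eqToIso (h u)
  γ_comp u v X := by simp [mapComp, eqToHom_app, eqToHom_map]
  γ_naturality α X := by simpa [eqToHom_app] using h₂ α X

/-- Composition of morphisms. -/
def comp (Φ : Morphism D E) (Ψ : Morphism E F) : Morphism D F where
  app K := Φ.app K ⋙ Ψ.app K
  γ {J K} u := (Functor.associator _ _ _).symm ≪≫ Functor.isoWhiskerRight (Φ.γ u) (Ψ.app J) ≪≫
    Functor.associator _ _ _ ≪≫ Functor.isoWhiskerLeft (Φ.app K) (Ψ.γ u) ≪≫
    (Functor.associator _ _ _).symm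
  γ_comp u v X := by
    have h1 := congr_arg (Ψ.app _).map (Φ.γ_comp u v X)
    have h2 := Ψ.γ_comp u v ((Φ.app _).obj X)
    have h3 := (Ψ.γ u).hom.naturality ((Φ.γ v).hom.app X)
    simp only [Functor.map_comp, Functor.comp_map] at h1 h3
    simp
    rw [h2, reassoc_of% h1, reassoc_of% h3]
  γ_naturality α X := by
    have h1 := congr_arg (Ψ.app _).map (Φ.γ_naturality α X)
    have h2 := Ψ.γ_naturality α ((Φ.app _).obj X)
    simp only [Functor.map_comp] at h1
    simp [reassoc_of% h1, h2]

/-- The identity morphism. -/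
def id (D : Prederivator.{w, v, u} Dia) : Morphism D D where
  app K := 𝟭 _
  γ u := Iso.refl _
  γ_comp u v X := by simp
  γ_naturality α X := by simp

end Morphism

/-- A modification between morphisms of prederivators. -/
@[ext]
structure Modification {D E : Prederivator.{w, v, u} Dia} (Φ Ψ : Morphism D E) where
  app : ∀ K : Shape Dia, Φ.app K ⟶ Ψ.app K
  naturality : ∀ {J K : Shape Dia} (u : J ⥤ K) (X : D.obj K),
    (app J).app ((D.map u).obj X) ≫ (Ψ.γ u).hom.app X =
      (Φ.γ u).hom.app X ≫ (E.map u).map ((app K).app X)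

variable {D : Prederivator.{w, v, u} Dia}

theorem eqToHom_swap {C : Type*} [Category C] {A A' B B' Z Z' : C} {x : A ⟶ B} {y : A' ⟶ B'}
    (p : Z = A) (q : B = Z') (p' : Z = A') (q' : B' = Z')
    (h : eqToHom p ≫ x ≫ eqToHom q = eqToHom p' ≫ y ≫ eqToHom q') (r : B = B') (s : A = A') :
    x ≫ eqToHom r = eqToHom s ≫ y := by
  subst p q r s
  simpa using h

theorem map₂_eqToHom {J K : Shape Dia} {u v : J ⥤ K} (h : u = v) :
    D.map₂ (eqToHom h) = eqToHom (congr_arg D.map h) := by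
  subst h
  exact D.map₂_id u

theorem map₂_swap {I J K L : Shape Dia} {p : I ⥤ J} {v v' : J ⥤ K} {β : v ⟶ v'} {t t' : I ⥤ L}
    {α : t ⟶ t'} {q : L ⥤ K} (h : p ⋙ v = t ⋙ q) (h' : p ⋙ v' = t' ⋙ q)
    (hβ : Functor.whiskerLeft p β = eqToHom h ≫ Functor.whiskerRight α q ≫ eqToHom h'.symm)
    (X : D.obj K) (e : (D.map p).obj ((D.map v').obj X) = (D.map t').obj ((D.map q).obj X))
    (e' : (D.map p).obj ((D.map v).obj X) = (D.map t).obj ((D.map q).obj X)) :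
    (D.map p).map ((D.map₂ β).app X) ≫ eqToHom e =
      eqToHom e' ≫ (D.map₂ α).app ((D.map q).obj X) := by
  have h1 := congr_arg (fun f => (D.map₂ f).app X) hβ
  simp only [map₂_comp, NatTrans.comp_app, map₂_eqToHom, map₂_whiskerLeft_app,
    map₂_whiskerRight_app] at h1
  simp only [mapComp, eqToIso.hom, eqToIso.inv, eqToHom_app, Category.assoc, eqToHom_trans,
    eqToHom_trans_assoc] at h1
  exact eqToHom_swap _ _ _ _ h1 _ _

/-- Evaluation at `p`. -/
def eval (D : Prederivator.{w, v, u} Dia) {P : Shape Dia} (p : P) : Morphism (D.shift P) D :=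
  .ofEq (D := D.shift P) (E := D) (fun K => D.map (K.sect p))
    (fun {J K} u => (D.map_comp (J.sect p) (Shape.prodMap u (𝟭 P))).symm.trans
      (D.map_comp u (K.sect p)))
    (fun α X => map₂_swap (D := D) (p := Shape.sect _ p) (q := Shape.sect _ p) (β := Shape.prodWhisker α P) (α := α)
      rfl rfl (by ext <;> simp) X _ _)

abbrev _root_.Shape.fst (K P : Shape Dia) : K.prod P ⥤ K where
  obj x := x.1
  map g := g.1

/-- Constant diagrams. -/
def const (D : Prederivator.{w, v, u} Dia) (P : Shape Dia) : Morphism D (D.shift P) :=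
  .ofEq (D := D) (E := D.shift P) (fun K => D.map (K.fst P))
    (fun {J K} u => (D.map_comp (J.fst P) u).symm.trans
      (D.map_comp (Shape.prodMap u (𝟭 P)) (K.fst P)))
    (fun α X => map₂_swap (D := D) (p := Shape.fst _ P) (q := Shape.fst _ P) (β := α) (α := Shape.prodWhisker α P)
      rfl rfl (by ext; simp) X _ _)

section
variable [IsDerivator D] {P Q : Shape Dia} (f : P ⥤ Q)

instance isIso_lmate_prodCell {J K : Shape Dia} (u : J ⥤ K) : IsIso (D.lmate (prodCell u f)) :=
  (isExact_iff_lmate _).1 (isExact_prodCell u f)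

instance isIso_rmate_prodCell' {J K : Shape Dia} (u : J ⥤ K) : IsIso (D.rmate (prodCell' u f)) :=
  (isExact_iff_rmate (D := D) _).1 (isExact_prodCell' u f)

variable (D)

/-- Left Kan extension along `f`, as a morphism of shifted derivators. -/
noncomputable def lanMor : Morphism (D.shift P) (D.shift Q) where
  app K := D.lan (Shape.prodMap (𝟭 K) f)
  γ u := @asIso _ _ _ _ (D.lmate (prodCell u f)) (isIso_lmate_prodCell f u)
  γ_comp u v X := lmate_paste (prodCell v f) (prodCell u f) (prodCell (u ⋙ v) f)
      (by ext <;> simp) X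
  γ_naturality {_ _ u v} α X := lmate_nat (Shape.prodWhisker α P) (Shape.prodWhisker α Q)
    (prodCell u f) (prodCell v f)
      (by ext <;> simp) X

/-- Right Kan extension along `f`, as a morphism of shifted derivators. -/
noncomputable def ranMor : Morphism (D.shift P) (D.shift Q) where
  app K := D.ran (Shape.prodMap (𝟭 K) f)
  γ u := (@asIso _ _ _ _ (D.rmate (prodCell' u f)) (isIso_rmate_prodCell' f u)).symm
  γ_comp u v X := rmate_paste_iso (prodCell' v f) (prodCell' u f) (prodCell' (u ⋙ v) f)
    (by ext <;> simp) X (@asIso _ _ _ _ (D.rmate (prodCell' v f)) (isIso_rmate_prodCell' f v)) rfl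
    (@asIso _ _ _ _ (D.rmate (prodCell' u f)) (isIso_rmate_prodCell' f u)) rfl
    (@asIso _ _ _ _ (D.rmate (prodCell' (u ⋙ v) f)) (isIso_rmate_prodCell' f (u ⋙ v))) rfl
  γ_naturality {_ _ u v} α X := rmate_nat_iso (Shape.prodWhisker α P) (Shape.prodWhisker α Q)
    (prodCell' u f) (prodCell' v f) (by ext <;> simp) X
    (@asIso _ _ _ _ (D.rmate (prodCell' u f)) (isIso_rmate_prodCell' f u)) rfl
    (@asIso _ _ _ _ (D.rmate (prodCell' v f)) (isIso_rmate_prodCell' f v)) rfl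

end

/-! ### Zero objects -/
section zero
variable {D : Prederivator.{w, v, u} Dia}

theorem isIso_of_isZero {C : Type*} [Category C] {X Y : C} (f : X ⟶ Y) (hX : IsZero X)
    (hY : IsZero Y) : IsIso f :=
  ⟨hY.to_ X, hX.eq_of_src _ _, hY.eq_of_src _ _⟩

theorem isZero_map [HasKan D] {J K : Shape Dia} (u : J ⥤ K) {X : D.obj K} (h : IsZero X) :
    IsZero ((D.map u).obj X) where
  unique_to Y := by
    obtain ⟨i⟩ := h.unique_to ((D.ran u).obj Y)
    exact ⟨((D.ranAdj u).homEquiv X Y).unique⟩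
  unique_from Y := by
    obtain ⟨i⟩ := h.unique_from ((D.lan u).obj Y)
    exact ⟨((D.lanAdj u).homEquiv Y X).symm.unique⟩

variable (D) in
/-- A prederivator is pointed if its underlying category has a zero object. -/
def IsPointed : Prop := HasZeroObject (D.obj (.point Dia))

theorem IsPointed.exists_isZero [HasKan D] (h : D.IsPointed) (K : Shape Dia) :
    ∃ Z : D.obj K, IsZero Z := by
  obtain ⟨Z, hZ⟩ := h.zero
  exact ⟨_, isZero_map K.toPoint hZ⟩

theorem IsPointed.isZero_of_unique_to [HasKan D] (h : D.IsPointed) {K : Shape Dia} {X : D.obj K}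
    (hX : ∀ Y, Nonempty (Unique (X ⟶ Y))) : IsZero X := by
  obtain ⟨Z, hZ⟩ := h.exists_isZero K
  obtain ⟨i⟩ := hX Z
  obtain ⟨j⟩ := hX X
  exact hZ.of_iso ⟨i.default, hZ.to_ X, Subsingleton.elim _ _, hZ.eq_of_src _ _⟩

theorem IsPointed.isZero_ran [HasKan D] (h : D.IsPointed) {J K : Shape Dia} (u : J ⥤ K)
    {X : D.obj J} (hX : IsZero X) : IsZero ((D.ran u).obj X) := by
  obtain ⟨Z, hZ⟩ := h.exists_isZero K
  have i (Y : D.obj K) : Nonempty (Unique (Y ⟶ (D.ran u).obj X)) := by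
    obtain ⟨i⟩ := hX.unique_from ((D.map u).obj Y)
    exact ⟨((D.ranAdj u).homEquiv Y X).symm.unique⟩
  obtain ⟨i₁⟩ := i Z
  obtain ⟨i₂⟩ := i ((D.ran u).obj X)
  exact hZ.of_iso ⟨hZ.from_ _, i₁.default, Subsingleton.elim _ _, hZ.eq_of_src _ _⟩

theorem isZero_map_comp_iff {I J K : Shape Dia} (u : I ⥤ J) (v : J ⥤ K) (X : D.obj K) :
    IsZero ((D.map (u ⋙ v)).obj X) ↔ IsZero ((D.map u).obj ((D.map v).obj X)) :=
  ((D.mapComp u v).app X).isZero_iff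

theorem isZero_map_congr_iff {J K : Shape Dia} {u v : J ⥤ K} (e : u ≅ v) (X : D.obj K) :
    IsZero ((D.map u).obj X) ↔ IsZero ((D.map v).obj X) :=
  have := isIso_map₂ (D := D) e.hom inferInstance
  ((asIso (D.map₂ e.hom)).app X).isZero_iff

theorem IsPointed.shift [IsDerivator D] (h : D.IsPointed) (A : Shape Dia) :
    (D.shift A).IsPointed := by
  obtain ⟨Z, hZ⟩ := h.exists_isZero ((Shape.point Dia).prod A)
  exact ⟨Z, hZ⟩

instance [IsDerivator D] (A : Shape Dia) : (D.shift A).IsDerivator := isDerivator_shift A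

/-- The empty shape. -/
def _root_.Shape.empty (Dia : DiagramDomain.{w}) : Shape Dia where
  carrier := Σ i : PEmpty.{w + 1}, (i.elim : Shape Dia)
  mem := Dia.mem_of_iso (J := PEmpty.{w + 1})
    { obj i := i.elim, map {i} := i.elim, map_id i := i.elim, map_comp {i} := i.elim }
    { obj i := i.1.elim, map {i} := i.1.elim, map_id i := i.1.elim, map_comp {i} := i.1.elim }
    (CategoryTheory.Functor.ext (fun i => i.elim) fun i => i.elim)
    (CategoryTheory.Functor.ext (fun i => i.1.elim) fun i => i.1.elim)
    (Dia.mem_of_poset PEmpty.{w + 1})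

instance : IsEmpty (Shape.empty Dia) := ⟨fun i => i.1.elim⟩

theorem unique_hom_empty [IsDerivator D] (X Y : D.obj (.empty Dia)) : Nonempty (Unique (X ⟶ Y)) := by
  have h := IsDerivator.der1 (D := D) (fun i : PEmpty.{w + 1} => i.elim) (Shape.empty Dia).mem
  obtain ⟨f, -⟩ := h.full.map_surjective (X := X) (Y := Y) fun i => i.elim
  exact ⟨⟨⟨f⟩, fun g => h.faithful.map_injective (funext fun i => i.elim)⟩⟩

theorem IsLan.isZero_of_empty [IsDerivator D] (hD : D.IsPointed) {K : Shape Dia}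
    {u : Shape.empty Dia ⥤ K} {X : D.obj (.empty Dia)} {Y : D.obj K} {c : X ⟶ (D.map u).obj Y} (h : IsLan u c) :
    IsZero Y := hD.isZero_of_unique_to fun Z => by
  obtain ⟨i⟩ := unique_hom_empty X ((D.map u).obj Z)
  exact ⟨(Equiv.ofBijective _ (h Z)).unique⟩

theorem IsLan.isIso_of_bijective {J K : Shape Dia} {t : J ⥤ K} (ht : (D.map t).IsEquivalence)
    {X : D.obj J} {Y : D.obj K} {c : X ⟶ (D.map t).obj Y} (h : IsLan t c) : IsIso c := by
  let e := (D.map t).objObjPreimageIso X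
  have he : IsLan t e.inv := fun Z => by
    have h2 : Function.Bijective fun g : (D.map t).obj _ ⟶ (D.map t).obj Z => e.inv ≫ g :=
      ⟨fun a b hab => (cancel_epi e.inv).1 hab, fun g => ⟨e.hom ≫ g, by simp⟩⟩
    exact h2.comp ⟨(D.map t).map_injective, (D.map t).map_surjective⟩
  obtain ⟨f, hf⟩ := (he Y).surjective c
  dsimp only at hf
  have : IsIso f := he.isIso (by rwa [hf])
  rw [← hf]
  infer_instance

theorem isEquivalence_map_of_isEquivalence {J K : Shape Dia} (t : J ⥤ K) (ht : t.IsEquivalence) :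
    (D.map t).IsEquivalence :=
  have := isIso_map₂ (D := D) t.asEquivalence.unit inferInstance
  have := isIso_map₂ (D := D) t.asEquivalence.counit inferInstance
  (CategoryTheory.Equivalence.mk (D.map t) (D.map t.inv)
    ((eqToIso (D.map_id K)).symm ≪≫ (asIso (D.map₂ t.asEquivalence.counit)).symm ≪≫ D.mapComp t.inv t)
    ((D.mapComp t t.inv).symm ≪≫ (asIso (D.map₂ t.asEquivalence.unit)).symm ≪≫
      eqToIso (D.map_id J))).isEquivalence_functor

/-- Left Kan extension along a fully faithful functor is fully faithful. -/
theorem isIso_unit [IsDerivator D] {J K : Shape Dia} (u : J ⥤ K) [u.Full] [u.Faithful]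
    (X : D.obj J) : IsIso ((D.lanAdj u).unit.app X) := by
  let δ : 𝟭 J ⋙ u ⟶ 𝟭 J ⋙ u := 𝟙 _
  have h : D.IsExact δ := isExact_of_isEquivalence _ inferInstance inferInstance inferInstance
  have he := isEquivalence_map_of_isEquivalence (D := D) (𝟭 J) inferInstance
  have h1 := (h _ (isLan_unit X)).isIso_of_bijective he
  have := isIso_map₂ (D := D) δ inferInstance
  have h2 : IsIso (D.sqL δ) := by unfold sqL; infer_instance
  unfold bcL at h1
  have := IsIso.of_isIso_comp_right ((D.map (𝟭 J)).map ((D.lanAdj u).unit.app X)) ((D.sqL δ).app _)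
  exact isIso_of_reflects_iso _ (D.map (𝟭 J))

/-- Extension by zero along the inclusion of a maximal element. -/
theorem isIso_counit_of_isZero [IsDerivator D] (hD : D.IsPointed) {K : Shape Dia} {P : Type w}
    [PartialOrder P] [Countable P] {p : P} (hp : ∀ q, p ≤ q → q = p)
    (Y : D.obj (K.prod (.poset Dia P)))
    (hY : ∀ q, q ≠ p → IsZero ((D.map (K.sect (A := .poset Dia P) q)).obj Y)) :
    IsIso ((D.lanAdj (Shape.prodMap (𝟭 K) (Shape.incl (K := .poset Dia P) p))).counit.app Y) := by
  let u := Shape.prodMap (𝟭 K) (Shape.incl (K := .poset Dia P) p)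
  have h1 : u.Faithful := ⟨fun {x y} f g h =>
    Prod.ext (congr_arg (fun t : u.obj x ⟶ u.obj y => t.1) h) (Subsingleton.elim _ _)⟩
  have h2 : u.Full := ⟨fun {x y} f => ⟨(f.1, eqToHom (Subsingleton.elim _ _)), Prod.ext rfl (Subsingleton.elim _ _)⟩⟩
  refine isIso_of_sect _ fun q => ?_
  by_cases hq : q = p
  · subst hq
    have e : K.sect (A := .poset Dia P) q ≅ K.sect (A := .point Dia) ⟨PUnit.unit⟩ ⋙ u :=
      NatIso.ofComponents (fun _ => Iso.refl _) fun f => by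
        refine Prod.ext ?_ (Subsingleton.elim _ _)
        simp [u]
    rw [isIso_map_congr_iff e, isIso_map_comp_iff]
    have h3 := (D.lanAdj u).right_triangle_components Y
    have := isIso_unit u ((D.map u).obj Y)
    have h5 : IsIso ((D.lanAdj u).unit.app ((D.map u).obj Y) ≫
        (D.map u).map ((D.lanAdj u).counit.app Y)) := by rw [h3]; exact IsIso.id _
    have := IsIso.of_isIso_comp_left ((D.lanAdj u).unit.app ((D.map u).obj Y))
      ((D.map u).map ((D.lanAdj u).counit.app Y))
    infer_instance
  · refine isIso_of_isZero _ ?_ (hY q hq)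
    let v : Shape.empty Dia ⥤ K.prod (.point Dia) :=
      { obj i := isEmptyElim i, map {i} := isEmptyElim i, map_id i := isEmptyElim i, map_comp {i} := isEmptyElim i }
    let u' : Shape.empty Dia ⥤ K :=
      { obj i := isEmptyElim i, map {i} := isEmptyElim i, map_id i := isEmptyElim i, map_comp {i} := isEmptyElim i }
    let δ : v ⋙ u ⟶ u' ⋙ K.sect (A := .poset Dia P) q :=
      { app i := isEmptyElim i, naturality i := isEmptyElim i }
    have h3 (k : K) : IsEmpty (Shape.slice u' k) := ⟨fun x => isEmptyElim x.left⟩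
    have h4 (k : K) : IsEmpty (Shape.slice u ((K.sect (A := .poset Dia P) q).obj k)) :=
      ⟨fun x => hq (hp q (leOfHom x.hom.2))⟩
    let T (k : K) : Shape.slice u' k ⥤ Shape.slice u ((K.sect (A := .poset Dia P) q).obj k) :=
      { obj i := isEmptyElim i, map {i} := isEmptyElim i, map_id i := isEmptyElim i, map_comp {i} := isEmptyElim i }
    have hT (k : K) : (T k).IsEquivalence :=
      { faithful := ⟨fun {i} => ((h3 k).false i).elim⟩
        full := ⟨fun {i} => ((h3 k).false i).elim⟩
        essSurj := ⟨fun i => isEmptyElim i⟩ }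
    have h5 : D.IsExact δ := isExact_of_comparison δ T (fun k => inferInstance)
      (fun k => CategoryTheory.Functor.ext (fun i => isEmptyElim i) fun i => isEmptyElim i)
      (fun k i => isEmptyElim i)
    exact (h5 _ (isLan_unit _)).isZero_of_empty hD

end zero

/-! ### Suspension and loops -/

end Prederivator

/-- The square `{0,1}²`. -/
abbrev UnitSquare : Type w := ULift.{w} (Bool × Bool)

namespace UnitSquare

/-- An object of the square. -/
abbrev pt (a b : Bool) : UnitSquare.{w} := ⟨(a, b)⟩

/-- The square without its final vertex `(1,1)`. -/
abbrev Span : Type w := {s : UnitSquare.{w} // s ≠ pt true true}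

/-- The square without its initial vertex `(0,0)`. -/
abbrev Cospan : Type w := {s : UnitSquare.{w} // s ≠ pt false false}

end UnitSquare

namespace Shape
variable (Dia : DiagramDomain.{w})

abbrev square : Shape Dia := .poset Dia UnitSquare.{w}
abbrev span : Shape Dia := .poset Dia UnitSquare.Span.{w}
abbrev cospan : Shape Dia := .poset Dia UnitSquare.Cospan.{w}

/-- The inclusion of a subset of a partially ordered set. -/
abbrev subtypeIncl {P : Type w} [PartialOrder P] [Countable P] (p : P → Prop) :
    Shape.poset Dia {x // p x} ⥤ Shape.poset Dia P :=
  (Subtype.mono_coe p).functor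

/-- The inclusion of the span into the square. -/
abbrev spanIncl : span Dia ⥤ square Dia := subtypeIncl Dia _

/-- The inclusion of the cospan into the square. -/
abbrev cospanIncl : cospan Dia ⥤ square Dia := subtypeIncl Dia _

/-- The vertex `(0,0)` of the span. -/
abbrev spanPt : point Dia ⥤ span Dia :=
  incl (K := span Dia) ⟨UnitSquare.pt false false, by decide⟩

/-- The vertex `(1,1)` of the cospan. -/
abbrev cospanPt : point Dia ⥤ cospan Dia :=
  incl (K := cospan Dia) ⟨UnitSquare.pt true true, by decide⟩

end Shape

namespace Prederivator
variable {Dia : DiagramDomain.{w}} (D : Prederivator.{w, v, u} Dia) [IsDerivator D]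

/-- The suspension: extend by zero from `(0,0)` to the span, extend to a cocartesian square, and
evaluate at `(1,1)`. -/
noncomputable def susp : Morphism D D :=
  (((D.const (.point Dia)).comp (D.ranMor (Shape.spanPt Dia))).comp
    (D.lanMor (Shape.spanIncl Dia))).comp (D.eval (UnitSquare.pt true true))

/-- The loop functor: extend by zero from `(1,1)` to the cospan, extend to a cartesian square, and
evaluate at `(0,0)`. -/
noncomputable def loop : Morphism D D :=
  (((D.const (.point Dia)).comp (D.lanMor (Shape.cospanPt Dia))).comp
    (D.ranMor (Shape.cospanIncl Dia))).comp (D.eval (UnitSquare.pt false false))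

variable {D} {K : Shape Dia}

/-- A square is said to have zero corners if it vanishes at `(1,0)` and at `(0,1)`. -/
def HasZeroCorners (Y : D.obj (K.prod (.square Dia))) : Prop :=
  IsZero ((D.map (K.sect (UnitSquare.pt true false))).obj Y) ∧
    IsZero ((D.map (K.sect (UnitSquare.pt false true))).obj Y)

/-- The value of a square at a vertex. -/
abbrev vertex (Y : D.obj (K.prod (.square Dia))) (a b : Bool) : D.obj K :=
  (D.map (K.sect (UnitSquare.pt a b))).obj Y

def cornerCell (K : Shape Dia) :
    K.fst (.point Dia) ⋙ K.sect (A := .square Dia) (UnitSquare.pt true true) ≅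
      Shape.prodMap (𝟭 K) (Shape.cospanPt Dia) ⋙ Shape.prodMap (𝟭 K) (Shape.cospanIncl Dia) :=
  NatIso.ofComponents (fun _ => Iso.refl _) fun f => by
    refine Prod.ext ?_ (Subsingleton.elim _ _)
    simp

/-- The canonical morphism from the extension by zero of the value at `(1,1)` to the restriction
to the cospan. -/
noncomputable def cospanComparison (Y : D.obj (K.prod (.square Dia))) :
    (D.lan (Shape.prodMap (𝟭 K) (Shape.cospanPt Dia))).obj
      ((D.map (K.fst (.point Dia))).obj (vertex Y true true)) ⟶
      (D.map (Shape.prodMap (𝟭 K) (Shape.cospanIncl Dia))).obj Y :=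
  ((D.lanAdj (Shape.prodMap (𝟭 K) (Shape.cospanPt Dia))).homEquiv _ _).symm
    ((D.sqL (cornerCell K).hom).app Y)

theorem isIso_cospanComparison (hD : D.IsPointed) (Y : D.obj (K.prod (.square Dia)))
    (hY : HasZeroCorners Y) : IsIso (cospanComparison Y) := by
  have h1 := isIso_map₂ (D := D) (cornerCell K).hom inferInstance
  have h2 : IsIso ((D.sqL (cornerCell K).hom).app Y) := by unfold sqL; infer_instance
  have h3 : IsIso ((D.lanAdj (Shape.prodMap (𝟭 K) (Shape.cospanPt Dia))).counit.app
      ((D.map (Shape.prodMap (𝟭 K) (Shape.cospanIncl Dia))).obj Y)) := by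
    refine isIso_counit_of_isZero hD ?_ _ ?_
    · rintro ⟨⟨⟨a, b⟩⟩, hs⟩ ⟨h4, h5⟩
      have h6 : ∀ a b, true ≤ a → true ≤ b → a = true ∧ b = true := by decide
      obtain ⟨rfl, rfl⟩ := h6 a b h4 h5
      rfl
    · rintro ⟨⟨⟨a, b⟩⟩, hs⟩ hq
      have e : K.sect (A := .cospan Dia) ⟨⟨(a, b)⟩, hs⟩ ⋙
          Shape.prodMap (𝟭 K) (Shape.cospanIncl Dia) ≅ K.sect (A := .square Dia) (UnitSquare.pt a b) :=
        NatIso.ofComponents (fun _ => Iso.refl _) fun f => by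
          refine Prod.ext ?_ (Subsingleton.elim _ _)
          simp
      rw [← isZero_map_comp_iff, isZero_map_congr_iff e]
      cases a <;> cases b
      · exact absurd rfl hs
      · exact hY.2
      · exact hY.1
      · exact absurd rfl hq
  rw [cospanComparison, Adjunction.homEquiv_counit]
  infer_instance

/-- The canonical comparison `Y₀₀ ⟶ Ω Y₁₁` of a square with zero corners. -/
noncomputable def loopComparison (hD : D.IsPointed) (Y : D.obj (K.prod (.square Dia)))
    (hY : HasZeroCorners Y) : vertex Y false false ⟶ (D.loop.app K).obj (vertex Y true true) :=
  have := isIso_cospanComparison hD Y hY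
  (D.map (K.sect (UnitSquare.pt false false))).map
    ((D.ranAdj (Shape.prodMap (𝟭 K) (Shape.cospanIncl Dia))).unit.app Y ≫
      (D.ran (Shape.prodMap (𝟭 K) (Shape.cospanIncl Dia))).map (inv (cospanComparison Y)))

/-- The unit of the right Kan extension from the cospan to the square is invertible at the initial
vertex. -/
def IsCartesianAt (Y : D.obj (K.prod (.square Dia))) : Prop :=
  IsIso ((D.map (K.sect (UnitSquare.pt false false))).map
    ((D.ranAdj (Shape.prodMap (𝟭 K) (Shape.cospanIncl Dia))).unit.app Y))

theorem isIso_loopComparison_iff (hD : D.IsPointed) (Y : D.obj (K.prod (.square Dia)))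
    (hY : HasZeroCorners Y) : IsIso (loopComparison hD Y hY) ↔ IsCartesianAt Y := by
  have := isIso_cospanComparison hD Y hY
  unfold loopComparison IsCartesianAt
  rw [Functor.map_comp]
  have h1 : IsIso ((D.ran (Shape.prodMap (𝟭 K) (Shape.cospanIncl Dia))).map
    (inv (cospanComparison Y))) := inferInstance
  have h2 := Functor.map_isIso (D.map (K.sect (UnitSquare.pt false false))) ((D.ran (Shape.prodMap (𝟭 K)
    (Shape.cospanIncl Dia))).map (inv (cospanComparison Y)))
  exact @isIso_comp_right_iff _ _ _ _ _ _ _ h2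

theorem unit_rmate {J₁ J₂ K₁ K₂ : Shape Dia} {v : J₁ ⥤ J₂} {u₁ : J₁ ⥤ K₁} {u₂ : J₂ ⥤ K₂}
    {t : K₁ ⥤ K₂} (δ : u₁ ⋙ t ⟶ v ⋙ u₂) (Y : D.obj K₂) :
    (D.map t).map ((D.ranAdj u₂).unit.app Y) ≫ (D.rmate δ).app ((D.map u₂).obj Y) =
      (D.ranAdj u₁).unit.app ((D.map t).obj Y) ≫ (D.ran u₁).map ((D.sqR δ).app Y) :=
  unit_mateEquiv (D.ranAdj u₂) (D.ranAdj u₁) (.mk _ _ _ _ (D.sqR δ)) Y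

theorem isIso_ran_unit_iff {J₁ J₂ K₁ K₂ : Shape Dia} {v : J₁ ⥤ J₂} {u₁ : J₁ ⥤ K₁} {u₂ : J₂ ⥤ K₂}
    {t : K₁ ⥤ K₂} (δ : u₁ ⋙ t ⟶ v ⋙ u₂) [IsIso δ] (h : IsIso (D.rmate δ)) (Y : D.obj K₂)
    {C : Type*} [Category C] (F : D.obj K₁ ⥤ C) :
    IsIso (F.map ((D.ranAdj u₁).unit.app ((D.map t).obj Y))) ↔
      IsIso (F.map ((D.map t).map ((D.ranAdj u₂).unit.app Y))) := by
  have h1 := isIso_map₂ (D := D) δ inferInstance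
  have h2 : IsIso ((D.sqR δ).app Y) := by unfold sqR; infer_instance
  have h3 := congr_arg F.map (unit_rmate δ Y)
  rw [F.map_comp, F.map_comp] at h3
  rw [← isIso_comp_right_iff _ (F.map ((D.ran u₁).map ((D.sqR δ).app Y))), ← h3]
  exact @isIso_comp_right_iff _ _ _ _ _ _ _ (Functor.map_isIso F _)

theorem isIso_rmate_of_isEquivalence {J₁ J₂ K₁ K₂ : Shape Dia} {v : J₁ ⥤ J₂} {u₁ : J₁ ⥤ K₁}
    {u₂ : J₂ ⥤ K₂} {t : K₁ ⥤ K₂} (δ : u₁ ⋙ t ⟶ v ⋙ u₂) [IsIso δ] (ht : t.IsEquivalence)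
    (hv : v.IsEquivalence) : IsIso (D.rmate δ) := by
  refine (isExact_iff_rmate (D := D) δ).1 fun X Y c hc => ?_
  have h1 := isIso_map₂ (D := D) δ inferInstance
  have h2 : IsIso ((D.sqL δ).app Y) := by unfold sqL; infer_instance
  have h3 := hc.isIso_of_bijective (isEquivalence_map_of_isEquivalence t ht)
  have h4 := isEquivalence_map_of_isEquivalence (D := D) v hv
  have h5 : IsIso (bcL δ c) := by unfold bcL; infer_instance
  refine fun Z => ?_
  have h6 : Function.Bijective fun g : (D.map v).obj ((D.map u₂).obj Y) ⟶ (D.map v).obj Z =>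
      bcL δ c ≫ g :=
    ⟨fun a b hab => (cancel_epi (bcL δ c)).1 hab, fun g => ⟨inv (bcL δ c) ≫ g, by simp⟩⟩
  exact h6.comp ⟨(D.map v).map_injective, (D.map v).map_surjective⟩

theorem isCartesianAt_map_iff {J : Shape Dia} (u : J ⥤ K) (Y : D.obj (K.prod (.square Dia))) :
    IsCartesianAt ((D.map (Shape.prodMap u (𝟭 (Shape.square Dia)))).obj Y) ↔
      IsIso ((D.map u).map ((D.map (K.sect (UnitSquare.pt false false))).map
        ((D.ranAdj (Shape.prodMap (𝟭 K) (Shape.cospanIncl Dia))).unit.app Y))) := by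
  have : IsIso (prodCell' u (Shape.cospanIncl Dia)) := IsIso.id _
  unfold IsCartesianAt
  rw [isIso_ran_unit_iff (prodCell' u (Shape.cospanIncl Dia)) (isIso_rmate_prodCell' _ u) Y,
    ← isIso_map_comp_iff, ← isIso_map_comp_iff]
  rfl

theorem isCartesianAt_of_isZero (hD : D.IsPointed) {Y : D.obj (K.prod (.square Dia))}
    (hY : IsZero Y) : IsCartesianAt Y := by
  have := isIso_of_isZero ((D.ranAdj (Shape.prodMap (𝟭 K) (Shape.cospanIncl Dia))).unit.app Y) hY
    (hD.isZero_ran _ (isZero_map _ hY))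
  unfold IsCartesianAt
  infer_instance

end Prederivator

/-- The exchange of the two coordinates. -/
def UnitSquare.flip : UnitSquare.{w} ≃o UnitSquare.{w} where
  toFun s := ⟨s.down.swap⟩
  invFun s := ⟨s.down.swap⟩
  left_inv _ := rfl
  right_inv _ := rfl
  map_rel_iff' := and_comm

def UnitSquare.flipCospan : UnitSquare.Cospan.{w} ≃o UnitSquare.Cospan.{w} where
  toFun s := ⟨UnitSquare.flip s.1, fun h => s.2 (UnitSquare.flip.injective h)⟩
  invFun s := ⟨UnitSquare.flip s.1, fun h => s.2 (UnitSquare.flip.injective h)⟩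
  left_inv _ := rfl
  right_inv _ := rfl
  map_rel_iff' := and_comm

/-- The poset `V` of pairs of integers `(i, j)` with `|i - j| ≤ 1`. -/
abbrev Band : Type w := ULift.{w} {p : ℤ × ℤ // |p.1 - p.2| ≤ 1}

namespace Band

/-- The boundary `∂V`: pairs with `|i - j| = 1`. -/
abbrev Boundary : Type w := {x : Band.{w} // |x.down.1.1 - x.down.1.2| = 1}

/-- The automorphism `(i, j) ↦ (j + 1, i + 1)`. -/
def shift : Band.{w} ≃o Band.{w} where
  toFun x := ⟨⟨(x.down.1.2 + 1, x.down.1.1 + 1), by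
    have := abs_le.1 x.down.2
    exact abs_le.2 (by constructor <;> dsimp only <;> omega)⟩⟩
  invFun x := ⟨⟨(x.down.1.2 - 1, x.down.1.1 - 1), by
    have := abs_le.1 x.down.2
    exact abs_le.2 (by constructor <;> dsimp only <;> omega)⟩⟩
  left_inv x := by ext <;> simp
  right_inv x := by ext <;> simp
  map_rel_iff' {x y} := by
    change (_ + 1 ≤ _ + 1 ∧ _ + 1 ≤ _ + 1) ↔ (_ ∧ _)
    rw [add_le_add_iff_right, add_le_add_iff_right]
    exact and_comm

/-- The map `w`, with `w(0,0,i,j) = (i,j)`, `w(1,0,i,j) = (j+1,j)`, `w(0,1,i,j) = (i,i+1)` and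
`w(1,1,i,j) = (j+1,i+1)`. -/
def squareMap (s : UnitSquare.{w}) (x : Band.{w}) : Band.{w} :=
  ⟨⟨(bif s.down.1 then x.down.1.2 + 1 else x.down.1.1,
    bif s.down.2 then x.down.1.1 + 1 else x.down.1.2), by
      obtain ⟨⟨⟨i, j⟩, h⟩⟩ := x
      obtain ⟨⟨a, b⟩⟩ := s
      have := abs_le.1 h
      cases a <;> cases b <;> exact abs_le.2 (by constructor <;> simp <;> omega)⟩⟩

theorem squareMap_mono {s s' : UnitSquare.{w}} {x x' : Band.{w}} (hs : s ≤ s') (hx : x ≤ x') :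
    squareMap s x ≤ squareMap s' x' := by
  obtain ⟨⟨⟨i, j⟩, h⟩⟩ := x
  obtain ⟨⟨⟨i', j'⟩, h'⟩⟩ := x'
  obtain ⟨⟨a, b⟩⟩ := s
  obtain ⟨⟨a', b'⟩⟩ := s'
  obtain ⟨ha, hb⟩ : a ≤ a' ∧ b ≤ b' := hs
  obtain ⟨hi, hj⟩ : i ≤ i' ∧ j ≤ j' := hx
  have := abs_le.1 h
  have := abs_le.1 h'
  dsimp only at *
  change (bif a then j + 1 else i) ≤ (bif a' then j' + 1 else i') ∧
    (bif b then i + 1 else j) ≤ (bif b' then i' + 1 else j')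
  revert ha hb
  cases a <;> cases a' <;> cases b <;> cases b' <;> simp <;> omega

end Band

namespace Shape
variable (Dia : DiagramDomain.{w})

/-- The shape `V`. -/
noncomputable abbrev band : Shape Dia := .poset Dia Band.{w}

/-- The shape `∂V`. -/
noncomputable abbrev boundary : Shape Dia := .poset Dia Band.Boundary.{w}

noncomputable abbrev boundaryIncl : boundary Dia ⥤ band Dia := subtypeIncl Dia _

/-- The functor `σ : V ⥤ V`. -/
noncomputable abbrev bandShift : band Dia ⥤ band Dia := Band.shift.monotone.functor

/-- The exchange of coordinates, on the square and on the cospan. -/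
abbrev flip : square Dia ⥤ square Dia := UnitSquare.flip.monotone.functor
abbrev flipCospan : cospan Dia ⥤ cospan Dia := UnitSquare.flipCospan.monotone.functor

variable {Dia}

/-- The functor `K × □ × V ⥤ K × V` given by `w`. -/
noncomputable abbrev bandSquare (K : Shape Dia) : (K.prod (square Dia)).prod (band Dia) ⥤ K.prod (band Dia) where
  obj x := (x.1.1, Band.squareMap x.1.2 x.2)
  map f := (f.1.1, homOfLE (Band.squareMap_mono (leOfHom f.1.2) (leOfHom f.2)))
  map_id _ := Prod.ext rfl (Subsingleton.elim _ _)
  map_comp _ _ := Prod.ext rfl (Subsingleton.elim _ _)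

/-- The functor to a product with a partially ordered set that has the given components. -/
abbrev prodLift {J K : Shape Dia} {P : Type w} [PartialOrder P] [Countable P] (f : J ⥤ K) (p : J → P)
    (hp : ∀ {x y : J}, (x ⟶ y) → p x ≤ p y) : J ⥤ K.prod (poset Dia P) where
  obj x := (f.obj x, p x)
  map g := (f.map g, homOfLE (hp g))
  map_id x := Prod.ext (f.map_id x) (Subsingleton.elim _ _)
  map_comp g h := Prod.ext (f.map_comp g h) (Subsingleton.elim _ _)

theorem prodLift_congr {J K : Shape Dia} {P : Type w} [PartialOrder P] [Countable P] (f : J ⥤ K)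
    {p q : J → P} (h : p = q) (hp : ∀ {x y : J}, (x ⟶ y) → p x ≤ p y)
    (hq : ∀ {x y : J}, (x ⟶ y) → q x ≤ q y) : prodLift f p hp = prodLift f q hq := by
  subst h
  rfl

theorem prodMap_isEquivalence {J K A B : Shape Dia} {u : J ⥤ K} {f : A ⥤ B} (hu : u.IsEquivalence)
    (hf : f.IsEquivalence) : (prodMap u f).IsEquivalence where
  faithful := ⟨fun {_ _ _ _} h => Prod.ext (u.map_injective (congr_arg (fun x => x.1) h))
    (f.map_injective (congr_arg (fun x => x.2) h))⟩
  full := ⟨fun g => ⟨(u.preimage g.1, f.preimage g.2), Prod.ext (u.map_preimage _) (f.map_preimage _)⟩⟩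
  essSurj := ⟨fun y => ⟨(u.objPreimage y.1, f.objPreimage y.2),
    ⟨Iso.prod (u.objObjPreimageIso y.1) (f.objObjPreimageIso y.2)⟩⟩⟩

theorem isEquivalence_orderIso {P Q : Type w} [PartialOrder P] [Countable P] [PartialOrder Q]
    [Countable Q] (e : P ≃o Q) :
    (e.monotone.functor : (poset Dia P).carrier ⥤ (poset Dia Q).carrier).IsEquivalence :=
  e.equivalence.isEquivalence_functor

end Shape

namespace Prederivator

variable {Dia : DiagramDomain.{w}} {D : Prederivator.{w, v, u} Dia} {K : Shape Dia}

theorem map_eq_of_eq {J K : Shape Dia} {u v : J ⥤ K} (h : u = v) (X : D.obj K) :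
    (D.map u).obj X = (D.map v).obj X := by rw [h]

theorem map_map_eq {I J J' K : Shape Dia} {u : I ⥤ J} {v : J ⥤ K} {u' : I ⥤ J'} {v' : J' ⥤ K}
    (h : u ⋙ v = u' ⋙ v') (X : D.obj K) :
    (D.map u).obj ((D.map v).obj X) = (D.map u').obj ((D.map v').obj X) := by
  have h1 := Functor.congr_obj (D.map_comp u v) X
  have h2 := Functor.congr_obj (D.map_comp u' v') X
  exact h1.symm.trans ((map_eq_of_eq h X).trans h2)

theorem map_eq_map_map {I J K : Shape Dia} {u : I ⥤ J} {v : J ⥤ K} {t : I ⥤ K}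
    (h : u ⋙ v = t) (X : D.obj K) : (D.map u).obj ((D.map v).obj X) = (D.map t).obj X := by
  subst h
  exact (Functor.congr_obj (D.map_comp u v) X).symm

/-- The restriction `w^* X` of `X` along `w : □ × V ⥤ V`. -/
noncomputable abbrev bandSquare (X : D.obj (K.prod (.band Dia))) :
    (D.shift (.band Dia)).obj (K.prod (.square Dia)) :=
  (D.map K.bandSquare).obj X

/-- The functor `σ^*`. -/
noncomputable abbrev bandShift (D : Prederivator.{w, v, u} Dia) (K : Shape Dia) :
    D.obj (K.prod (.band Dia)) ⥤ D.obj (K.prod (.band Dia)) :=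
  D.map (Shape.prodMap (𝟭 K) (Shape.bandShift Dia))

/-- Prespectrum objects: the restriction to `∂V` vanishes. -/
def IsPrespectrum (X : D.obj (K.prod (.band Dia))) : Prop :=
  IsZero ((D.map (Shape.prodMap (𝟭 K) (Shape.boundaryIncl Dia))).obj X)


theorem vertex_bandSquare_false_false (X : D.obj (K.prod (.band Dia))) :
    X = vertex (D := D.shift (.band Dia)) (bandSquare X) false false := by
  refine (Functor.congr_obj (D.map_id (K.prod (.band Dia))) X).symm.trans
    (map_eq_map_map (D := D) (u := Shape.prodMap (K.sect _) (𝟭 _)) ?_ X).symm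
  exact CategoryTheory.Functor.ext (fun _ => rfl) fun _ _ f => Prod.ext ((Category.id_comp _).trans (Category.comp_id _)).symm (Subsingleton.elim _ _)

theorem vertex_bandSquare_true_true (X : D.obj (K.prod (.band Dia))) :
    vertex (D := D.shift (.band Dia)) (bandSquare X) true true = (D.bandShift K).obj X := by
  refine map_eq_map_map (D := D) (u := Shape.prodMap (K.sect _) (𝟭 _)) ?_ X
  exact CategoryTheory.Functor.ext (fun _ => rfl) fun _ _ f => Prod.ext ((Category.id_comp _).trans (Category.comp_id _)).symm (Subsingleton.elim _ _)

variable [IsDerivator D] {X : D.obj (K.prod (.band Dia))}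

theorem IsPrespectrum.isZero_map (hX : IsPrespectrum X) {J : Shape Dia} (t : J ⥤ K.prod (.band Dia))
    (ht : ∀ j, |(t.obj j).2.down.1.1 - (t.obj j).2.down.1.2| = 1) : IsZero ((D.map t).obj X) := by
  let t' : J ⥤ K.prod (.boundary Dia) :=
    { obj j := ((t.obj j).1, ⟨(t.obj j).2, ht j⟩)
      map f := ((t.map f).1, homOfLE (leOfHom (t.map f).2))
      map_id j := Prod.ext (congr_arg (fun f => f.1) (t.map_id j)) (Subsingleton.elim _ _)
      map_comp f g := Prod.ext (congr_arg (fun f => f.1) (t.map_comp f g)) (Subsingleton.elim _ _) }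
  have h : t' ⋙ Shape.prodMap (𝟭 K) (Shape.boundaryIncl Dia) = t :=
    CategoryTheory.Functor.ext (fun _ => rfl) fun _ _ f => Prod.ext (((Category.id_comp _).trans (Category.comp_id _)).symm) (Subsingleton.elim _ _)
  rw [← map_eq_map_map h]
  exact Prederivator.isZero_map _ hX

theorem IsPrespectrum.hasZeroCorners (hX : IsPrespectrum X) :
    HasZeroCorners (D := D.shift (.band Dia)) (bandSquare X) := by
  constructor
  all_goals
    change IsZero ((D.map (Shape.prodMap _ _)).obj ((D.map _).obj X))
    rw [← isZero_map_comp_iff]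
    refine hX.isZero_map _ fun j => ?_
    simp [Band.squareMap]

/-- The canonical comparison `X ⟶ Ω Y₁₁` -/
noncomputable def squareComparison (hD : D.IsPointed) {K : Shape Dia} (Y : D.obj (K.prod (.square Dia)))
    (hY : HasZeroCorners Y) {A B : D.obj K} (hA : A = vertex Y false false)
    (hB : vertex Y true true = B) : A ⟶ (D.loop.app K).obj B :=
  eqToHom hA ≫ loopComparison hD Y hY ≫ (D.loop.app K).map (eqToHom hB)

/-- The canonical comparison `φ : X ⟶ Ω σ^* X` of a prespectrum object. -/
noncomputable def spectrumComparison (hD : D.IsPointed) (hX : IsPrespectrum X) :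
    X ⟶ ((D.shift (.band Dia)).loop.app K).obj ((D.bandShift K).obj X) :=
  squareComparison (hD.shift _) (bandSquare X) hX.hasZeroCorners
    (vertex_bandSquare_false_false X) (vertex_bandSquare_true_true X)

theorem isIso_squareComparison_iff (hD : D.IsPointed) {K : Shape Dia}
    (Y : D.obj (K.prod (.square Dia))) (hY : HasZeroCorners Y) {A B : D.obj K}
    (hA : A = vertex Y false false) (hB : vertex Y true true = B) :
    IsIso (squareComparison hD Y hY hA hB) ↔ IsCartesianAt Y := by
  subst hA hB
  rw [← isIso_loopComparison_iff hD Y hY]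
  simp [squareComparison]

/-- Spectrum objects: prespectrum objects for which the comparison `X ⟶ Ω σ^* X` is invertible. -/
def IsOmegaSpectrum (hD : D.IsPointed) (X : D.obj (K.prod (.band Dia))) : Prop :=
  ∃ hX : IsPrespectrum X, IsIso (spectrumComparison hD hX)

theorem isOmegaSpectrum_iff (hD : D.IsPointed) (X : D.obj (K.prod (.band Dia))) :
    IsOmegaSpectrum hD X ↔
      IsPrespectrum X ∧ IsCartesianAt (D := D.shift (.band Dia)) (bandSquare X) :=
  ⟨fun ⟨h, h'⟩ => ⟨h, (isIso_squareComparison_iff _ _ _ _ _).1 h'⟩,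
    fun ⟨h, h'⟩ => ⟨h, (isIso_squareComparison_iff _ _ _ _ _).2 h'⟩⟩

theorem IsPrespectrum.map (hX : IsPrespectrum X) {J : Shape Dia} (t : J.prod (.band Dia) ⥤ K.prod (.band Dia))
    (ht : ∀ x, |x.2.down.1.1 - x.2.down.1.2| = 1 →
      |(t.obj x).2.down.1.1 - (t.obj x).2.down.1.2| = 1) :
    IsPrespectrum ((D.map t).obj X) := by
  unfold IsPrespectrum
  rw [← isZero_map_comp_iff]
  exact hX.isZero_map _ fun j => ht _ j.2.2

theorem IsOmegaSpectrum.map {hD : D.IsPointed} (hX : IsOmegaSpectrum hD X) {J : Shape Dia} (u : J ⥤ K) :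
    IsOmegaSpectrum hD ((D.map (Shape.prodMap u (𝟭 (Shape.band Dia)))).obj X) := by
  rw [isOmegaSpectrum_iff] at hX ⊢
  refine ⟨hX.1.map _ fun x hx => hx, ?_⟩
  have h := isCartesianAt_map_iff (D := D.shift (.band Dia)) u (bandSquare X)
  have h1 : bandSquare ((D.map (Shape.prodMap u (𝟭 (Shape.band Dia)))).obj X) =
      ((D.shift (.band Dia)).map (Shape.prodMap u (𝟭 (Shape.square Dia)))).obj (bandSquare X) :=
    map_map_eq (D := D) (u := J.bandSquare) (v := Shape.prodMap u (𝟭 (Shape.band Dia)))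
      (u' := Shape.prodMap (Shape.prodMap u (𝟭 (Shape.square Dia))) (𝟭 (Shape.band Dia)))
      (v' := K.bandSquare) rfl X
  rw [h1, h]
  have := hX.2
  unfold IsCartesianAt at this
  infer_instance

theorem isOmegaSpectrum_of_sect {hD : D.IsPointed} {A : Shape Dia}
    {X : D.obj ((K.prod A).prod (.band Dia))}
    (h : ∀ a : A, IsOmegaSpectrum hD ((D.map (Shape.prodMap (K.sect a) (𝟭 (Shape.band Dia)))).obj X)) :
    IsOmegaSpectrum hD X := by
  rw [isOmegaSpectrum_iff]
  refine ⟨?_, ?_⟩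
  · have h3 (x : (K.prod A).prod (.boundary Dia)) : IsZero ((D.map (Shape.incl x)).obj
        ((D.map (Shape.prodMap (𝟭 (K.prod A)) (Shape.boundaryIncl Dia))).obj X)) := by
      obtain ⟨h4, -⟩ := h x.1.2
      have h5 := h4.isZero_map (Shape.incl (x.1.1, x.2.1)) fun _ => x.2.2
      let e : Shape.incl (K := K.prod (.band Dia)) (x.1.1, x.2.1) ⋙
          Shape.prodMap (K.sect x.1.2) (𝟭 (Shape.band Dia)) ≅
          Shape.incl x ⋙ Shape.prodMap (𝟭 (K.prod A)) (Shape.boundaryIncl Dia) :=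
        Discrete.natIso fun _ => Iso.refl _
      rwa [← isZero_map_comp_iff, ← isZero_map_congr_iff e, isZero_map_comp_iff]
    obtain ⟨Z, hZ⟩ := hD.exists_isZero ((K.prod A).prod (.boundary Dia))
    have := IsDerivator.der2 (hZ.to_ ((D.map (Shape.prodMap (𝟭 (K.prod A)) (Shape.boundaryIncl Dia))).obj X))
      fun x => isIso_of_isZero _ (isZero_map _ hZ) (h3 x)
    exact hZ.of_iso (asIso (hZ.to_ _)).symm
  · refine isIso_of_sect (D := D.shift (.band Dia)) _ fun a => ?_
    have h2 := isCartesianAt_map_iff (D := D.shift (.band Dia)) (K.sect a) (bandSquare X)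
    rw [← h2]
    have h1 : bandSquare ((D.map (Shape.prodMap (K.sect a) (𝟭 (Shape.band Dia)))).obj X) =
      ((D.shift (.band Dia)).map (Shape.prodMap (K.sect a) (𝟭 (Shape.square Dia)))).obj (bandSquare X) :=
      map_map_eq (D := D) (u := K.bandSquare) (v := Shape.prodMap (K.sect a) (𝟭 (Shape.band Dia)))
        (u' := Shape.prodMap (Shape.prodMap (K.sect a) (𝟭 (Shape.square Dia))) (𝟭 (Shape.band Dia)))
        (v' := (K.prod A).bandSquare) rfl X
    rw [← h1]
    exact ((isOmegaSpectrum_iff hD _).1 (h a)).2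

theorem isOmegaSpectrum_of_isZero (hD : D.IsPointed) (hX : IsZero X) : IsOmegaSpectrum hD X :=
  (isOmegaSpectrum_iff hD X).2 ⟨isZero_map _ hX, isCartesianAt_of_isZero (hD.shift _) (isZero_map _ hX)⟩

theorem IsOmegaSpectrum.bandShift {hD : D.IsPointed} (hX : IsOmegaSpectrum hD X) :
    IsOmegaSpectrum hD ((D.bandShift K).obj X) := by
  rw [isOmegaSpectrum_iff] at hX ⊢
  refine ⟨hX.1.map _ fun x hx => ?_, ?_⟩
  · change |x.2.down.1.2 + 1 - (x.2.down.1.1 + 1)| = 1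
    rw [add_sub_add_right_eq_sub, abs_sub_comm, hx]
  let t : (K.prod (.square Dia)).prod (.band Dia) ⥤ (K.prod (.square Dia)).prod (.band Dia) :=
    Shape.prodMap (Shape.prodMap (𝟭 K) (Shape.flip Dia)) (Shape.bandShift Dia)
  let t' : (K.prod (.cospan Dia)).prod (.band Dia) ⥤ (K.prod (.cospan Dia)).prod (.band Dia) :=
    Shape.prodMap (Shape.prodMap (𝟭 K) (Shape.flipCospan Dia)) (Shape.bandShift Dia)
  let i : (K.prod (.cospan Dia)).prod (.band Dia) ⥤ (K.prod (.square Dia)).prod (.band Dia) :=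
    Shape.prodMap (Shape.prodMap (𝟭 K) (Shape.cospanIncl Dia)) (𝟭 (Shape.band Dia))
  let δ : i ⋙ t ⟶ t' ⋙ i := 𝟙 _
  have : IsIso δ := IsIso.id _
  have ht : t.IsEquivalence := Shape.prodMap_isEquivalence
    (Shape.prodMap_isEquivalence inferInstance (Shape.isEquivalence_orderIso UnitSquare.flip))
    (Shape.isEquivalence_orderIso Band.shift)
  have ht' : t'.IsEquivalence := Shape.prodMap_isEquivalence
    (Shape.prodMap_isEquivalence inferInstance (Shape.isEquivalence_orderIso UnitSquare.flipCospan))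
    (Shape.isEquivalence_orderIso Band.shift)
  have h1 : bandSquare ((D.bandShift K).obj X) = (D.map t).obj (bandSquare X) := by
    refine map_map_eq (D := D) (u := K.bandSquare) (u' := t) (v' := K.bandSquare) ?_ X
    refine Shape.prodLift_congr (J := (K.prod (.square Dia)).prod (.band Dia)) (P := Band.{w})
      (Shape.fst _ _ ⋙ Shape.fst _ _)
      (p := fun x => Band.shift (Band.squareMap x.1.2 x.2))
      (q := fun x => Band.squareMap (UnitSquare.flip x.1.2) (Band.shift x.2))
      (funext ?_)
      (fun f => Band.shift.monotone (Band.squareMap_mono (leOfHom f.1.2) (leOfHom f.2)))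
      (fun f => Band.squareMap_mono (UnitSquare.flip.monotone (leOfHom f.1.2))
        (Band.shift.monotone (leOfHom f.2)))
    rintro ⟨⟨_, ⟨⟨a, b⟩⟩⟩, _⟩
    cases a <;> cases b <;> rfl
  rw [h1]
  let F := D.map (Shape.prodMap (K.sect (A := .square Dia) (UnitSquare.pt false false)) (𝟭 (Shape.band Dia)))
  refine (isIso_ran_unit_iff (D := D) δ (isIso_rmate_of_isEquivalence δ ht ht') (bandSquare X) F).2 ?_
  have h2 := hX.2
  unfold IsCartesianAt at h2
  change IsIso (F.map _) at h2
  rw [← isIso_map_comp_iff]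
  have h3 := (isIso_map_comp_iff (Shape.prodMap (𝟭 K) (Shape.bandShift Dia)) (Shape.prodMap (K.sect (A := .square Dia) (UnitSquare.pt false false)) (𝟭 (Shape.band Dia))) _).2
    (@Functor.map_isIso _ _ _ _ _ _ (D.map (Shape.prodMap (𝟭 K) (Shape.bandShift Dia))) _ h2)
  exact h3

theorem IsOmegaSpectrum.bandSquare {hD : D.IsPointed} (hX : IsOmegaSpectrum hD X) :
    IsOmegaSpectrum hD (bandSquare X) := by
  refine isOmegaSpectrum_of_sect fun s => ?_
  obtain ⟨⟨a, b⟩⟩ := s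
  cases a <;> cases b
  · exact (congr_arg (IsOmegaSpectrum hD) (vertex_bandSquare_false_false X)).mp hX
  · exact isOmegaSpectrum_of_isZero hD hX.1.hasZeroCorners.2
  · exact isOmegaSpectrum_of_isZero hD hX.1.hasZeroCorners.1
  · exact (congr_arg (IsOmegaSpectrum hD) (vertex_bandSquare_true_true X)).mpr hX.bandShift

theorem full_swap {C : Type*} [Category C] (P : ObjectProperty C) {X Y Y' Z : P.FullSubcategory}
    (f : X ⟶ Y) (h : Y = Z) (k : X = Y') (g : Y' ⟶ Z)
    (H : f.hom ≫ eqToHom (congr_arg (fun A => A.obj) h) =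
      eqToHom (congr_arg (fun A => A.obj) k) ≫ g.hom) : f ≫ eqToHom h = eqToHom k ≫ g := by
  subst h k
  apply P.hom_ext
  simpa using H

/-- The property of being a spectrum object, at the level `K`. -/
abbrev omegaSpectra (hD : D.IsPointed) (K : Shape Dia) : ObjectProperty (D.obj (K.prod (.band Dia))) :=
  fun X => IsOmegaSpectrum hD X

/-- The prederivator of spectrum objects of a pointed derivator: the full subprederivator of
`K ↦ D (K × V)` on the prespectrum objects whose canonical comparison `X ⟶ Ω σ^* X` is invertible. -/
noncomputable def St (D : Prederivator.{w, v, u} Dia) [IsDerivator D] (hD : D.IsPointed) :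
    Prederivator.{w, v, u} Dia :=
  (D.shift (.band Dia)).full (omegaSpectra hD) fun u _ hX => hX.map u

namespace St

/-- The morphism `σ^*` on spectrum objects. -/
noncomputable def bandShift (D : Prederivator.{w, v, u} Dia) [IsDerivator D] (hD : D.IsPointed) :
    Morphism (D.St hD) (D.St hD) :=
  .ofEq (D := D.St hD) (E := D.St hD)
    (fun K => (omegaSpectra hD K).lift ((omegaSpectra hD K).ι ⋙ D.bandShift K)
      fun X => X.property.bandShift)
    (fun {J K} u => lift_eqToHom (omegaSpectra hD K) (omegaSpectra hD J)
      (F := D.map (Shape.prodMap u (𝟭 (Shape.band Dia))) ⋙ D.bandShift J)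
      (F' := D.bandShift K ⋙ D.map (Shape.prodMap u (𝟭 (Shape.band Dia))))
      ((D.map_comp (Shape.prodMap (𝟭 J) (Shape.bandShift Dia)) (Shape.prodMap u (𝟭 _))).symm.trans
        (D.map_comp (Shape.prodMap u (𝟭 _)) (Shape.prodMap (𝟭 K) (Shape.bandShift Dia))))
      (fun X hX => (hX.map u).bandShift) (fun X hX => hX.bandShift.map u))
    (fun {J K u v} α X => full_swap (omegaSpectra hD J) _ _ _ _ <| by
      exact map₂_swap (D := D) (p := Shape.prodMap (𝟭 _) (Shape.bandShift Dia))
        (q := Shape.prodMap (𝟭 _) (Shape.bandShift Dia)) (β := Shape.prodWhisker α (.band Dia))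
        (α := Shape.prodWhisker α (.band Dia)) rfl rfl (by ext <;> simp) X.obj _ _)

variable {hD : D.IsPointed}

theorem isZero_of_isZero {X : (D.St hD).obj K}
    (h : IsZero (C := D.obj (K.prod (.band Dia))) X.obj) : IsZero X :=
  IsZero.of_full_of_faithful_of_isZero (omegaSpectra hD K).ι X h


/-- The square of spectrum objects obtained from a spectrum object by restriction along `w`. -/
noncomputable abbrev square (X : (D.St hD).obj K) : (D.St hD).obj (K.prod (.square Dia)) :=
  ⟨Prederivator.bandSquare X.obj, X.property.bandSquare⟩

theorem hasZeroCorners (X : (D.St hD).obj K) : HasZeroCorners (D := D.St hD) (square X) :=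
  ⟨isZero_of_isZero X.property.1.hasZeroCorners.1, isZero_of_isZero X.property.1.hasZeroCorners.2⟩

variable [IsDerivator (D.St hD)]

/-- The canonical comparison `X ⟶ Ω σ^* X` inside spectrum objects. -/
noncomputable def comparison (hS : (D.St hD).IsPointed) (X : (D.St hD).obj K) :
    X ⟶ ((D.St hD).loop.app K).obj (((bandShift D hD).app K).obj X) :=
  squareComparison hS (square X) (hasZeroCorners X)
    (ObjectProperty.FullSubcategory.ext (vertex_bandSquare_false_false X.obj))
    (ObjectProperty.FullSubcategory.ext (vertex_bandSquare_true_true X.obj))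

end St

/-- The canonical morphism `π_{C!} (id_C × π_A)_* Y ⟶ π_{A*} (π_C × id_A)_! Y`. It is adjoint to the
composite of `(id_C × π_A)_* Y ⟶ (id_C × π_A)_* (π_C × id_A)^* (π_C × id_A)_! Y`
with the inverse of the base change isomorphism
`π_C^* π_{A*} ⟶ (id_C × π_A)_* (π_C × id_A)^*`. -/
noncomputable def colimLimComparison {C A : Shape Dia} (Y : D.obj (C.prod A)) :
    (D.lan (Shape.prodMap C.toPoint (𝟭 (Shape.point Dia)))).obj
        ((D.ran (Shape.prodMap (𝟭 C) A.toPoint)).obj Y) ⟶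
      (D.ran (Shape.prodMap (𝟭 (Shape.point Dia)) A.toPoint)).obj
        ((D.lan (Shape.prodMap C.toPoint (𝟭 A))).obj Y) :=
  have := isIso_rmate_prodCell' (D := D) A.toPoint C.toPoint
  ((D.lanAdj (Shape.prodMap C.toPoint (𝟭 (Shape.point Dia)))).homEquiv _ _).symm
    ((D.ran (Shape.prodMap (𝟭 C) A.toPoint)).map
        ((D.lanAdj (Shape.prodMap C.toPoint (𝟭 A))).unit.app Y) ≫
      inv ((D.rmate (prodCell' C.toPoint A.toPoint)).app
        ((D.lan (Shape.prodMap C.toPoint (𝟭 A))).obj Y)))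

/-- A category is finite in the homotopical sense if its nerve has finitely many nondegenerate
simplices: it has finitely many objects and morphisms, and no cycles of nonidentity morphisms. -/
structure _root_.Shape.IsFinite (A : Shape Dia) : Prop where
  finite_obj : Finite A
  finite_hom : ∀ a b : A, Finite (a ⟶ b)
  eq_id : ∀ {a b : A} (f : a ⟶ b), (b ⟶ a) → ∃ h : a = b, f = eqToHom h

variable (D)

/-- Filtered colimits commute with finite limits. -/
def IsRegular : Prop :=
  ∀ {C A : Shape Dia}, IsFiltered C → A.IsFinite → ∀ Y : D.obj (C.prod A),
    IsIso (colimLimComparison Y)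

/-- An adjunction between morphisms of prederivators. -/
structure MorphismAdjunction {D E : Prederivator.{w, v, u} Dia} (Φ : Morphism D E)
    (Ψ : Morphism E D) where
  unit : Modification (Morphism.id D) (Φ.comp Ψ)
  counit : Modification (Ψ.comp Φ) (Morphism.id E)
  left_triangle : ∀ (K : Shape Dia) (X : D.obj K),
    (Φ.app K).map ((unit.app K).app X) ≫ (counit.app K).app ((Φ.app K).obj X) = 𝟙 ((Φ.app K).obj X)
  right_triangle : ∀ (K : Shape Dia) (Y : E.obj K),
    (unit.app K).app ((Ψ.app K).obj Y) ≫ (Ψ.app K).map ((counit.app K).app Y) = 𝟙 ((Ψ.app K).obj Y)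

/-- An adjunction is an adjoint equivalence if its unit and counit are invertible. -/
structure MorphismAdjunction.IsEquivalence {D E : Prederivator.{w, v, u} Dia} {Φ : Morphism D E}
    {Ψ : Morphism E D} (adj : MorphismAdjunction Φ Ψ) : Prop where
  isIso_unit : ∀ K, IsIso (adj.unit.app K)
  isIso_counit : ∀ K, IsIso (adj.counit.app K)

/-- A derivator is stable if it is pointed and the adjunction between suspension and loops
is an adjoint equivalence. -/
structure IsStable : Prop where
  isPointed : D.IsPointed
  exists_adjunction : Nonempty (MorphismAdjunction D.susp D.loop)
  isEquivalence : ∀ adj : MorphismAdjunction D.susp D.loop, adj.IsEquivalence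

end Prederivator

/-! The proof realises `St` as a reflective part of `K ↦ D (K × V)` that is closed under right Kan
extensions, and then recognises loops on it as an inverse of `σ^*`.

Being an Ω-spectrum is a pointwise condition. A prespectrum `X` is an Ω-spectrum iff for every
integer `i` its square with vertices `(i,i)`, `(i+1,i)`, `(i,i+1)`, `(i+1,i+1)` is cartesian
(`isOmegaSpectrum_iff_diag`); at a boundary parameter the square is zero. To turn these conditions
into a single Kan extension condition, let `π : ℕ × V ⥤ V` be the projection and let `q` be the
inclusion of the kept elements: all `(n,x)` with `x` in the boundary, and the `(n,i,i)` with `n ≤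
i`. Right Kan extension along `q` fills in the values at `(n,i,i)` for `i < n` by downward induction
on `i`, each time by a pullback. So an object on `ℕ × V` is extended from the kept part iff its
squares at all `(n,i,i)` with `i < n` are cartesian (`isIso_ran_unit_kept_iff`), and a prespectrum
`X` is an Ω-spectrum iff `π^* X ≅ q_* q^* π^* X` (`isOmegaSpectrum_iff_tower`). Right Kan extensions
commute with each other, so Ω-spectra are closed under `u_*` (`IsOmegaSpectrum.ran`).

The reflector is `L X = π_! q_* q^* π^* X`, the colimit of the stages `X, ΩX, Ω²X, …`. For an
Ω-spectrum `Z`, maps `L X ⟶ Z` are maps `q_* q^* π^* X ⟶ π^* Z`. As `π^* Z` is extended along `q`,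
these are maps `π^* X ⟶ π^* Z`, and `π^*` is fully faithful (`exists_hom_spectrify`). Regularity
enters only in showing that `L X` is an Ω-spectrum for a prespectrum `X`: its square at `(i,i)` is
the colimit over `n` of squares that are cartesian for `n > i`, and this sequential colimit commutes
with the pullback (`isOmegaSpectrum_spectrify`).

A full subprederivator that is closed under isomorphisms and `u_*`, can be tested at objects, and
contains a reflection of every `u_! X` with `X` in it, is a derivator (`isDerivator_full`). Left Kan
extensions are reflections of those in the ambient derivator. A square that is exact there remains
exact (`isExact_full`): the restriction `t^*` of a reflection is still inverted by maps into `Z`,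
because `t_* Z` belongs to the subprederivator. This gives both halves of Der4, since a square has
invertible left mate iff it has invertible right mate.

In every pointed derivator `Σ ⊣ Ω`: maps `Σ X ⟶ Z` and maps `X ⟶ Ω Z` are both identified with maps
from the suspension square of `X` to the loop square of `Z` (`bijective_loopLift`,
`bijective_suspVertex`). On spectra, the square `w^* X` is cartesian, already in the ambient
derivator and therefore in `St`, so `φ : X ⟶ Ω σ^* X` is a natural isomorphism. As `σ` is an
automorphism of `V`, the functor `σ^*` is an equivalence, hence so is `Ω` (`St.isEquivalence_loop`),
and every adjunction `Σ ⊣ Ω` is an adjoint equivalence. The adjunct of `φ` is the required `θ : Σ ⟶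
σ^*`. -/

namespace Prederivator
variable {Dia : DiagramDomain.{w}}

/-! ### Right Kan extensions by their universal property -/

section ran
variable {D : Prederivator.{w, v, u} Dia} {J K : Shape Dia}

/-- The arrow `c` exhibits `Y` as a right Kan extension of `X`. -/
def IsRan (u : J ⥤ K) {X : D.obj J} {Y : D.obj K} (c : (D.map u).obj Y ⟶ X) : Prop :=
  ∀ Z, Function.Bijective fun g : Z ⟶ Y => (D.map u).map g ≫ c

variable {u : J ⥤ K} {X : D.obj J} {Y : D.obj K} {c : (D.map u).obj Y ⟶ X}

theorem isRan_counit [HasKan D] (X : D.obj J) : IsRan u ((D.ranAdj u).counit.app X) := fun Z => by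
  have h : (fun g : Z ⟶ (D.ran u).obj X => (D.map u).map g ≫ (D.ranAdj u).counit.app X) =
      ((D.ranAdj u).homEquiv Z X).symm := funext fun g => by rw [Adjunction.homEquiv_counit]
  exact h ▸ ((D.ranAdj u).homEquiv Z X).symm.bijective

theorem bijective_iso_comp {C : Type*} [Category C] {X Y : C} (f : X ⟶ Y) [IsIso f] (Z : C) :
    Function.Bijective fun g : Y ⟶ Z => f ≫ g :=
  ⟨fun a b hab => (cancel_epi f).1 hab, fun g => ⟨inv f ≫ g, by simp⟩⟩

theorem IsRan.iso_comp (h : IsRan u c) {Y' : D.obj K} (e : Y' ⟶ Y) [IsIso e] :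
    IsRan u ((D.map u).map e ≫ c) := fun Z => by
  convert (h Z).comp (bijective_comp_iso Z e) using 2
  simp

theorem IsRan.comp_iso (h : IsRan u c) {X' : D.obj J} (e : X ⟶ X') [IsIso e] :
    IsRan u (c ≫ e) := fun Z => by
  convert (bijective_comp_iso _ e).comp (h Z) using 2
  simp

theorem IsRan.isIso (h : IsRan u c) {Y' : D.obj K} {f : Y' ⟶ Y}
    (h' : IsRan u ((D.map u).map f ≫ c)) : IsIso f := by
  obtain ⟨g, hg⟩ := (h' Y).surjective c
  simp only [← Category.assoc, ← Functor.map_comp] at hg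
  have h1 : g ≫ f = 𝟙 _ := (h Y).injective (by simpa using hg)
  refine ⟨g, (h' _).injective ?_, h1⟩
  simp only [← Category.assoc, ← Functor.map_comp]
  simp [h1]

theorem isRan_iso_comp_iff {Y' : D.obj K} (e : Y' ⟶ Y) [IsIso e] :
    IsRan u ((D.map u).map e ≫ c) ↔ IsRan u c :=
  ⟨fun h => by simpa [← Functor.map_comp_assoc] using h.iso_comp (inv e), fun h => h.iso_comp e⟩

theorem isRan_comp_iso_iff {X' : D.obj J} (e : X ⟶ X') [IsIso e] :
    IsRan u (c ≫ e) ↔ IsRan u c :=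
  ⟨fun h => by simpa using h.comp_iso (inv e), fun h => h.comp_iso e⟩

/-- Base change of an arrow `u^* Y ⟶ X` along a square. -/
def bcR {J' K' : Shape Dia} {v : J' ⥤ J} {u' : J' ⥤ K'} {t : K' ⥤ K} (δ : u' ⋙ t ⟶ v ⋙ u)
    (c : (D.map u).obj Y ⟶ X) : (D.map u').obj ((D.map t).obj Y) ⟶ (D.map v).obj X :=
  (D.sqR δ).app Y ≫ (D.map v).map c

variable {J' K' : Shape Dia} {v : J' ⥤ J} {u' : J' ⥤ K'} {t : K' ⥤ K}

theorem bcR_comp (δ : u' ⋙ t ⟶ v ⋙ u) (c : (D.map u).obj Y ⟶ X) {Z : D.obj K} (g : Z ⟶ Y) :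
    bcR δ ((D.map u).map g ≫ c) = (D.map u').map ((D.map t).map g) ≫ bcR δ c := by
  have := (D.sqR δ).naturality g
  simp only [Functor.comp_map] at this
  simp [bcR, reassoc_of% this]

/-- A universal arrow is the counit up to isomorphism, and the base change of the counit is the
counit of the other side precomposed with the right mate. This replaces mates by arrows with a
universal property, which do not depend on chosen adjoints. -/
theorem isRan_bcR_iff_isIso [HasKan D] (δ : u' ⋙ t ⟶ v ⋙ u) (h : IsRan u c) :
    IsRan u' (bcR δ c) ↔ IsIso ((D.rmate δ).app X) := by
  obtain ⟨f, hf⟩ := (isRan_counit (u := u) X Y).surjective c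
  dsimp only at hf
  have : IsIso f := (isRan_counit X).isIso (by rwa [hf])
  rw [← hf, bcR_comp, isRan_iso_comp_iff]
  have key : bcR δ ((D.ranAdj u).counit.app X) =
    (D.map u').map ((D.rmate δ).app X) ≫ (D.ranAdj u').counit.app _ := (rmate_counit D δ X).symm
  rw [key]
  exact ⟨fun H => (isRan_counit _).isIso H, fun H => (isRan_counit _).iso_comp _⟩

theorem bcR_bcR {J'' K'' : Shape Dia} {v' : J'' ⥤ J'} {u'' : J'' ⥤ K''} {t' : K'' ⥤ K'}
    (δ : u' ⋙ t ⟶ v ⋙ u) (δ' : u'' ⋙ t' ⟶ v' ⋙ u') (c : (D.map u).obj Y ⟶ X)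
    (ε : u'' ⋙ (t' ⋙ t) ⟶ (v' ⋙ v) ⋙ u)
    (hε : ε = Functor.whiskerRight δ' t ≫ Functor.whiskerLeft v' δ) :
    bcR δ' (bcR δ c) ≫ (D.mapComp v' v).inv.app X =
      (D.map u'').map ((D.mapComp t' t).inv.app Y) ≫ bcR ε c := by
  have h := D.sqR_paste δ δ' Y ε hε
  have h1 := (D.mapComp v' v).inv.naturality c
  simp only [Functor.comp_map] at h1
  simp only [bcR, Functor.map_comp, Category.assoc, h1, reassoc_of% h]

theorem bcR_whisker (δ : u' ⋙ t ⟶ v ⋙ u) (c : (D.map u).obj Y ⟶ X) {t' : K' ⥤ K} (φ : t' ⟶ t)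
    (ε : u' ⋙ t' ⟶ v ⋙ u) (hε : ε = Functor.whiskerLeft u' φ ≫ δ) :
    bcR ε c = (D.map u').map ((D.map₂ φ).app Y) ≫ bcR δ c := by
  have := D.map₂_whiskerLeft_app u' φ Y
  simp only [bcR, sqR, hε, map₂_comp, NatTrans.comp_app, Category.assoc, this]
  simp

/-- Exactness was defined through left Kan extensions along `t` and `v`. Left and right mates are
conjugate, so the same condition can be read off from right Kan extensions along `u` and `u'`. -/
theorem isExact_iff_bcR [HasKan D] (δ : u' ⋙ t ⟶ v ⋙ u) :
    D.IsExact δ ↔ ∀ ⦃X : D.obj J⦄ ⦃Y : D.obj K⦄ (c : (D.map u).obj Y ⟶ X), IsRan u c →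
      IsRan u' (bcR δ c) := by
  rw [isExact_iff_rmate]
  refine ⟨fun h X Y c hc => (isRan_bcR_iff_isIso δ hc).2 inferInstance, fun h => ?_⟩
  have : ∀ X, IsIso ((D.rmate δ).app X) := fun X =>
    (isRan_bcR_iff_isIso δ (isRan_counit X)).1 (h _ (isRan_counit X))
  exact NatIso.isIso_of_isIso_app _

theorem IsRan.coslice [IsDerivator D] (h : IsRan u c) (k : K) :
    IsRan _ (bcR (cosliceCell u k) c) :=
  (isRan_bcR_iff_isIso _ h).2 (by have := IsDerivator.der4_right (D := D) u k; infer_instance)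

/-- Compare with the counit: by Der2 the comparison arrow is tested at each object, where both
arrows are universal over the same coslice. -/
theorem isRan_of_coslice [IsDerivator D] (h : ∀ k : K, IsRan _ (bcR (cosliceCell u k) c)) :
    IsRan u c := by
  obtain ⟨f, hf⟩ := (isRan_counit (u := u) X Y).surjective c
  dsimp only at hf
  have : IsIso f := IsDerivator.der2 _ fun k => by
    refine ((isRan_counit (u := u) X).coslice k).isIso (f := (D.map (Shape.incl k)).map f) ?_
    rw [← bcR_comp, hf]
    exact h k
  rw [← hf]
  exact (isRan_counit X).iso_comp f

/-- On a constant diagram the counit of `R^* ⊣ S^*` is the image of a 2-cell between functors to the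
point, and all such 2-cells are invertible. -/
theorem isIso_mapAdj_counit {I L : Shape Dia} {S : I ⥤ L} {R : L ⥤ I} (adj : S ⊣ R)
    (Z : D.obj (.point Dia)) :
    IsIso ((mapAdj (D := D) adj).counit.app ((D.map L.toPoint).obj Z)) := by
  have h := D.map₂_whiskerRight_app adj.counit L.toPoint Z
  have h1 := isIso_map₂ (D := D) _ (isIso_toPoint (Functor.whiskerRight adj.counit L.toPoint))
  have h2 : IsIso ((D.map₂ adj.counit).app ((D.map L.toPoint).obj Z)) := by
    have h3 : (D.map₂ adj.counit).app ((D.map L.toPoint).obj Z) =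
      (D.mapComp (R ⋙ S) L.toPoint).inv.app Z ≫
        (D.map₂ (Functor.whiskerRight adj.counit L.toPoint)).app Z ≫
        (D.mapComp (𝟭 _) L.toPoint).hom.app Z := by
      rw [h]; simp
    rw [h3]
    infer_instance
  simp only [mapAdj, Adjunction.mkOfUnitCounit_counit, NatTrans.comp_app]
  infer_instance

theorem bcR_point_bijective {I L : Shape Dia} {S : I ⥤ L} (hS : S.IsLeftAdjoint)
    (δ : I.toPoint ⋙ 𝟭 _ ⟶ S ⋙ L.toPoint) (X : D.obj L) (Z : D.obj (.point Dia)) :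
    Function.Bijective fun f : (D.map L.toPoint).obj Z ⟶ X => bcR δ f := by
  obtain ⟨R, ⟨adj⟩⟩ := hS
  have h1 := isIso_map₂ (D := D) δ (isIso_toPoint δ)
  have h2 : IsIso ((D.sqR δ).app Z) := by unfold sqR; infer_instance
  have h3 := isIso_mapAdj_counit (D := D) adj Z
  have h4 : Function.Bijective fun f : (D.map L.toPoint).obj Z ⟶ X => (D.map S).map f := by
    refine (Function.Bijective.of_comp_iff' ((mapAdj (D := D) adj).homEquiv _ _).symm.bijective _).1 ?_
    have : (((mapAdj (D := D) adj).homEquiv _ X).symm ∘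
        fun f : (D.map L.toPoint).obj Z ⟶ X => (D.map S).map f) =
        fun f => (mapAdj (D := D) adj).counit.app ((D.map L.toPoint).obj Z) ≫ f := by
      funext f
      simp [Adjunction.homEquiv_counit]
    rw [this]
    exact bijective_iso_comp _ _
  exact (bijective_iso_comp ((D.sqR δ).app Z) _).comp h4

/-- Left adjoints are initial functors: cones over a diagram on `L` with constant source correspond
to cones over its restriction along `S`, so limits over `L` can be computed over `I`. -/
theorem isRan_restrict {I L : Shape Dia} {S : I ⥤ L} (hS : S.IsLeftAdjoint)
    {X : D.obj L} {Y : D.obj (.point Dia)} (δ : I.toPoint ⋙ 𝟭 _ ⟶ S ⋙ L.toPoint)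
    (c : (D.map L.toPoint).obj Y ⟶ X) :
    IsRan _ (bcR δ c) ↔ IsRan _ c := by
  have key : ∀ Z, (Function.Bijective fun g : (D.map (𝟭 _)).obj Z ⟶ (D.map (𝟭 _)).obj Y =>
      (D.map I.toPoint).map g ≫ bcR δ c) ↔
      Function.Bijective fun g : Z ⟶ Y => (D.map L.toPoint).map g ≫ c := fun Z => by
    rw [← Function.Bijective.of_comp_iff _ (bijective_map_id Z Y),
      ← Function.Bijective.of_comp_iff' (bcR_point_bijective hS δ X Z)]
    simp only [Function.comp_def, bcR_comp]
  refine ⟨fun h Z => (key Z).1 (h _), fun h Z => ?_⟩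
  have h1 := (key Z).2 (h Z)
  generalize hZ : (D.map (𝟭 _)).obj Z = Z' at h1
  obtain rfl : Z' = Z := by rw [← hZ, D.map_id]; rfl
  exact h1

theorem isExact_of_coslice [IsDerivator D] (δ : u' ⋙ t ⟶ v ⋙ u)
    (h : ∀ k : K', D.IsExact (v := (Shape.coslice u' k).toPoint) (u' := Shape.coproj u' k ⋙ v)
      (u := Shape.incl k ⋙ t) (t := u)
      (Functor.whiskerRight (cosliceCell u' k) t ≫ Functor.whiskerLeft (Shape.coproj u' k) δ)) :
    D.IsExact δ := (isExact_iff_bcR δ).2 fun X Y c hc => isRan_of_coslice fun k => by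
  have h1 := bcR_bcR δ (cosliceCell u' k) c _ rfl
  have h2 := ((isExact_iff_bcR _).1 (h k) c hc).iso_comp ((D.mapComp (Shape.incl k) t).inv.app Y)
  rw [← h1] at h2
  have h3 := h2.comp_iso ((D.mapComp (Shape.coproj u' k) v).hom.app X)
  simpa using h3

/-- The form of `isRan_restrict` adapted to coslices: two base changes to points agree when their
index categories are related by a left adjoint and their points by an isomorphism `φ`. -/
theorem isRan_point_iff {I L : Shape Dia} {S : I ⥤ L} (hS : S.IsLeftAdjoint) {p : L ⥤ J}
    {t₀ t₁ : Shape.point Dia ⥤ K} (δ : L.toPoint ⋙ t₀ ⟶ p ⋙ u) {q : I ⥤ J} (hq : S ⋙ p = q)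
    (ε : I.toPoint ⋙ t₁ ⟶ q ⋙ u) (φ : t₁ ⟶ t₀) [IsIso φ]
    (hε : ∀ x, ε.app x = φ.app ⟨PUnit.unit⟩ ≫ δ.app (S.obj x) ≫
      u.map (eqToHom (Functor.congr_obj hq x))) :
    IsRan I.toPoint (bcR ε c) ↔ IsRan L.toPoint (bcR δ c) := by
  subst hq
  let η : I.toPoint ⋙ 𝟭 _ ⟶ S ⋙ L.toPoint := (Functor.punitExt _ _).hom
  let φ' : t₁ ⟶ 𝟭 (Shape.point Dia) ⋙ t₀ := φ
  have hφ' : IsIso φ' := ‹_›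
  rw [← isRan_restrict hS η]
  let ε₀ : I.toPoint ⋙ (𝟭 (Shape.point Dia) ⋙ t₀) ⟶ (S ⋙ p) ⋙ u :=
    Functor.whiskerRight η t₀ ≫ Functor.whiskerLeft S δ
  have h3 := bcR_bcR δ η c ε₀ rfl
  have h4 := bcR_whisker ε₀ c φ' ε (by
    ext x
    have := hε x
    simp only [Functor.comp_obj, eqToHom_refl] at this
    have h5 : ε₀.app x = δ.app (S.obj x) := by
      change t₀.map (η.app x) ≫ δ.app (S.obj x) = _
      rw [Subsingleton.elim (η.app x) (𝟙 _)]
      exact (congr_arg (fun f => f ≫ _) (t₀.map_id _)).trans (Category.id_comp _)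
    rw [this]
    erw [u.map_id, Category.comp_id]
    exact congr_arg (fun f => φ.app ⟨PUnit.unit⟩ ≫ f) h5.symm)
  have := isIso_map₂ (D := D) φ' inferInstance
  rw [h4, isRan_iso_comp_iff, ← isRan_iso_comp_iff (c := bcR ε₀ c) ((D.mapComp (𝟭 _) t₀).inv.app Y)]
  exact h3 ▸ isRan_comp_iso_iff _

/-- A square is exact if the induced functors on coslices are left adjoints. -/
theorem isExact_of_cocomparison [IsDerivator D] (δ : u' ⋙ t ⟶ v ⋙ u)
    (T : ∀ k : K', Shape.coslice u' k ⥤ Shape.coslice u (t.obj k)) (hT : ∀ k, (T k).IsLeftAdjoint)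
    (hv : ∀ k, T k ⋙ Shape.coproj u (t.obj k) = Shape.coproj u' k ⋙ v)
    (hδ : ∀ k (x : Shape.coslice u' k), t.map x.hom ≫ δ.app x.right =
      ((T k).obj x).hom ≫ u.map (eqToHom (Functor.congr_obj (hv k) x))) :
    D.IsExact δ := by
  refine isExact_of_coslice δ fun k => (isExact_iff_bcR _).2 fun X Y c hc => ?_
  let e : Shape.incl k ⋙ t ≅ Shape.incl (t.obj k) :=
    Discrete.natIso fun _ => Iso.refl _
  refine (isRan_point_iff (hT k) (cosliceCell u (t.obj k)) (hv k) _ e.hom fun x => ?_).2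
    (hc.coslice (t.obj k))
  refine Eq.trans ?_ (Category.id_comp _).symm
  exact hδ k x

end ran
end Prederivator

namespace Prederivator
variable {Dia : DiagramDomain.{w}}

/-! ### Fully faithful Kan extensions, exactness for products and posets -/

section exact
variable {D : Prederivator.{w, v, u} Dia} {J K : Shape Dia}

theorem IsRan.isIso_of_isEquivalence {t : J ⥤ K} (ht : (D.map t).IsEquivalence)
    {X : D.obj J} {Y : D.obj K} {c : (D.map t).obj Y ⟶ X} (h : IsRan t c) : IsIso c := by
  let e := (D.map t).objObjPreimageIso X
  have he : IsRan t e.hom := fun Z =>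
    (bijective_comp_iso _ e.hom).comp ⟨(D.map t).map_injective, (D.map t).map_surjective⟩
  obtain ⟨f, hf⟩ := (he Y).surjective c
  dsimp only at hf
  have : IsIso f := he.isIso (by rwa [hf])
  rw [← hf]
  infer_instance

/-- Right Kan extension along a fully faithful functor is fully faithful. -/
theorem IsRan.isIso_of_fullyFaithful [IsDerivator D] {u : J ⥤ K} [u.Full] [u.Faithful] {X : D.obj J}
    {Y : D.obj K} {c : (D.map u).obj Y ⟶ X} (hc : IsRan u c) : IsIso c := by
  -- The square with identity functors on one side is exact because `u` is fully faithful. Base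
  -- change along it makes the arrow a right Kan extension along the identity of `J`, hence an
  -- isomorphism.
  let δ : 𝟭 J ⋙ u ⟶ 𝟭 J ⋙ u := 𝟙 _
  have h : D.IsExact δ := isExact_of_isEquivalence _ inferInstance inferInstance inferInstance
  have he := isEquivalence_map_of_isEquivalence (D := D) (𝟭 J) inferInstance
  have h1 := ((isExact_iff_bcR δ).1 h c hc).isIso_of_isEquivalence he
  have := isIso_map₂ (D := D) δ inferInstance
  have h2 : IsIso (D.sqR δ) := by unfold sqR; infer_instance
  unfold bcR at h1
  have := IsIso.of_isIso_comp_left ((D.sqR δ).app Y) ((D.map (𝟭 J)).map c)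
  exact isIso_of_reflects_iso _ (D.map (𝟭 J))

/-- For fully faithful `u`, invertibility of the unit at `Y` means that `Y` is in the essential
image of `u_*`. Such objects are called local (for `u`) below. -/
theorem isIso_ran_unit_ran [IsDerivator D] (u : J ⥤ K) [u.Full] [u.Faithful] (X : D.obj J) :
    IsIso ((D.ranAdj u).unit.app ((D.ran u).obj X)) := by
  have := (isRan_counit (u := u) X).isIso_of_fullyFaithful
  have h := (D.ranAdj u).right_triangle_components X
  have h1 : IsIso ((D.ranAdj u).unit.app ((D.ran u).obj X) ≫
    (D.ran u).map ((D.ranAdj u).counit.app X)) := by rw [h]; exact IsIso.id _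
  exact IsIso.of_isIso_comp_right _ ((D.ran u).map ((D.ranAdj u).counit.app X))

theorem isIso_ran_unit_of_iso [HasKan D] (u : J ⥤ K) {Y Y' : D.obj K} (e : Y ≅ Y')
    (h : IsIso ((D.ranAdj u).unit.app Y)) : IsIso ((D.ranAdj u).unit.app Y') := by
  have h1 := (D.ranAdj u).unit.naturality e.inv
  have : IsIso ((𝟭 (D.obj K)).map e.inv ≫ (D.ranAdj u).unit.app Y) := by
    dsimp; infer_instance
  rw [h1] at this
  exact IsIso.of_isIso_comp_right _ ((D.map u ⋙ D.ran u).map e.inv)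

/-- Right Kan extension along a composite functor. -/
noncomputable def ranComp (D : Prederivator.{w, v, u} Dia) [HasKan D] {I J K : Shape Dia}
    (u : I ⥤ J) (v : J ⥤ K) : D.ran (u ⋙ v) ≅ D.ran u ⋙ D.ran v :=
  Adjunction.rightAdjointUniq ((D.ranAdj (u ⋙ v)).ofNatIsoLeft (D.mapComp u v))
    ((D.ranAdj v).comp (D.ranAdj u))

/-- The product of a shape with a natural transformation. -/
abbrev _root_.Shape.prodWhiskerRight (A : Shape Dia) {J K : Shape Dia} {u v : J ⥤ K} (α : u ⟶ v) :
    Shape.prodMap (𝟭 A) u ⟶ Shape.prodMap (𝟭 A) v where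
  app x := (𝟙 x.1, α.app x.2)
  naturality _ _ g := Prod.ext ((Category.comp_id _).trans (Category.id_comp _).symm)
    (α.naturality g.2)

/-- Isomorphisms are detected on the slices `{a} × -`, and pasting with the exact squares of these
sections gives back `δ` itself. -/
theorem isExact_prodWhiskerRight [IsDerivator D] {J' K' : Shape Dia} {u : J ⥤ K} {v : J' ⥤ J}
    {u' : J' ⥤ K'} {t : K' ⥤ K} (δ : v ⋙ u ⟶ u' ⋙ t) (h : D.IsExact δ) (A : Shape Dia) :
    D.IsExact (v := Shape.prodMap (𝟭 A) v) (u := Shape.prodMap (𝟭 A) u)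
      (u' := Shape.prodMap (𝟭 A) u') (t := Shape.prodMap (𝟭 A) t) (Shape.prodWhiskerRight A δ) := by
  refine isExact_of_paste (D := D) (ι := A) _ _ (fun f h => isIso_of_sectR f h)
    (fun a => isExact_sectR u' a) fun a => ?_
  refine isExact_paste _ δ _ ?_ (isExact_sectR u a) h
  ext x
  · simp [sectCell]
  · simp [sectCell]

/-- For posets the comparison of coslices is monotone, and a right adjoint to it is a function `g`
for which `g x ρ` is the largest `c` with `x ≤ u' c` and `v c ≤ ρ`. Only pairs with `t x ≤ u ρ`
matter, so `g` may take arbitrary values elsewhere. -/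
theorem isExact_of_poset_coslice [IsDerivator D] {P Q P' Q' : Type w} [PartialOrder P] [Countable P]
    [PartialOrder Q] [Countable Q] [PartialOrder P'] [Countable P'] [PartialOrder Q'] [Countable Q']
    {u : Shape.poset Dia P ⥤ Shape.poset Dia Q} {v : Shape.poset Dia P' ⥤ Shape.poset Dia P}
    {u' : Shape.poset Dia P' ⥤ Shape.poset Dia Q'} {t : Shape.poset Dia Q' ⥤ Shape.poset Dia Q}
    (δ : u' ⋙ t ⟶ v ⋙ u) (g : Q' → P → P')
    (hg : ∀ x ρ, t.obj x ≤ u.obj ρ → x ≤ u'.obj (g x ρ))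
    (hg' : ∀ x ρ c, t.obj x ≤ u.obj ρ → x ≤ u'.obj c → (v.obj c ≤ ρ ↔ c ≤ g x ρ)) :
    D.IsExact δ := by
  have hδ (c) : t.obj (u'.obj c) ≤ u.obj (v.obj c) := leOfHom (δ.app c)
  let T (x : Q') : Shape.coslice u' x ⥤ Shape.coslice u (t.obj x) :=
    { obj c := StructuredArrow.mk (Y := v.obj c.right)
        (homOfLE ((leOfHom (t.map c.hom)).trans (hδ c.right)))
      map f := StructuredArrow.homMk (v.map f.right) (Subsingleton.elim _ _)
      map_id _ := StructuredArrow.hom_ext _ _ (Subsingleton.elim _ _)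
      map_comp _ _ := StructuredArrow.hom_ext _ _ (Subsingleton.elim _ _) }
  have hsub (x : Q') (a b : Shape.coslice u' x) : Subsingleton (a ⟶ b) :=
    ⟨fun f g => StructuredArrow.hom_ext _ _ (Subsingleton.elim _ _)⟩
  have hsub' (x : Q') (a b : Shape.coslice u (t.obj x)) : Subsingleton (a ⟶ b) :=
    ⟨fun f g => StructuredArrow.hom_ext _ _ (Subsingleton.elim _ _)⟩
  let R (x : Q') : Shape.coslice u (t.obj x) ⥤ Shape.coslice u' x :=
    { obj ρ := StructuredArrow.mk (Y := g x ρ.right) (homOfLE (hg x _ (leOfHom ρ.hom)))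
      map {ρ ρ'} f := StructuredArrow.homMk (homOfLE ((hg' x _ _ (leOfHom ρ'.hom)
        (hg x _ (leOfHom ρ.hom))).1 (((hg' x _ _ (leOfHom ρ.hom)
        (hg x _ (leOfHom ρ.hom))).2 le_rfl).trans (leOfHom f.right)))) (Subsingleton.elim _ _)
      map_id _ := Subsingleton.elim _ _
      map_comp _ _ := Subsingleton.elim _ _ }
  have adj (x : Q') : T x ⊣ R x := Adjunction.mkOfHomEquiv
    { homEquiv c ρ :=
        { toFun f := StructuredArrow.homMk (homOfLE ((hg' x _ _ (leOfHom ρ.hom)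
            (leOfHom c.hom)).1 (leOfHom f.right))) (Subsingleton.elim _ _)
          invFun f := StructuredArrow.homMk (homOfLE ((hg' x _ _ (leOfHom ρ.hom)
            (leOfHom c.hom)).2 (leOfHom f.right))) (Subsingleton.elim _ _)
          left_inv f := Subsingleton.elim _ _
          right_inv f := Subsingleton.elim _ _ }
      homEquiv_naturality_left_symm _ _ := Subsingleton.elim _ _
      homEquiv_naturality_right _ _ := Subsingleton.elim _ _ }
  exact isExact_of_cocomparison δ T (fun x => ⟨_, ⟨adj x⟩⟩)
    (fun x => CategoryTheory.Functor.ext (fun _ => rfl) fun _ _ _ => Subsingleton.elim _ _)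
    fun x c => Subsingleton.elim _ _

/-- Dual criterion: `g x ρ` is the least `c` with `u' c ≤ x` and `ρ ≤ v c`, which is a left adjoint
to the comparison of slices. -/
theorem isExact_of_poset_slice [IsDerivator D] {P Q P' Q' : Type w} [PartialOrder P] [Countable P]
    [PartialOrder Q] [Countable Q] [PartialOrder P'] [Countable P'] [PartialOrder Q'] [Countable Q']
    {u : Shape.poset Dia P ⥤ Shape.poset Dia Q} {v : Shape.poset Dia P' ⥤ Shape.poset Dia P}
    {u' : Shape.poset Dia P' ⥤ Shape.poset Dia Q'} {t : Shape.poset Dia Q' ⥤ Shape.poset Dia Q}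
    (δ : v ⋙ u ⟶ u' ⋙ t) (g : Q' → P → P')
    (hg : ∀ x ρ, u.obj ρ ≤ t.obj x → u'.obj (g x ρ) ≤ x)
    (hg' : ∀ x ρ c, u.obj ρ ≤ t.obj x → u'.obj c ≤ x → (ρ ≤ v.obj c ↔ g x ρ ≤ c)) :
    D.IsExact δ := by
  have hδ (c) : u.obj (v.obj c) ≤ t.obj (u'.obj c) := leOfHom (δ.app c)
  let T (x : Q') : Shape.slice u' x ⥤ Shape.slice u (t.obj x) :=
    { obj c := CostructuredArrow.mk (Y := v.obj c.left)
        (homOfLE ((hδ c.left).trans (leOfHom (t.map c.hom))))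
      map f := CostructuredArrow.homMk (v.map f.left) (Subsingleton.elim _ _)
      map_id _ := CostructuredArrow.hom_ext _ _ (Subsingleton.elim _ _)
      map_comp _ _ := CostructuredArrow.hom_ext _ _ (Subsingleton.elim _ _) }
  have hsub (x : Q') (a b : Shape.slice u' x) : Subsingleton (a ⟶ b) :=
    ⟨fun f g => CostructuredArrow.hom_ext _ _ (Subsingleton.elim _ _)⟩
  have hsub' (x : Q') (a b : Shape.slice u (t.obj x)) : Subsingleton (a ⟶ b) :=
    ⟨fun f g => CostructuredArrow.hom_ext _ _ (Subsingleton.elim _ _)⟩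
  let R (x : Q') : Shape.slice u (t.obj x) ⥤ Shape.slice u' x :=
    { obj ρ := CostructuredArrow.mk (Y := g x ρ.left) (homOfLE (hg x _ (leOfHom ρ.hom)))
      map {ρ ρ'} f := CostructuredArrow.homMk (homOfLE ((hg' x _ _ (leOfHom ρ.hom)
        (hg x _ (leOfHom ρ'.hom))).1 ((leOfHom f.left).trans ((hg' x _ _ (leOfHom ρ'.hom)
        (hg x _ (leOfHom ρ'.hom))).2 le_rfl)))) (Subsingleton.elim _ _)
      map_id _ := Subsingleton.elim _ _
      map_comp _ _ := Subsingleton.elim _ _ }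
  have adj (x : Q') : R x ⊣ T x := Adjunction.mkOfHomEquiv
    { homEquiv ρ c :=
        { toFun f := CostructuredArrow.homMk (homOfLE ((hg' x _ _ (leOfHom ρ.hom)
            (leOfHom c.hom)).2 (leOfHom f.left))) (Subsingleton.elim _ _)
          invFun f := CostructuredArrow.homMk (homOfLE ((hg' x _ _ (leOfHom ρ.hom)
            (leOfHom c.hom)).1 (leOfHom f.left))) (Subsingleton.elim _ _)
          left_inv f := Subsingleton.elim _ _
          right_inv f := Subsingleton.elim _ _ }
      homEquiv_naturality_left_symm _ _ := Subsingleton.elim _ _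
      homEquiv_naturality_right _ _ := Subsingleton.elim _ _ }
  exact isExact_of_comparison δ T (fun x => ⟨_, ⟨adj x⟩⟩)
    (fun x => CategoryTheory.Functor.ext (fun _ => rfl) fun _ _ _ => Subsingleton.elim _ _)
    fun x c => Subsingleton.elim _ _

/-! ### Zero objects and extension by zero -/

theorem subsingleton_hom_of_isEmpty [IsDerivator D] [IsEmpty J] (X Y : D.obj J) :
    Nonempty (Unique (X ⟶ Y)) := by
  let F : Shape.empty Dia ⥤ J :=
    { obj i := isEmptyElim i, map {i} := isEmptyElim i, map_id i := isEmptyElim i,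
      map_comp {i} := isEmptyElim i }
  have hF : F.IsEquivalence :=
    { faithful := ⟨fun {i} => (IsEmpty.false i).elim⟩
      full := ⟨fun {i} => (IsEmpty.false i).elim⟩
      essSurj := ⟨fun i => isEmptyElim i⟩ }
  have := isEquivalence_map_of_isEquivalence (D := D) F hF
  obtain ⟨i⟩ := unique_hom_empty ((D.map F).obj X) ((D.map F).obj Y)
  exact ⟨(Equiv.ofBijective _ ⟨(D.map F).map_injective, (D.map F).map_surjective⟩).unique⟩

theorem IsPointed.isZero_of_unique_from [HasKan D] (h : D.IsPointed) {X : D.obj K}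
    (hX : ∀ Y, Nonempty (Unique (Y ⟶ X))) : IsZero X := by
  obtain ⟨Z, hZ⟩ := h.exists_isZero K
  obtain ⟨i⟩ := hX Z
  obtain ⟨j⟩ := hX X
  exact hZ.of_iso ⟨hZ.from_ X, i.default, Subsingleton.elim _ _, hZ.eq_of_src _ _⟩

theorem IsPointed.isZero_lan [HasKan D] (h : D.IsPointed) (u : J ⥤ K)
    {X : D.obj J} (hX : IsZero X) : IsZero ((D.lan u).obj X) :=
  h.isZero_of_unique_to fun Y => by
    obtain ⟨i⟩ := hX.unique_to ((D.map u).obj Y)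
    exact ⟨((D.lanAdj u).homEquiv X Y).unique⟩

theorem isZero_of_incl [IsDerivator D] (h : D.IsPointed) {X : D.obj K}
    (hX : ∀ k : K, IsZero ((D.map (Shape.incl k)).obj X)) : IsZero X := by
  obtain ⟨Z, hZ⟩ := h.exists_isZero K
  have := IsDerivator.der2 (hZ.to_ X) fun k => isIso_of_isZero _ (isZero_map _ hZ) (hX k)
  exact hZ.of_iso (asIso (hZ.to_ X)).symm

/-- By Der4 the value is a colimit over the empty category, hence initial. In a pointed derivator an
initial object is zero. -/
theorem isZero_lan_of_isEmpty_slice [IsDerivator D] (h : D.IsPointed) (u : J ⥤ K) (k : K)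
    (hk : IsEmpty (Shape.slice u k)) (X : D.obj J) :
    IsZero ((D.map (Shape.incl k)).obj ((D.lan u).obj X)) :=
  h.isZero_of_unique_to fun Z => by
    obtain ⟨i⟩ := subsingleton_hom_of_isEmpty ((D.map (Shape.proj u k)).obj X)
      ((D.map (Shape.slice u k).toPoint).obj Z)
    exact ⟨(Equiv.ofBijective _ ((isLan_unit X).slice k Z)).unique⟩

theorem isZero_ran_of_isEmpty_coslice [IsDerivator D] (h : D.IsPointed) (u : J ⥤ K) (k : K)
    (hk : IsEmpty (Shape.coslice u k)) (X : D.obj J) :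
    IsZero ((D.map (Shape.incl k)).obj ((D.ran u).obj X)) :=
  h.isZero_of_unique_from fun Z => by
    obtain ⟨i⟩ := subsingleton_hom_of_isEmpty ((D.map (Shape.coslice u k).toPoint).obj Z)
      ((D.map (Shape.coproj u k)).obj X)
    exact ⟨@Equiv.unique _ _ i (Equiv.ofBijective _ ((isRan_counit X).coslice k Z))⟩

end exact
end Prederivator

namespace Shape
variable {Dia : DiagramDomain.{w}}

theorem prodMap_full {J K A B : Shape Dia} (u : J ⥤ K) (f : A ⥤ B) [u.Full] [f.Full] :
    (prodMap u f).Full :=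
  ⟨fun g => ⟨(u.preimage g.1, f.preimage g.2), Prod.ext (u.map_preimage _) (f.map_preimage _)⟩⟩

theorem prodMap_faithful {J K A B : Shape Dia} (u : J ⥤ K) (f : A ⥤ B) [u.Faithful]
    [f.Faithful] : (prodMap u f).Faithful :=
  ⟨fun {_ _ _ _} h => Prod.ext (u.map_injective (congr_arg (fun x => x.1) h))
    (f.map_injective (congr_arg (fun x => x.2) h))⟩

instance subtypeIncl_full {P : Type w} [PartialOrder P] [Countable P] (p : P → Prop) :
    (subtypeIncl Dia p).Full := ⟨fun {x y} g => ⟨homOfLE (leOfHom g : x.1 ≤ y.1), rfl⟩⟩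

instance subtypeIncl_faithful {P : Type w} [PartialOrder P] [Countable P] (p : P → Prop) :
    (subtypeIncl Dia p).Faithful := ⟨fun _ => Subsingleton.elim _ _⟩

end Shape

/-! ### Local objects for a fully faithful functor. -/

namespace Prederivator
variable {Dia : DiagramDomain.{w}} {D : Prederivator.{w, v, u} Dia} {J K : Shape Dia}

/-- Localisation does not change the values on `J`: the counit is invertible for fully faithful `u`,
and the triangle identity transfers this to the restricted unit. -/
theorem isIso_map_ran_unit [IsDerivator D] (u : J ⥤ K) [u.Full] [u.Faithful] (Y : D.obj K) :
    IsIso ((D.map u).map ((D.ranAdj u).unit.app Y)) := by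
  have h1 := (isRan_counit (u := u) ((D.map u).obj Y)).isIso_of_fullyFaithful
  have h := (D.ranAdj u).left_triangle_components Y
  have h2 : IsIso ((D.map u).map ((D.ranAdj u).unit.app Y) ≫
    (D.ranAdj u).counit.app ((D.map u).obj Y)) := by rw [h]; exact IsIso.id _
  exact @IsIso.of_isIso_comp_right _ _ _ _ _ _ _ h1 h2

/-- A map between local objects is determined by its restriction, by naturality of the unit. This
replaces a computation of the missing values. -/
theorem isIso_of_isIso_ran_unit [HasKan D] (u : J ⥤ K) {Y Y' : D.obj K} (f : Y ⟶ Y')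
    (hY : IsIso ((D.ranAdj u).unit.app Y)) (hY' : IsIso ((D.ranAdj u).unit.app Y'))
    (hf : IsIso ((D.map u).map f)) : IsIso f := by
  have h := (D.ranAdj u).unit.naturality f
  have : IsIso ((D.ranAdj u).unit.app Y ≫ (D.map u ⋙ D.ran u).map f) := by
    dsimp; infer_instance
  rw [← h] at this
  exact @IsIso.of_isIso_comp_right _ _ _ _ _ ((𝟭 _).map f) _ hY' this

/-- If `Y` is a right Kan extension, so is its restriction along an exact square. -/
theorem isIso_ran_unit_map [IsDerivator D] {J' K' : Shape Dia} {u : J ⥤ K} {v : J' ⥤ J} {u' : J' ⥤ K'}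
    {t : K' ⥤ K} (δ : u' ⋙ t ⟶ v ⋙ u) [IsIso δ] (h : D.IsExact δ) (Y : D.obj K)
    (hY : IsIso ((D.ranAdj u).unit.app Y)) :
    IsIso ((D.ranAdj u').unit.app ((D.map t).obj Y)) :=
  (isIso_ran_unit_iff δ ((isExact_iff_rmate (D := D) δ).1 h) Y (𝟭 _)).2 (by dsimp; infer_instance)

/-! ### Cartesian squares -/

/-- The vertices other than `(0,0)` lie in the cospan, where the unit is always invertible. So the
condition at `(0,0)` says that the whole square is local. -/
theorem isCartesianAt_iff [IsDerivator D] (Y : D.obj (K.prod (.square Dia))) :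
    IsCartesianAt Y ↔
      IsIso ((D.ranAdj (Shape.prodMap (𝟭 K) (Shape.cospanIncl Dia))).unit.app Y) := by
  refine ⟨fun h => isIso_of_sect _ fun a => ?_, fun h => by unfold IsCartesianAt; infer_instance⟩
  by_cases ha : a = UnitSquare.pt false false
  · subst ha; exact h
  · have := Shape.prodMap_full (𝟭 K) (Shape.cospanIncl Dia)
    have := Shape.prodMap_faithful (𝟭 K) (Shape.cospanIncl Dia)
    have e : K.sect (A := .cospan Dia) ⟨a, ha⟩ ⋙
        Shape.prodMap (𝟭 K) (Shape.cospanIncl Dia) ≅ K.sect (A := .square Dia) a :=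
      NatIso.ofComponents (fun _ => Iso.refl _) fun f => by
        refine Prod.ext ?_ (Subsingleton.elim _ _)
        simp
    have := isIso_map_ran_unit (Shape.prodMap (𝟭 K) (Shape.cospanIncl Dia)) Y
    rw [← isIso_map_congr_iff e, isIso_map_comp_iff]
    infer_instance

theorem IsCartesianAt.of_iso [IsDerivator D] {Y Y' : D.obj (K.prod (.square Dia))}
    (h : IsCartesianAt Y) (e : Y ≅ Y') : IsCartesianAt Y' :=
  (isCartesianAt_iff _).2 (isIso_ran_unit_of_iso _ e ((isCartesianAt_iff _).1 h))

end Prederivator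

/-! ### The tower of the stages of a spectrum -/

/-- The poset `ℕ × V`. -/
def Tower : Type w := ULift.{w} ℕ × Band.{w}

instance : PartialOrder Tower.{w} := inferInstanceAs (PartialOrder (ULift.{w} ℕ × Band.{w}))
instance : Countable Tower.{w} := inferInstanceAs (Countable (ULift.{w} ℕ × Band.{w}))

namespace Band

/-- The diagonal element `(i, i)`. -/
abbrev diag (i : ℤ) : Band.{w} := ⟨⟨(i, i), by simp⟩⟩

theorem eq_or_of_le (x : Band.{w}) : x.down.1.1 = x.down.1.2 ∨ |x.down.1.1 - x.down.1.2| = 1 := by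
  obtain ⟨⟨⟨i, j⟩, h⟩⟩ := x
  dsimp only at *
  rw [abs_le] at h
  rw [abs_eq (by norm_num)]
  omega

theorem abs_eq_one_iff (x : Band.{w}) : |x.down.1.1 - x.down.1.2| = 1 ↔ x.down.1.1 ≠ x.down.1.2 := by
  refine ⟨fun h h' => ?_, fun h => (x.eq_or_of_le).resolve_left h⟩
  rw [h'] at h
  simp at h

end Band

namespace Tower

/-- The elements at which the stages of a spectrum keep their values: at stage `n` these are the
boundary of `V` and the diagonal elements `(i, i)` with `n ≤ i`. -/
abbrev Kept (x : Tower.{w}) : Prop :=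
  x.2.down.1.1 ≠ x.2.down.1.2 ∨ (x.1.down : ℤ) ≤ x.2.down.1.1

/-- All elements except the `(n, i, i)` with `i < n`, for a fixed `i`. -/
abbrev Off (i : ℤ) (x : Tower.{w}) : Prop :=
  x.2.down.1.1 ≠ x.2.down.1.2 ∨ x.2.down.1.1 ≠ i ∨ (x.1.down : ℤ) ≤ i

theorem Kept.off {x : Tower.{w}} (h : Kept x) (i : ℤ) : Off i x := by
  unfold Kept at h
  unfold Off
  omega

/-- The retraction of the part of the tower above `(n, i, i)` to the square. -/
def toCospan (i : ℤ) (x : Tower.{w}) : UnitSquare.Cospan.{w} :=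
  -- The default value plays no role: an element of `Off i` above `(n, i, i)` with `i < n` cannot be
  -- some `(m, i, i)`, so at least one of its coordinates in `V` is at least `i + 1`.
  if h : UnitSquare.pt.{w} (decide (i + 1 ≤ x.2.down.1.1)) (decide (i + 1 ≤ x.2.down.1.2)) ≠
      UnitSquare.pt false false then ⟨_, h⟩ else ⟨UnitSquare.pt true true, by decide⟩

end Tower

theorem UnitSquare.pt_le_pt (a b c d : Bool) :
    UnitSquare.pt.{w} a b ≤ UnitSquare.pt c d ↔ a ≤ c ∧ b ≤ d := Iff.rfl

namespace Shape
variable (Dia : DiagramDomain.{w})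

/-- The square of `V` at `(i, i)`. -/
noncomputable abbrev diagSquare (i : ℤ) : square Dia ⥤ band Dia :=
  Monotone.functor (f := fun s => Band.squareMap s (Band.diag i))
    fun _ _ h => Band.squareMap_mono h le_rfl

noncomputable abbrev tower : Shape Dia := poset Dia Tower.{w}
noncomputable abbrev kept : Shape Dia := poset Dia {x : Tower.{w} // x.Kept}
noncomputable abbrev off (i : ℤ) : Shape Dia := poset Dia {x : Tower.{w} // x.Off i}
noncomputable abbrev keptIncl : kept Dia ⥤ tower Dia := subtypeIncl Dia _
noncomputable abbrev offIncl (i : ℤ) : off Dia i ⥤ tower Dia := subtypeIncl Dia _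

/-- The inclusion of the kept elements into the complement of the column at `i`. -/
noncomputable abbrev keptOff (i : ℤ) : kept Dia ⥤ off Dia i :=
  Monotone.functor (f := fun x : {x : Tower.{w} // x.Kept} =>
    (⟨x.1, x.2.off i⟩ : {x : Tower.{w} // x.Off i})) fun _ _ h => h

/-- The square of the tower at `(n, i, i)`. -/
noncomputable abbrev towerSquare (n : ℕ) (i : ℤ) : square Dia ⥤ tower Dia :=
  Monotone.functor (f := fun s => (⟨n⟩, Band.squareMap s (Band.diag i)))
    fun _ _ h => ⟨le_rfl, Band.squareMap_mono h le_rfl⟩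

theorem _root_.Tower.off_squareMap (n : ℕ) (i : ℤ) (s : UnitSquare.{w})
    (hs : s ≠ UnitSquare.pt false false) : Tower.Off i (⟨n⟩, Band.squareMap s (Band.diag i)) := by
  obtain ⟨⟨a, b⟩⟩ := s
  cases a <;> cases b <;> simp [Band.squareMap, Tower.Off] at hs ⊢

/-- The restriction of the square of the tower at `(n, i, i)` to the cospan. -/
noncomputable abbrev towerCospan (n : ℕ) (i : ℤ) : cospan Dia ⥤ off Dia i :=
  Monotone.functor (f := fun s : UnitSquare.Cospan.{w} =>
    (⟨(⟨n⟩, Band.squareMap s.1 (Band.diag i)), Tower.off_squareMap n i s.1 s.2⟩ :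
      {x : Tower.{w} // x.Off i}))
    fun _ _ h => ⟨le_rfl, Band.squareMap_mono h le_rfl⟩

/-- The projection of the tower to `V`. -/
noncomputable abbrev towerProj : tower Dia ⥤ band Dia :=
  Monotone.functor (f := fun x : Tower.{w} => x.2) fun _ _ h => h.2

end Shape

/-! ### Values of right Kan extensions from parts of the tower. -/

namespace Prederivator
variable {Dia : DiagramDomain.{w}} {D : Prederivator.{w, v, u} Dia} {J K : Shape Dia}

/-- Once the column over `(i,i)` is removed above level `i`, every remaining element above `(n,i,i)`
has a largest element of the cospan at `(n,i,i)` below it. Hence the cospan is initial in that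
coslice, and the value at `(n,i,i)` of an extension from `Off i` is a pullback. -/
theorem isExact_towerCospan [IsDerivator D] {n : ℕ} {i : ℤ} (hi : i < n)
    (δ : Shape.cospanIncl Dia ⋙ Shape.towerSquare Dia n i ⟶
      Shape.towerCospan Dia n i ⋙ Shape.offIncl Dia i) : D.IsExact δ := by
  refine isExact_of_poset_coslice δ (fun _ ρ => Tower.toCospan i ρ.1) ?_ ?_
  · rintro ⟨⟨a, b⟩⟩ ⟨⟨⟨m⟩, ⟨⟨⟨j, k⟩, hjk⟩⟩⟩, hρ⟩ h
    change UnitSquare.pt a b ≤ (Tower.toCospan i _).1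
    obtain ⟨h1, h2, h3⟩ : n ≤ m ∧ (bif a then i + 1 else i) ≤ j ∧ (bif b then i + 1 else i) ≤ k := h
    unfold Tower.toCospan
    dsimp only at *
    split_ifs with h4
    · rw [UnitSquare.pt_le_pt]
      cases a <;> cases b <;> simp at h2 h3 <;> simp [Bool.le_iff_imp, h2, h3]
    · rw [UnitSquare.pt_le_pt]
      exact ⟨Bool.le_true _, Bool.le_true _⟩
  · rintro ⟨⟨a, b⟩⟩ ⟨⟨⟨m⟩, ⟨⟨⟨j, k⟩, hjk⟩⟩⟩, hρ⟩ ⟨⟨⟨c, d⟩⟩, hc⟩ h -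
    change (n ≤ m ∧ (bif c then i + 1 else i) ≤ j ∧ (bif d then i + 1 else i) ≤ k) ↔
      UnitSquare.pt c d ≤ (Tower.toCospan i _).1
    obtain ⟨h1, h2, h3⟩ : n ≤ m ∧ (bif a then i + 1 else i) ≤ j ∧ (bif b then i + 1 else i) ≤ k := h
    have h2' : i ≤ j := by cases a <;> simp at h2 <;> omega
    have h3' : i ≤ k := by cases b <;> simp at h3 <;> omega
    unfold Tower.toCospan
    have hρ' : j ≠ k ∨ j ≠ i ∨ (m : ℤ) ≤ i := hρ
    dsimp only at *
    split_ifs with h4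
    · rw [UnitSquare.pt_le_pt]
      cases c <;> cases d <;> simp [h1, h2', h3', Bool.le_iff_imp]
    -- Both coordinates equal `i` here and the level is `m ≥ n > i`, which `Off i` excludes.
    · exfalso
      rw [abs_le] at hjk
      simp at h4
      omega

end Prederivator

namespace Prederivator
variable {Dia : DiagramDomain.{w}} {D : Prederivator.{w, v, u} Dia} {J K : Shape Dia}

/-- Sections are compatible with functors of the second factor. -/
def _root_.Shape.sectComp (K : Shape Dia) {A B : Shape Dia} (f : A ⥤ B) (a : A) :
    K.sect a ⋙ Shape.prodMap (𝟭 K) f ≅ K.sect (f.obj a) :=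
  NatIso.ofComponents (fun _ => Iso.refl _) fun g => by
    refine Prod.ext ?_ ?_ <;> simp

theorem isIso_sect_prodMap_iff {A B : Shape Dia} (f : A ⥤ B) (a : A)
    {X Y : D.obj (K.prod B)} (g : X ⟶ Y) :
    IsIso ((D.map (K.sect a)).map ((D.map (Shape.prodMap (𝟭 K) f)).map g)) ↔
      IsIso ((D.map (K.sect (f.obj a))).map g) := by
  rw [← isIso_map_congr_iff (K.sectComp f a), isIso_map_comp_iff]

/-- If `Y` is extended along `u ⋙ v`, it is of the form `v_* (u_* -)`, hence local for `v`. -/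
theorem isIso_ran_unit_of_comp [IsDerivator D] {I : Shape Dia} (u : I ⥤ J) (v : J ⥤ K) [v.Full]
    [v.Faithful] (Y : D.obj K) (h : IsIso ((D.ranAdj (u ⋙ v)).unit.app Y)) :
    IsIso ((D.ranAdj v).unit.app Y) :=
  isIso_ran_unit_of_iso v
    ((asIso ((D.ranAdj (u ⋙ v)).unit.app Y)) ≪≫ (ranComp D u v).app _).symm
    (isIso_ran_unit_ran v _)

/-- A square at `(n,i,i)` of a local object is a pullback because the object is also extended from
`Off i`. Conversely, compare `Y` with the localisation `q_* q^* Y`. They agree on kept elements,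
both have cartesian squares, and agreement spreads downwards along each diagonal. -/
theorem isIso_ran_unit_kept_iff [IsDerivator D] (Y : D.obj (K.prod (.tower Dia))) :
    IsIso ((D.ranAdj (Shape.prodMap (𝟭 K) (Shape.keptIncl Dia))).unit.app Y) ↔
      ∀ (n : ℕ) (i : ℤ), i < n →
        IsCartesianAt ((D.map (Shape.prodMap (𝟭 K) (Shape.towerSquare Dia n i))).obj Y) := by
  have hq := Shape.prodMap_full (𝟭 K) (Shape.keptIncl Dia)
  have hq' := Shape.prodMap_faithful (𝟭 K) (Shape.keptIncl Dia)
  have key (Y : D.obj (K.prod (.tower Dia)))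
      (h : IsIso ((D.ranAdj (Shape.prodMap (𝟭 K) (Shape.keptIncl Dia))).unit.app Y)) (n : ℕ)
      (i : ℤ) (hi : i < n) :
      IsCartesianAt ((D.map (Shape.prodMap (𝟭 K) (Shape.towerSquare Dia n i))).obj Y) := by
    rw [isCartesianAt_iff]
    have := Shape.prodMap_full (𝟭 K) (Shape.offIncl Dia i)
    have := Shape.prodMap_faithful (𝟭 K) (Shape.offIncl Dia i)
    -- The kept elements form a subset of `Off i`, so the extension can be made in two steps, of
    -- which only the second is used.
    have h1 := isIso_ran_unit_of_comp (Shape.prodMap (𝟭 K) (Shape.keptOff Dia i))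
      (Shape.prodMap (𝟭 K) (Shape.offIncl Dia i)) Y h
    let δ : Shape.cospanIncl Dia ⋙ Shape.towerSquare Dia n i ⟶
      Shape.towerCospan Dia n i ⋙ Shape.offIncl Dia i := 𝟙 _
    have h2 := isExact_prodWhiskerRight δ (isExact_towerCospan (D := D) hi δ) K
    have : IsIso (Shape.prodWhiskerRight K δ) := IsIso.id _
    exact isIso_ran_unit_map (u' := Shape.prodMap (𝟭 K) (Shape.cospanIncl Dia))
      (t := Shape.prodMap (𝟭 K) (Shape.towerSquare Dia n i))
      (v := Shape.prodMap (𝟭 K) (Shape.towerCospan Dia n i))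
      (u := Shape.prodMap (𝟭 K) (Shape.offIncl Dia i)) (Shape.prodWhiskerRight K δ) h2 Y h1
  refine ⟨key Y, fun h => ?_⟩
  set f := (D.ranAdj (Shape.prodMap (𝟭 K) (Shape.keptIncl Dia))).unit.app Y
  have h' := key _ (isIso_ran_unit_ran _
    ((D.map (Shape.prodMap (𝟭 K) (Shape.keptIncl Dia))).obj Y))
  have hf : IsIso ((D.map (Shape.prodMap (𝟭 K) (Shape.keptIncl Dia))).map f) :=
    isIso_map_ran_unit _ Y
  have hk (x : Tower) (hx : x.Kept) : IsIso ((D.map (K.sect (A := .tower Dia) x)).map f) := by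
    have := (isIso_sect_prodMap_iff (K := K) (Shape.keptIncl Dia) ⟨x, hx⟩ f).1 inferInstance
    exact this
  -- Induction on the depth `k = n - 1 - i` below the kept part. The cospan at `(n,i,i)` consists of
  -- two boundary elements and `(n,i+1,i+1)`; the latter is kept when `k = 0` and has smaller depth
  -- otherwise.
  have hd (k : ℕ) : ∀ (n : ℕ) (i : ℤ), i = n - 1 - k →
      IsIso ((D.map (K.sect (A := .tower Dia) (⟨n⟩, Band.diag i))).map f) := by
    induction k with
    | zero =>
      intro n i hi
      have h1 := (isCartesianAt_iff _).1 (h n i (by omega))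
      have h2 := (isCartesianAt_iff _).1 (h' n i (by omega))
      have h3 := isIso_of_isIso_ran_unit _
        ((D.map (Shape.prodMap (𝟭 K) (Shape.towerSquare Dia n i))).map f) h1 h2
        (isIso_of_sect _ fun c => ?_)
      · exact (isIso_sect_prodMap_iff (K := K) (Shape.towerSquare Dia n i)
          (UnitSquare.pt false false) f).1 inferInstance
      · rw [isIso_sect_prodMap_iff, isIso_sect_prodMap_iff]
        refine hk _ ?_
        obtain ⟨⟨⟨a, b⟩⟩, hc⟩ := c
        cases a <;> cases b
        · exact absurd rfl hc
        · exact Or.inl (show i ≠ i + 1 by omega)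
        · exact Or.inl (show i + 1 ≠ i by omega)
        · exact Or.inr (show (n : ℤ) ≤ i + 1 by omega)
    | succ k ih =>
      intro n i hi
      have h1 := (isCartesianAt_iff _).1 (h n i (by omega))
      have h2 := (isCartesianAt_iff _).1 (h' n i (by omega))
      have h3 := isIso_of_isIso_ran_unit _
        ((D.map (Shape.prodMap (𝟭 K) (Shape.towerSquare Dia n i))).map f) h1 h2
        (isIso_of_sect _ fun c => ?_)
      · exact (isIso_sect_prodMap_iff (K := K) (Shape.towerSquare Dia n i)
          (UnitSquare.pt false false) f).1 inferInstance
      · rw [isIso_sect_prodMap_iff, isIso_sect_prodMap_iff]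
        obtain ⟨⟨⟨a, b⟩⟩, hc⟩ := c
        cases a <;> cases b
        · exact absurd rfl hc
        · exact hk _ (Or.inl (show i ≠ i + 1 by omega))
        · exact hk _ (Or.inl (show i + 1 ≠ i by omega))
        · exact ih n (i + 1) (by push_cast at hi; omega)
  refine isIso_of_sect _ fun x => ?_
  by_cases hx : x.Kept
  · exact hk x hx
  · obtain ⟨⟨n⟩, ⟨⟨⟨i, j⟩, hij⟩⟩⟩ := x
    obtain ⟨h1, h2⟩ := not_or.1 hx
    obtain rfl : i = j := not_not.1 h1
    have h3 : i < n := not_le.1 h2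
    exact hd (n - 1 - i).toNat n i (by omega)

/-- The square of `isExact_sectCell` with its identity 2-cell read in the other direction; in this
form exactness concerns the right Kan extensions along `u` and `u × A`. The comparison of coslices
inserts `𝟙 a` and is left adjoint to forgetting the component in `A`. -/
theorem isExact_sectCell' [IsDerivator D] (u : J ⥤ K) {A : Shape Dia} (a : A)
    (δ : u ⋙ K.sect a ⟶ J.sect a ⋙ Shape.prodMap u (𝟭 A)) (hδ : δ = 𝟙 _) : D.IsExact δ := by
  let T (k : K) : StructuredArrow k u ⥤ Shape.coslice (Shape.prodMap u (𝟭 A)) (k, a) :=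
    { obj x := StructuredArrow.mk (T := Shape.prodMap u (𝟭 A)) (Y := (x.right, a)) (x.hom, 𝟙 a)
      map f := StructuredArrow.homMk (f.right, 𝟙 a)
        (Prod.ext (StructuredArrow.w f) (Category.comp_id _))
      map_comp f g := CommaMorphism.ext rfl (Prod.ext rfl (Category.comp_id _).symm) }
  let R (k : K) : Shape.coslice (Shape.prodMap u (𝟭 A)) (k, a) ⥤ StructuredArrow k u :=
    { obj x := StructuredArrow.mk (Y := x.right.1) x.hom.1
      map f := StructuredArrow.homMk f.right.1 (congr_arg Prod.fst (StructuredArrow.w f)) }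
  have adj (k : K) : T k ⊣ R k := Adjunction.mkOfHomEquiv
    { homEquiv x y :=
        { toFun f := StructuredArrow.homMk f.right.1 (congr_arg Prod.fst (StructuredArrow.w f))
          invFun f := StructuredArrow.homMk (f.right, y.hom.2)
            (Prod.ext (StructuredArrow.w f) (Category.id_comp _))
          left_inv f := by
            have h : 𝟙 a ≫ f.right.2 = y.hom.2 := congr_arg Prod.snd (StructuredArrow.w f)
            exact CommaMorphism.ext rfl
              (Prod.ext rfl (h.symm.trans (Category.id_comp (X := a) f.right.2)))
          right_inv f := rfl }
      homEquiv_naturality_left_symm _ _ :=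
        CommaMorphism.ext rfl (Prod.ext rfl (Category.id_comp _).symm)
      homEquiv_naturality_right _ _ := by ext; rfl }
  refine isExact_of_cocomparison _ T (fun k => ⟨_, ⟨adj k⟩⟩) (fun k => rfl) fun k x => ?_
  subst hδ
  refine Prod.ext ?_ ?_
  · change x.hom ≫ 𝟙 _ = x.hom ≫ u.map (𝟙 _)
    simp
  · change 𝟙 a ≫ 𝟙 a = 𝟙 a ≫ 𝟙 a
    rfl

/-- Restriction to a parameter `a` commutes with `u_*`, and the restrictions to all `a` jointly
detect isomorphisms. -/
theorem isIso_ran_unit_shift_iff [IsDerivator D] (u : J ⥤ K) {A : Shape Dia}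
    (Y : D.obj (K.prod A)) :
    IsIso ((D.ranAdj (Shape.prodMap u (𝟭 A))).unit.app Y) ↔
      ∀ a : A, IsIso ((D.ranAdj u).unit.app ((D.map (K.sect a)).obj Y)) := by
  have h (a : A) : IsIso ((D.ranAdj u).unit.app ((D.map (K.sect a)).obj Y)) ↔
      IsIso ((D.map (K.sect a)).map ((D.ranAdj (Shape.prodMap u (𝟭 A))).unit.app Y)) := by
    let δ : u ⋙ K.sect a ⟶ J.sect a ⋙ Shape.prodMap u (𝟭 A) := 𝟙 (J.sect a ⋙ Shape.prodMap u (𝟭 A))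
    have : IsIso δ := IsIso.id _
    have hδ : D.IsExact δ := isExact_sectCell' u a _ rfl
    exact isIso_ran_unit_iff δ ((isExact_iff_rmate (D := D) δ).1 hδ) Y (𝟭 _)
  simp only [h]
  exact ⟨fun _ _ => inferInstance, fun h => isIso_of_sect _ h⟩

/-! ### Spectra in terms of the tower -/

theorem isPrespectrum_iff [IsDerivator D] (hD : D.IsPointed) (X : D.obj (K.prod (.band Dia))) :
    IsPrespectrum X ↔ ∀ (k : K) (x : Band), x.down.1.1 ≠ x.down.1.2 →
      IsZero ((D.map (Shape.incl (K := K.prod (.band Dia)) (k, x))).obj X) := by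
  have e (k : K) (x : Band.Boundary) :
      Shape.incl (K := K.prod (.boundary Dia)) (k, x) ⋙
        Shape.prodMap (𝟭 K) (Shape.boundaryIncl Dia) ≅
      Shape.incl (K := K.prod (.band Dia)) (k, x.1) := Discrete.natIso fun _ => Iso.refl _
  refine ⟨fun h k x hx => h.isZero_map _ fun _ => (Band.abs_eq_one_iff x).2 hx, fun h => ?_⟩
  refine isZero_of_incl hD fun ⟨k, x⟩ => ?_
  rw [← isZero_map_comp_iff, isZero_map_congr_iff (e k x)]
  exact h k x.1 ((Band.abs_eq_one_iff _).1 x.2)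

/-- The square `w^* X` is cartesian iff it is so at each parameter `x` of `V`. At `(i,i)` this is
the square of `X` starting there; at a boundary parameter nothing is required. -/
theorem isOmegaSpectrum_iff_diag [IsDerivator D] (hD : D.IsPointed)
    (X : D.obj (K.prod (.band Dia))) :
    IsOmegaSpectrum hD X ↔ IsPrespectrum X ∧
      ∀ i, IsCartesianAt ((D.map (Shape.prodMap (𝟭 K) (Shape.diagSquare Dia i))).obj X) := by
  rw [isOmegaSpectrum_iff]
  refine and_congr_right fun hX => ?_
  rw [isCartesianAt_iff (D := D.shift (.band Dia))]
  refine (isIso_ran_unit_shift_iff (D := D) (Shape.prodMap (𝟭 K) (Shape.cospanIncl Dia))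
    (bandSquare X)).trans ?_
  simp only [← isCartesianAt_iff]
  have e (i : ℤ) : (D.map ((K.prod (.square Dia)).sect (A := .band Dia) (Band.diag i))).obj
      (bandSquare X) ≅ (D.map (Shape.prodMap (𝟭 K) (Shape.diagSquare Dia i))).obj X := by
    refine ((D.mapComp _ _).app X).symm ≪≫ eqToIso (map_eq_of_eq ?_ X)
    exact CategoryTheory.Functor.ext (fun _ => rfl) fun _ _ f =>
      Prod.ext ((Category.id_comp _).trans (Category.comp_id _)).symm (Subsingleton.elim _ _)
  refine ⟨fun h i => (h _).of_iso (e i), fun h x => ?_⟩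
  rcases x.eq_or_of_le with hx | hx
  · obtain ⟨⟨⟨i, j⟩, hij⟩⟩ := x
    obtain rfl : i = j := hx
    exact (h i).of_iso (e i).symm
  -- For `i ≠ j` all four values `(i,j)`, `(j+1,j)`, `(i,i+1)`, `(j+1,i+1)` of `w` lie in the
  -- boundary, so the square is zero.
  · refine isCartesianAt_of_isZero hD ?_
    rw [← isZero_map_comp_iff]
    refine hX.isZero_map _ ?_
    rintro ⟨k, ⟨⟨a, b⟩⟩⟩
    obtain ⟨⟨⟨i, j⟩, hij⟩⟩ := x
    rw [Band.abs_eq_one_iff] at hx ⊢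
    dsimp only at hx
    rw [abs_le] at hij
    change (bif a then j + 1 else i) ≠ (bif b then i + 1 else j)
    cases a <;> cases b <;> simp <;> dsimp only at hij <;> omega

end Prederivator

/-! ### Right Kan extensions of spectra and the universal property of spectrification. -/

namespace Prederivator
variable {Dia : DiagramDomain.{w}} {D : Prederivator.{w, v, u} Dia} {J K : Shape Dia}

/-- The squares of `π^* X` at `(n,i,i)` do not depend on `n`, so the conditions for `i < n` cover
every `i`. -/
theorem isOmegaSpectrum_iff_tower [IsDerivator D] (hD : D.IsPointed)
    (X : D.obj (K.prod (.band Dia))) :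
    IsOmegaSpectrum hD X ↔ IsPrespectrum X ∧
      IsIso ((D.ranAdj (Shape.prodMap (𝟭 K) (Shape.keptIncl Dia))).unit.app
        ((D.map (Shape.prodMap (𝟭 K) (Shape.towerProj Dia))).obj X)) := by
  rw [isOmegaSpectrum_iff_diag, isIso_ran_unit_kept_iff]
  refine and_congr_right fun _ => ?_
  have h (n : ℕ) (i : ℤ) : (D.map (Shape.prodMap (𝟭 K) (Shape.towerSquare Dia n i))).obj
      ((D.map (Shape.prodMap (𝟭 K) (Shape.towerProj Dia))).obj X) =
        (D.map (Shape.prodMap (𝟭 K) (Shape.diagSquare Dia i))).obj X :=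
    map_eq_map_map (CategoryTheory.Functor.ext (fun _ => rfl) fun _ _ f =>
      Prod.ext ((Category.id_comp _).trans (Category.comp_id _)).symm (Subsingleton.elim _ _)) X
  simp only [h]
  -- Any natural number above `i` would do for `n`; for negative `i` the truncation gives `0`.
  exact ⟨fun h _ i _ => h i, fun h i => h (i + 1).toNat i (by omega)⟩

/-- Restriction to the boundary acts on the factor `V` and commutes with Kan extension in the factor
`J`, which preserves zero objects. The same holds for left Kan extensions. -/
theorem IsPrespectrum.ran [IsDerivator D] (hD : D.IsPointed) (u : J ⥤ K)
    {X : D.obj (J.prod (.band Dia))} (hX : IsPrespectrum X) :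
    IsPrespectrum ((D.ran (Shape.prodMap u (𝟭 (Shape.band Dia)))).obj X) := by
  have := (isExact_iff_rmate (D := D) _).1 (isExact_prodCell (D := D) u (Shape.boundaryIncl Dia))
  exact (hD.isZero_ran (Shape.prodMap u (𝟭 (Shape.boundary Dia))) hX).of_iso
    ((asIso (D.rmate (prodCell u (Shape.boundaryIncl Dia)))).app X)

theorem IsPrespectrum.lan [IsDerivator D] (hD : D.IsPointed) (u : J ⥤ K)
    {X : D.obj (J.prod (.band Dia))} (hX : IsPrespectrum X) :
    IsPrespectrum ((D.lan (Shape.prodMap u (𝟭 (Shape.band Dia)))).obj X) := by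
  have := (isExact_iff_lmate (D := D) _).1 (isExact_prodCell' (D := D) u (Shape.boundaryIncl Dia))
  exact (hD.isZero_lan (Shape.prodMap u (𝟭 (Shape.boundary Dia))) hX).of_iso
    ((asIso (D.lmate (prodCell' u (Shape.boundaryIncl Dia)))).app X).symm

/-- Extension along `u` commutes both with `π^*` and with `q_*`, so it preserves the property of
being extended from the kept part. -/
theorem IsOmegaSpectrum.ran [IsDerivator D] {hD : D.IsPointed} (u : J ⥤ K)
    {X : D.obj (J.prod (.band Dia))} (hX : IsOmegaSpectrum hD X) :
    IsOmegaSpectrum hD ((D.ran (Shape.prodMap u (𝟭 (Shape.band Dia)))).obj X) := by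
  rw [isOmegaSpectrum_iff_tower] at hX ⊢
  refine ⟨hX.1.ran hD u, ?_⟩
  have h2 := hX.2
  have h3 := (isExact_iff_rmate (D := D) _).1 (isExact_prodCell (D := D) u (Shape.towerProj Dia))
  have := Shape.prodMap_full (𝟭 K) (Shape.keptIncl Dia)
  have := Shape.prodMap_faithful (𝟭 K) (Shape.keptIncl Dia)
  let W := (D.map (Shape.prodMap (𝟭 J) (Shape.keptIncl Dia))).obj
    ((D.map (Shape.prodMap (𝟭 J) (Shape.towerProj Dia))).obj X)
  -- The chain is `π^* u_* X ≅ u_* π^* X ≅ u_* q_* q^* π^* X ≅ (q ⋙ u)_* q^* π^* X ≅ q_* u_* q^* π^*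
  -- X`, products with identities being understood.
  let e₁ := (@asIso _ _ _ _ (D.rmate (prodCell u (Shape.towerProj Dia))) h3).app X
  let e₂ := (D.ran (Shape.prodMap u (𝟭 (Shape.tower Dia)))).mapIso (@asIso _ _ _ _ _ h2)
  let e₃ := (ranComp D (Shape.prodMap (𝟭 J) (Shape.keptIncl Dia))
    (Shape.prodMap u (𝟭 (Shape.tower Dia)))).app W
  let e₄ := (ranComp D (Shape.prodMap u (𝟭 (Shape.kept Dia)))
    (Shape.prodMap (𝟭 K) (Shape.keptIncl Dia))).app W
  have h : Shape.prodMap (𝟭 J) (Shape.keptIncl Dia) ⋙ Shape.prodMap u (𝟭 (Shape.tower Dia)) =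
    Shape.prodMap u (𝟭 (Shape.kept Dia)) ⋙ Shape.prodMap (𝟭 K) (Shape.keptIncl Dia) := rfl
  exact isIso_ran_unit_of_iso _ (e₁ ≪≫ e₂ ≪≫ e₃.symm ≪≫ e₄).symm (isIso_ran_unit_ran _ _)

theorem bijective_map_of_isIso_ran_unit [HasKan D] (u : J ⥤ K) {Z : D.obj K}
    (h : IsIso ((D.ranAdj u).unit.app Z)) (W : D.obj K) :
    Function.Bijective fun f : W ⟶ Z => (D.map u).map f := by
  have h1 := ((D.ranAdj u).homEquiv W ((D.map u).obj Z)).symm.bijective.comp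
    (bijective_comp_iso W ((D.ranAdj u).unit.app Z))
  refine cast (congrArg Function.Bijective (funext fun f => ?_)) h1
  simp [Adjunction.homEquiv_counit]

/-- Local objects are orthogonal to every arrow that `u^*` inverts, since maps into a local object
are computed after restriction. -/
theorem bijective_comp_of_isIso_ran_unit [HasKan D] (u : J ⥤ K) {Z W W' : D.obj K}
    (h : IsIso ((D.ranAdj u).unit.app Z)) (y : W ⟶ W') (hy : IsIso ((D.map u).map y)) :
    Function.Bijective fun f : W' ⟶ Z => y ≫ f := by
  refine (Function.Bijective.of_comp_iff' (bijective_map_of_isIso_ran_unit u h W) _).1 ?_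
  have h1 := (bijective_iso_comp ((D.map u).map y) _).comp (bijective_map_of_isIso_ran_unit u h W')
  refine cast (congrArg Function.Bijective (funext fun f => ?_)) h1
  exact ((D.map u).map_comp y f).symm

/-- The projection `π` has the left adjoint `x ↦ (0, x)`, so each slice of `π` over `x` is compared
with the elements below `x` by a right adjoint functor. Hence `X` is itself the left Kan extension
of `π^* X`. -/
theorem bijective_map_towerProj [IsDerivator D] (X Z : D.obj (K.prod (.band Dia))) :
    Function.Bijective fun f : X ⟶ Z =>
      (D.map (Shape.prodMap (𝟭 K) (Shape.towerProj Dia))).map f := by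
  let δ : Shape.towerProj Dia ⋙ 𝟭 _ ⟶ Shape.towerProj Dia ⋙ 𝟭 _ := 𝟙 _
  have h : D.IsExact δ := isExact_of_poset_slice δ (fun _ ρ => ((⟨0⟩, ρ) : Tower))
    (fun _ _ h => h) fun x ρ c _ _ => ⟨fun h => ⟨Nat.zero_le _, h⟩, fun h => h.2⟩
  have h := isExact_prodWhiskerRight δ h K
  have hδ : IsIso (Shape.prodWhiskerRight K δ) := IsIso.id _
  have h0 : (D.map (Shape.prodMap (𝟭 K) (𝟭 (Shape.band Dia)))) = 𝟭 _ := D.map_id _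
  -- Restriction along the identity returns `X` only up to a propositional equality, so the source
  -- is made a variable in order to substitute.
  have hX : ∀ X', X' = X → Function.Bijective fun f : X' ⟶ Z =>
      (D.map (Shape.prodMap (𝟭 K) (Shape.towerProj Dia))).map f := by
    intro X' hX'
    have e : X = (D.map (Shape.prodMap (𝟭 K) (𝟭 (Shape.band Dia)))).obj X := by rw [h0]; rfl
    obtain rfl := hX'.trans e
    let c : X ⟶ (D.map (Shape.prodMap (𝟭 K) (𝟭 (Shape.band Dia)))).obj X := eqToHom e
    have hc : IsLan (Shape.prodMap (𝟭 K) (𝟭 (Shape.band Dia))) c := fun W =>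
      (bijective_iso_comp c _).comp (bijective_map_id X W)
    have h1 := h c hc Z
    have h2 := isIso_map₂ (D := D) _ hδ
    have h3 : IsIso (bcL (u := Shape.prodMap (𝟭 K) (𝟭 (Shape.band Dia)))
        (v := Shape.prodMap (𝟭 K) (Shape.towerProj Dia))
        (u' := Shape.prodMap (𝟭 K) (Shape.towerProj Dia))
        (t := Shape.prodMap (𝟭 K) (𝟭 (Shape.band Dia))) (Shape.prodWhiskerRight K δ) c) := by
      unfold bcL sqL
      infer_instance
    exact (Function.Bijective.of_comp_iff' (bijective_iso_comp _ _) _).1 h1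
  exact hX X rfl

/-- The colimit of the stages of a prespectrum. -/
noncomputable def spectrify (X : D.obj (K.prod (.band Dia))) [IsDerivator D] :
    D.obj (K.prod (.band Dia)) :=
  (D.lan (Shape.prodMap (𝟭 K) (Shape.towerProj Dia))).obj
    ((D.ran (Shape.prodMap (𝟭 K) (Shape.keptIncl Dia))).obj
      ((D.map (Shape.prodMap (𝟭 K) (Shape.keptIncl Dia))).obj
        ((D.map (Shape.prodMap (𝟭 K) (Shape.towerProj Dia))).obj X)))

/-- The arrow corresponds, under full faithfulness of `π^*`, to the localisation unit `π^* X ⟶ q_*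
q^* π^* X` followed by the unit of `π_! ⊣ π^*`. The first is inverted by maps into the local object
`π^* Z`, the second is universal. Neither regularity nor vanishing of `X` on the boundary is
involved. -/
theorem exists_hom_spectrify [IsDerivator D] (hD : D.IsPointed) (X : D.obj (K.prod (.band Dia))) :
    ∃ e : X ⟶ spectrify X, ∀ Z, IsOmegaSpectrum hD Z →
      Function.Bijective fun g : spectrify X ⟶ Z => e ≫ g := by
  have := Shape.prodMap_full (𝟭 K) (Shape.keptIncl Dia)
  have := Shape.prodMap_faithful (𝟭 K) (Shape.keptIncl Dia)
  let π := Shape.prodMap (𝟭 K) (Shape.towerProj Dia)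
  let q := Shape.prodMap (𝟭 K) (Shape.keptIncl Dia)
  let y := (D.ranAdj q).unit.app ((D.map π).obj X)
  let c := (D.lanAdj π).unit.app ((D.ran q).obj ((D.map q).obj ((D.map π).obj X)))
  obtain ⟨e, he⟩ := (bijective_map_towerProj X (spectrify X)).surjective (y ≫ c)
  refine ⟨e, fun Z hZ => ?_⟩
  have h1 : Function.Bijective fun g : spectrify X ⟶ Z => c ≫ (D.map π).map g := isLan_unit _ Z
  have h2 := bijective_comp_of_isIso_ran_unit q ((isOmegaSpectrum_iff_tower hD Z).1 hZ).2 y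
    (isIso_map_ran_unit q _)
  refine (Function.Bijective.of_comp_iff' (bijective_map_towerProj X Z) _).1 ?_
  refine cast (congrArg Function.Bijective (funext fun g => ?_)) (h2.comp h1)
  refine Eq.trans ?_ ((D.map π).map_comp e g).symm
  exact (Category.assoc _ _ _).symm.trans (congr_arg (fun f => f ≫ (D.map π).map g) he.symm)

end Prederivator

namespace Prederivator
variable {Dia : DiagramDomain.{w}}

/-! ### Reflective subprederivators of derivators -/

theorem isRightAdjoint_of_bijective {C C' : Type*} [Category C] [Category C'] (G : C ⥤ C')
    (h : ∀ X, ∃ (Y : C) (c : X ⟶ G.obj Y), ∀ Z, Function.Bijective fun g : Y ⟶ Z => c ≫ G.map g) :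
    G.IsRightAdjoint := by
  choose Y c hc using h
  exact ⟨_, ⟨Adjunction.adjunctionOfEquivLeft (F_obj := Y)
    (fun X Z => Equiv.ofBijective _ (hc X Z)) fun X Z Z' f g => by simp⟩⟩

theorem isLeftAdjoint_of_bijective {C C' : Type*} [Category C] [Category C'] (F : C ⥤ C')
    (h : ∀ X, ∃ (Y : C) (c : F.obj Y ⟶ X), ∀ Z, Function.Bijective fun g : Z ⟶ Y => F.map g ≫ c) :
    F.IsLeftAdjoint := by
  choose Y c hc using h
  exact ⟨_, ⟨Adjunction.adjunctionOfEquivRight (G_obj := Y)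
    (fun Z X => (Equiv.ofBijective _ (hc X Z)).symm) fun Z Z' X f g => by
      rw [Equiv.symm_apply_eq]
      simp only [Equiv.ofBijective_apply, Functor.map_comp, Category.assoc]
      congr 1
      exact ((Equiv.ofBijective _ (hc X Z')).apply_symm_apply g).symm⟩⟩

/-- Orthogonality passes through the adjunction `t^* ⊣ t_*`: restrictions of reflections stay
orthogonal to `Z` when `t_* Z` is an admissible target. -/
theorem bijective_map_comp_of_ran {D : Prederivator.{w, v, u} Dia} [HasKan D] {J K : Shape Dia}
    (t : J ⥤ K) {X Y : D.obj K} (r : X ⟶ Y) (Z : D.obj J)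
    (h : Function.Bijective fun g : Y ⟶ (D.ran t).obj Z => r ≫ g) :
    Function.Bijective fun g : (D.map t).obj Y ⟶ Z => (D.map t).map r ≫ g := by
  refine (Function.Bijective.of_comp_iff' ((D.ranAdj t).homEquiv X Z).bijective _).1 ?_
  refine cast (congrArg Function.Bijective (funext fun g => ?_))
    (h.comp ((D.ranAdj t).homEquiv Y Z).bijective)
  simp [Adjunction.homEquiv_unit]

section full

theorem isIso_hom_iff {C : Type*} [Category C] {P : ObjectProperty C} {X Y : P.FullSubcategory}
    (f : X ⟶ Y) : IsIso f ↔ IsIso f.hom :=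
  ⟨fun _ => ⟨(inv f).hom, congr_arg (fun f => f.hom) (IsIso.hom_inv_id f),
    congr_arg (fun f => f.hom) (IsIso.inv_hom_id f)⟩,
    fun _ => ⟨ObjectProperty.homMk (inv f.hom), P.hom_ext (IsIso.hom_inv_id f.hom),
      P.hom_ext (IsIso.inv_hom_id f.hom)⟩⟩

variable {E : Prederivator.{w, v, u} Dia} {P : ∀ K, ObjectProperty (E.obj K)}
  {hP : ∀ {J K : Shape Dia} (u : J ⥤ K) (X : E.obj K), P K X → P J ((E.map u).obj X)}
  {J K : Shape Dia}

theorem full_hom_bijective {C : Type*} [Category C] {P : ObjectProperty C}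
    (X Y : P.FullSubcategory) : Function.Bijective fun f : X ⟶ Y => f.hom :=
  ⟨fun _ _ h => P.hom_ext h, fun f => ⟨ObjectProperty.homMk f, rfl⟩⟩

/-- In a full subprederivator, universality is the ambient condition tested only against targets
satisfying `P`; the arrow need not be universal in `E`. -/
theorem isLan_full_iff {u : J ⥤ K} {X : (E.full P hP).obj J} {Y : (E.full P hP).obj K}
    (c : X ⟶ ((E.full P hP).map u).obj Y) :
    IsLan u c ↔ ∀ Z, P K Z → Function.Bijective fun g : Y.obj ⟶ Z => c.hom ≫ (E.map u).map g := by
  have key (Z : (E.full P hP).obj K) :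
      (Function.Bijective fun g : Y ⟶ Z => c ≫ ((E.full P hP).map u).map g) ↔
      Function.Bijective fun g : Y.obj ⟶ Z.obj => c.hom ≫ (E.map u).map g :=
    (Function.Bijective.of_comp_iff' (full_hom_bijective X (((E.full P hP).map u).obj Z))
      _).symm.trans (Function.Bijective.of_comp_iff
        (fun g : Y.obj ⟶ Z.obj => c.hom ≫ (E.map u).map g) (full_hom_bijective Y Z))
  exact ⟨fun h Z hZ => (key ⟨Z, hZ⟩).1 (h _), fun h Z => (key Z).2 (h _ Z.property)⟩

theorem eqToHom_app_hom {C C' : Type*} [Category C] [Category C'] {P : ObjectProperty C'}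
    {F G : C ⥤ P.FullSubcategory} (h : F = G) (X : C) :
    ((eqToHom h).app X).hom = eqToHom (by rw [h]) := by
  subst h
  rfl

theorem full_mapComp_hom {I : Shape Dia} (u : I ⥤ J) (v : J ⥤ K) (X : (E.full P hP).obj K) :
    (((E.full P hP).mapComp u v).hom.app X).hom = (E.mapComp u v).hom.app X.obj :=
  (eqToHom_app_hom ((E.full P hP).map_comp u v) X).trans (eqToHom_app (E.map_comp u v) X.obj).symm

theorem full_mapComp_inv {I : Shape Dia} (u : I ⥤ J) (v : J ⥤ K) (X : (E.full P hP).obj K) :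
    (((E.full P hP).mapComp u v).inv.app X).hom = (E.mapComp u v).inv.app X.obj :=
  (eqToHom_app_hom ((E.full P hP).map_comp u v).symm X).trans
    (eqToHom_app (E.map_comp u v).symm X.obj).symm

/-- The strict functoriality isomorphisms of `full` come from equalities other than those of `E`, so
agreement of base change with the ambient one has to be checked on components. -/
theorem full_bcL_hom {J' K' : Shape Dia} {u : J ⥤ K} {v : J' ⥤ J} {u' : J' ⥤ K'} {t : K' ⥤ K}
    (δ : v ⋙ u ⟶ u' ⋙ t) {X : (E.full P hP).obj J} {Y : (E.full P hP).obj K}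
    (c : X ⟶ ((E.full P hP).map u).obj Y) :
    (bcL δ c).hom = bcL (D := E) δ c.hom := by
  have h1 := full_mapComp_inv (hP := hP) v u Y
  have h2 := full_mapComp_hom (hP := hP) u' t Y
  change (E.map v).map c.hom ≫ (((E.full P hP).mapComp v u).inv.app Y).hom ≫
    (E.map₂ δ).app Y.obj ≫ (((E.full P hP).mapComp u' t).hom.app Y).hom = _
  rw [h1, h2]
  rfl

variable [IsDerivator E]

/-- The objects of a reflective family have relative left Kan extensions. -/
theorem exists_isLan_full
    (hrefl : ∀ {J K : Shape Dia} (u : J ⥤ K) (X : E.obj J), P J X →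
      ∃ (Y : E.obj K) (r : (E.lan u).obj X ⟶ Y), P K Y ∧
        ∀ Z, P K Z → Function.Bijective fun g : Y ⟶ Z => r ≫ g)
    (u : J ⥤ K) (X : (E.full P hP).obj J) :
    ∃ (Y : (E.full P hP).obj K) (r : (E.lan u).obj X.obj ⟶ Y.obj)
      (c : X ⟶ ((E.full P hP).map u).obj Y), IsLan u c ∧
      (∀ Z, P K Z → Function.Bijective fun g : Y.obj ⟶ Z => r ≫ g) ∧
        c.hom = (E.lanAdj u).unit.app X.obj ≫ (E.map u).map r := by
  obtain ⟨Y, r, hY, hr⟩ := hrefl u X.obj X.property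
  refine ⟨⟨Y, hY⟩, r, ObjectProperty.homMk ((E.lanAdj u).unit.app X.obj ≫ (E.map u).map r), ?_,
    hr, rfl⟩
  refine (isLan_full_iff _).2 fun Z hZ => ?_
  refine cast (congrArg Function.Bijective (funext fun g => ?_)) ((isLan_unit X.obj Z).comp (hr Z hZ))
  exact (congr_arg (fun f => (E.lanAdj u).unit.app X.obj ≫ f) ((E.map u).map_comp r g)).trans
    (Category.assoc _ _ _).symm

/-- Maps `t^* Y ⟶ Z` are maps `t^* u_! X ⟶ Z`, because `t^*` of the reflection is orthogonal to `Z`.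
By exactness in `E` these are maps `v^* X ⟶ u'^* Z`. -/
theorem isExact_full
    (hran : ∀ {J K : Shape Dia} (u : J ⥤ K) (X : E.obj J), P J X → P K ((E.ran u).obj X))
    (hrefl : ∀ {J K : Shape Dia} (u : J ⥤ K) (X : E.obj J), P J X →
      ∃ (Y : E.obj K) (r : (E.lan u).obj X ⟶ Y), P K Y ∧
        ∀ Z, P K Z → Function.Bijective fun g : Y ⟶ Z => r ≫ g)
    {J' K' : Shape Dia} {u : J ⥤ K} {v : J' ⥤ J} {u' : J' ⥤ K'} {t : K' ⥤ K}
    (δ : v ⋙ u ⟶ u' ⋙ t) (h : E.IsExact δ) : (E.full P hP).IsExact δ := fun X Y c hc => by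
  obtain ⟨Y', r, c', hc', hr, hr'⟩ := exists_isLan_full (hP := hP) hrefl u X
  obtain ⟨f, hf⟩ := (hc' Y).surjective c
  dsimp only at hf
  -- Any universal arrow is isomorphic to the one built from the reflection, so only the latter has
  -- to be considered.
  have : IsIso f := hc'.isIso (by rwa [hf])
  rw [← hf, bcL_comp]
  refine IsLan.comp_iso ?_ _
  refine (isLan_full_iff _).2 fun Z hZ => ?_
  refine cast (congrArg Function.Bijective (funext fun g => ?_)) ((h _ (isLan_unit X.obj) Z).comp
    (bijective_map_comp_of_ran t r Z (hr _ (hran t Z hZ))))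
  have h1 : (bcL δ c').hom = bcL (D := E) δ ((E.lanAdj u).unit.app X.obj) ≫
      (E.map u').map ((E.map t).map r) := by
    rw [full_bcL_hom, hr', bcL_comp]
  refine Eq.trans ?_ (congr_arg (fun f => f ≫ (E.map u').map g) h1).symm
  exact (congr_arg (fun f => _ ≫ f) ((E.map u').map_comp _ _)).trans (Category.assoc _ _ _).symm

theorem hasKan_full
    (hran : ∀ {J K : Shape Dia} (u : J ⥤ K) (X : E.obj J), P J X → P K ((E.ran u).obj X))
    (hrefl : ∀ {J K : Shape Dia} (u : J ⥤ K) (X : E.obj J), P J X →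
      ∃ (Y : E.obj K) (r : (E.lan u).obj X ⟶ Y), P K Y ∧
        ∀ Z, P K Z → Function.Bijective fun g : Y ⟶ Z => r ≫ g) :
    (E.full P hP).HasKan where
  left u := isRightAdjoint_of_bijective _ fun X => by
    obtain ⟨Y, _, c, hc, _⟩ := exists_isLan_full (hP := hP) hrefl u X
    exact ⟨Y, c, hc⟩
  right {J K} u := isLeftAdjoint_of_bijective _ fun X => by
    refine ⟨⟨_, hran u _ X.property⟩, ObjectProperty.homMk ((E.ranAdj u).counit.app X.obj),
      fun Z => ?_⟩
    exact (Function.Bijective.of_comp_iff' (full_hom_bijective (((E.full P hP).map u).obj Z) X)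
      _).1 ((isRan_counit X.obj Z.obj).comp (full_hom_bijective Z ⟨_, hran u _ X.property⟩))

/-- Der2 is inherited, and Der1 up to membership in `P`. Both halves of Der4 follow since exact
squares of `E` stay exact and exactness has a left and a right form. -/
theorem isDerivator_full [hiso : ∀ K, (P K).IsClosedUnderIsomorphisms]
    (hpt : ∀ {K : Shape Dia} (X : E.obj K), (∀ k : K, P _ ((E.map (Shape.incl k)).obj X)) → P K X)
    (hran : ∀ {J K : Shape Dia} (u : J ⥤ K) (X : E.obj J), P J X → P K ((E.ran u).obj X))
    (hrefl : ∀ {J K : Shape Dia} (u : J ⥤ K) (X : E.obj J), P J X →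
      ∃ (Y : E.obj K) (r : (E.lan u).obj X ⟶ Y), P K Y ∧
        ∀ Z, P K Z → Function.Bijective fun g : Y ⟶ Z => r ≫ g) :
    (E.full P hP).IsDerivator := by
  have := hasKan_full (hP := hP) hran hrefl
  refine { der1 := fun {I} K h => ?_, der2 := fun {K X Y} f h => ?_, der4_left := fun u k => ?_,
           der4_right := fun u k => ?_ }
  · have h1 := IsDerivator.der1 (D := E) K h
    let S : Shape Dia := ⟨Σ i, K i, h⟩
    refine { faithful := ⟨fun {X Y} f g hfg => ?_⟩, full := ⟨fun {X Y} f => ?_⟩,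
             essSurj := ⟨fun Y => ?_⟩ }
    · apply (P S).hom_ext
      refine h1.faithful.map_injective (funext fun i => ?_)
      exact congr_arg (fun f => f.hom) (congr_fun hfg i)
    · obtain ⟨g, hg⟩ := h1.full.map_surjective (X := X.obj) (Y := Y.obj) fun i => (f i).hom
      refine ⟨ObjectProperty.homMk g, funext fun i => (P (K i)).hom_ext ?_⟩
      exact congr_fun hg i
    · obtain ⟨Z, ⟨e⟩⟩ := h1.essSurj.mem_essImage (fun i => (Y i).obj)
      have e' (i) : (E.map (J := K i) (K := S) (Sigma.incl (C := fun i => K i) i)).obj Z ≅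
        (Y i).obj := ⟨e.hom i, e.inv i, congr_fun e.hom_inv_id i, congr_fun e.inv_hom_id i⟩
      -- The object glued in `E` lies in `P` because membership is tested at the objects `⟨i, k⟩`,
      -- where it is isomorphic to a value of the given `Y i`.
      have hZ : P S Z := hpt Z fun ⟨i, k⟩ => by
        let a : Shape.incl k ⋙ Sigma.incl (C := fun i => K i) i ≅ Shape.incl (K := S) ⟨i, k⟩ :=
          Discrete.natIso fun _ => Iso.refl _
        have := isIso_map₂ (D := E) (J := Shape.point Dia) (K := S) a.hom inferInstance
        refine (P _).prop_of_iso ((asIso (E.map₂ (J := Shape.point Dia) (K := S) a.hom)).app Z) ?_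
        refine (P _).prop_of_iso ((E.mapComp _ _).app Z).symm ?_
        exact (P _).prop_of_iso ((E.map (Shape.incl k)).mapIso (e' i)).symm (hP _ _ (Y i).property)
      refine ⟨⟨Z, hZ⟩, ⟨⟨fun i => ObjectProperty.homMk (e' i).hom,
        fun i => ObjectProperty.homMk (e' i).inv, funext fun i => (P (K i)).hom_ext ?_,
        funext fun i => (P (K i)).hom_ext ?_⟩⟩⟩
      · exact (e' i).hom_inv_id
      · exact (e' i).inv_hom_id
  · exact (isIso_hom_iff f).2 (IsDerivator.der2 (D := E) f.hom fun k => (isIso_hom_iff _).1 (h k))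
  · exact (isExact_iff_lmate _).1 (isExact_full hran hrefl _
      ((isExact_iff_lmate _).2 (IsDerivator.der4_left u k)))
  · exact (isExact_iff_rmate (D := E.full P hP) _).1 (isExact_full hran hrefl _
      ((isExact_iff_rmate (D := E) _).2 (IsDerivator.der4_right u k)))

end full
end Prederivator

namespace Prederivator
variable {Dia : DiagramDomain.{w}} {D : Prederivator.{w, v, u} Dia} {J K : Shape Dia}

/-! ### Regularity and cartesian squares -/

/-- Regularity speaks of chosen Kan extensions and of one specific comparison. This version says
that the colimit of a limit cone is a limit cone, for arbitrary universal arrows, the compatibility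
`h` identifying `a'` as the induced cone. -/
theorem isRan_of_isRegular [IsDerivator D] (hr : D.IsRegular) {C A : Shape Dia} (hC : IsFiltered C)
    (hA : A.IsFinite) {Y : D.obj (C.prod A)} {W : D.obj (C.prod (.point Dia))}
    {W' : D.obj ((Shape.point Dia).prod (.point Dia))} {Y' : D.obj ((Shape.point Dia).prod A)}
    {a : (D.map (Shape.prodMap (𝟭 C) A.toPoint)).obj W ⟶ Y} (ha : IsRan _ a)
    {b : W ⟶ (D.map (Shape.prodMap C.toPoint (𝟭 (Shape.point Dia)))).obj W'} (hb : IsLan _ b)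
    {d : Y ⟶ (D.map (Shape.prodMap C.toPoint (𝟭 A))).obj Y'} (hd : IsLan _ d)
    {a' : (D.map (Shape.prodMap (𝟭 (Shape.point Dia)) A.toPoint)).obj W' ⟶ Y'}
    (h : a ≫ d = (D.map (Shape.prodMap (𝟭 C) A.toPoint)).map b ≫
      (D.sqR (prodCell' C.toPoint A.toPoint)).app W' ≫
        (D.map (Shape.prodMap C.toPoint (𝟭 A))).map a') : IsRan _ a' := by
  have h1 := hr hC hA Y
  have h2 := isIso_rmate_prodCell' (D := D) A.toPoint C.toPoint
  obtain ⟨g, rfl⟩ := (isRan_counit (u := Shape.prodMap (𝟭 (Shape.point Dia)) A.toPoint) Y'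
    W').surjective a'
  obtain ⟨α, rfl⟩ := (isRan_counit (u := Shape.prodMap (𝟭 C) A.toPoint) Y W).surjective a
  have hα : IsIso α := (isRan_counit Y).isIso ha
  obtain ⟨δ, rfl⟩ := (isLan_unit (u := Shape.prodMap C.toPoint (𝟭 A)) Y Y').surjective d
  have hδ : IsIso δ := (isLan_unit Y).isIso hd
  obtain ⟨β, hβ⟩ := (isLan_unit (u := Shape.prodMap C.toPoint (𝟭 (Shape.point Dia)))
    ((D.ran (Shape.prodMap (𝟭 C) A.toPoint)).obj Y) W').surjective (inv α ≫ b)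
  dsimp only at hβ h
  have hβ' : IsIso β := (isLan_unit _).isIso (by rw [hβ]; exact hb.iso_comp _)
  -- Up to the isomorphisms `β` and `δ` to the chosen extensions, the arrow `g` that classifies `a'`
  -- is the comparison of the regularity axiom, hence invertible.
  suffices h3 : β ≫ g = colimLimComparison Y ≫
      (D.ran (Shape.prodMap (𝟭 (Shape.point Dia)) A.toPoint)).map δ by
    have h4 : IsIso (β ≫ g) := by rw [h3]; infer_instance
    have : IsIso g := IsIso.of_isIso_comp_left β g
    exact (isRan_counit Y').iso_comp g
  apply lan_hom_ext
  rw [Functor.map_comp, reassoc_of% hβ, Functor.map_comp, ← cancel_epi α, IsIso.hom_inv_id_assoc]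
  have h5 := ((D.lanAdj (Shape.prodMap C.toPoint (𝟭 (Shape.point Dia)))).homEquiv _ _).apply_symm_apply
    ((D.ran (Shape.prodMap (𝟭 C) A.toPoint)).map
        ((D.lanAdj (Shape.prodMap C.toPoint (𝟭 A))).unit.app Y) ≫
      inv ((D.rmate (prodCell' C.toPoint A.toPoint)).app
        ((D.lan (Shape.prodMap C.toPoint (𝟭 A))).obj Y)))
  rw [Adjunction.homEquiv_unit] at h5
  change _ ≫ (D.map _).map (colimLimComparison Y) = _ at h5
  rw [reassoc_of% h5]
  have h6 := (D.rmate (prodCell' C.toPoint A.toPoint)).naturality δ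
  dsimp only [Functor.comp_map] at h6
  rw [← cancel_mono ((D.rmate (prodCell' C.toPoint A.toPoint)).app Y')]
  simp only [Category.assoc]
  erw [h6, IsIso.inv_hom_id_assoc]
  rw [← Functor.map_comp]
  apply ran_hom_ext
  have h7 := D.rmate_counit (prodCell' C.toPoint A.toPoint) Y'
  have h8 := (D.sqR (prodCell' C.toPoint A.toPoint)).naturality g
  have h9 := (D.ranAdj (Shape.prodMap (𝟭 C) A.toPoint)).counit.naturality
    ((D.lanAdj (Shape.prodMap C.toPoint (𝟭 A))).unit.app Y ≫
      (D.map (Shape.prodMap C.toPoint (𝟭 A))).map δ)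
  dsimp only [Functor.comp_map, Functor.id_map] at h8 h9
  simp only [Functor.map_comp, Category.assoc] at h h9 ⊢
  erw [h7, reassoc_of% h8, h9]
  exact h.symm

/-- The constant functor at the initial vertex maps to the inclusion of the cospan. -/
def cospanCell (Dia : DiagramDomain.{w}) : (Shape.cospan Dia).toPoint ⋙
    Shape.incl (K := .square Dia) (UnitSquare.pt false false) ⟶ 𝟭 _ ⋙ Shape.cospanIncl Dia where
  app _ := homOfLE ⟨Bool.false_le _, Bool.false_le _⟩
  naturality _ _ _ := Subsingleton.elim _ _

/-- Every element of the cospan lies above `(0,0)`, so the coslice at `(0,0)` is the whole cospan.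
-/
theorem isExact_cospanCell [IsDerivator D] : D.IsExact (cospanCell Dia) := by
  let T : Shape.coslice (Shape.cospan Dia).toPoint ⟨PUnit.unit⟩ ⥤
      Shape.coslice (Shape.cospanIncl Dia) (UnitSquare.pt false false) :=
    { obj x := StructuredArrow.mk (Y := x.right) ((cospanCell Dia).app x.right)
      map f := StructuredArrow.homMk f.right (Subsingleton.elim _ _)
      map_id _ := StructuredArrow.hom_ext _ _ rfl
      map_comp _ _ := StructuredArrow.hom_ext _ _ rfl }
  have hT : T.IsEquivalence :=
    { faithful := ⟨fun _ => StructuredArrow.hom_ext _ _ (Subsingleton.elim _ _)⟩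
      full := ⟨fun g => ⟨StructuredArrow.homMk g.right (Subsingleton.elim _ _),
        StructuredArrow.hom_ext _ _ (Subsingleton.elim _ _)⟩⟩
      essSurj := ⟨fun y => ⟨StructuredArrow.mk (Y := y.right) (𝟙 _),
        ⟨StructuredArrow.isoMk (Iso.refl _) (Subsingleton.elim _ _)⟩⟩⟩ }
  exact isExact_of_cocomparison _ (fun _ => T) (fun _ => inferInstance) (fun _ => rfl)
    fun _ _ => Subsingleton.elim _ _

/-- The cone on the restriction of a square to the cospan with the value at `(0,0)` as vertex. -/
def cospanCone (N : D.obj (K.prod (.square Dia))) :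
    (D.map (Shape.prodMap (𝟭 K) (Shape.cospan Dia).toPoint)).obj ((D.map (Shape.prodMap (𝟭 K)
      (Shape.incl (K := .square Dia) (UnitSquare.pt false false)))).obj N) ⟶
      (D.map (Shape.prodMap (𝟭 K) (Shape.cospanIncl Dia))).obj N :=
  (D.mapComp (Shape.prodMap (𝟭 K) (Shape.cospan Dia).toPoint) (Shape.prodMap (𝟭 K)
      (Shape.incl (K := .square Dia) (UnitSquare.pt false false)))).inv.app N ≫
    (D.map₂ (Shape.prodWhiskerRight K (cospanCell Dia))).app N

/-- Der4 at `(0,0)`: the value of the extension from the cospan is the limit over the cospan, and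
the cone of `N` is obtained from the limit cone through the unit. In this form being cartesian can
be fed to regularity and passed to full subprederivators. -/
theorem isCartesianAt_iff_isRan [IsDerivator D] (N : D.obj (K.prod (.square Dia))) :
    IsCartesianAt N ↔
      IsRan (Shape.prodMap (𝟭 K) (Shape.cospan Dia).toPoint) (cospanCone N) := by
  let u := Shape.prodMap (𝟭 K) (Shape.cospanIncl Dia)
  let δ : Shape.prodMap (𝟭 K) (Shape.cospan Dia).toPoint ⋙ Shape.prodMap (𝟭 K)
      (Shape.incl (K := .square Dia) (UnitSquare.pt false false)) ⟶
      Shape.prodMap (𝟭 K) (𝟭 (Shape.cospan Dia)) ⋙ u := Shape.prodWhiskerRight K (cospanCell Dia)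
  have hδ := (isExact_iff_bcR δ).1
    (isExact_prodWhiskerRight (cospanCell Dia) (isExact_cospanCell (D := D)) K)
  have h1 : bcR δ (𝟙 ((D.map u).obj N)) = cospanCone N ≫ (D.mapComp
      (Shape.prodMap (𝟭 K) (𝟭 (Shape.cospan Dia))) u).hom.app N := by
    unfold bcR sqR cospanCone
    rw [(D.map _).map_id]
    exact (Category.comp_id _).trans (Category.assoc _ _ _).symm
  have h2 : 𝟙 ((D.map u).obj N) = (D.map u).map ((D.ranAdj u).unit.app N) ≫
      (D.ranAdj u).counit.app ((D.map u).obj N) := ((D.ranAdj u).left_triangle_components N).symm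
  rw [← isRan_comp_iso_iff (c := cospanCone N) ((D.mapComp
      (Shape.prodMap (𝟭 K) (𝟭 (Shape.cospan Dia))) u).hom.app N), ← h1]
  refine ⟨fun h => ?_, fun h => ?_⟩
  · have := (isCartesianAt_iff N).1 h
    rw [h2]
    exact hδ _ ((isRan_counit _).iso_comp _)
  · rw [h2, bcR_comp] at h
    have h3 := (hδ _ (isRan_counit (u := u) ((D.map u).obj N))).isIso h
    exact (isIso_sect_prodMap_iff (K := K) (A := .point Dia) (B := .square Dia)
      (Shape.incl (K := .square Dia) (UnitSquare.pt false false)) ⟨PUnit.unit⟩ _).1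
      inferInstance

theorem sqL_app_of_eq_id {J₁ J₂ K₁ K₂ : Shape Dia} {v : J₁ ⥤ J₂} {u₁ : J₁ ⥤ K₁} {u₂ : J₂ ⥤ K₂}
    {t : K₁ ⥤ K₂} (δ : v ⋙ u₂ ⟶ u₁ ⋙ t) (h : v ⋙ u₂ = u₁ ⋙ t) (hδ : δ = eqToHom h) (X : D.obj K₂) :
    (D.sqL δ).app X = eqToHom (map_map_eq h X) := by
  simp [sqL, hδ, mapComp, map₂_eqToHom, eqToHom_app]

theorem sqR_app_of_eq_id {J₁ J₂ K₁ K₂ : Shape Dia} {v : J₁ ⥤ J₂} {u₁ : J₁ ⥤ K₁} {u₂ : J₂ ⥤ K₂}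
    {t : K₁ ⥤ K₂} (δ : u₁ ⋙ t ⟶ v ⋙ u₂) (h : u₁ ⋙ t = v ⋙ u₂) (hδ : δ = eqToHom h) (X : D.obj K₂) :
    (D.sqR δ).app X = eqToHom (map_map_eq h X) := by
  simp [sqR, hδ, mapComp, map₂_eqToHom, eqToHom_app]

theorem cospanCone_naturality {M N : D.obj (K.prod (.square Dia))} (f : M ⟶ N) :
    cospanCone M ≫ (D.map (Shape.prodMap (𝟭 K) (Shape.cospanIncl Dia))).map f =
      (D.map _).map ((D.map _).map f) ≫ cospanCone N := by
  have h1 := (D.mapComp (Shape.prodMap (𝟭 K) (Shape.cospan Dia).toPoint) (Shape.prodMap (𝟭 K)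
      (Shape.incl (K := .square Dia) (UnitSquare.pt false false)))).inv.naturality f
  have h2 := (D.map₂ (Shape.prodWhiskerRight K (cospanCell Dia))).naturality f
  unfold cospanCone
  refine (Category.assoc _ _ _).trans ((congr_arg (fun g => _ ≫ g) h2.symm).trans ?_)
  refine (Category.assoc _ _ _).symm.trans (Eq.trans ?_ (Category.assoc _ _ _))
  exact congr_arg (fun g => g ≫ _) h1.symm

theorem eqToHom_conj_swap {C : Type*} [Category C] {A A₁ A₂ A₃ A₄ B B₁ : C} {m : A ⟶ B}
    {m' : A₁ ⟶ B₁} (p' : A = A₁) (p₁ : A₂ = A₁) (p₂ : A₂ = A₃) (p₃ : A₃ = A₄)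
    (p₄ : A₄ = A) {q : B₁ = B} {q' : B = B₁} (h : m ≫ eqToHom q' = eqToHom p' ≫ m') :
    (eqToHom p₁ ≫ m') ≫ eqToHom q = eqToHom p₂ ≫ eqToHom p₃ ≫ eqToHom p₄ ≫ m := by
  subst p' p₁ p₂ p₃ q
  simpa using h.symm

/-- The cone commutes with change of the parameter shape. All structural arrows are identities of
objects by strictness, and what remains is functoriality of the 2-cell. -/
theorem cospanCone_map (f : J ⥤ K) (N : D.obj (K.prod (.square Dia))) :
    cospanCone ((D.map (Shape.prodMap f (𝟭 (Shape.square Dia)))).obj N) ≫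
      (D.sqL (prodCell' f (Shape.cospanIncl Dia))).app N =
    (D.map (Shape.prodMap (𝟭 J) (Shape.cospan Dia).toPoint)).map
      ((D.sqL (prodCell' f (Shape.incl (K := .square Dia) (UnitSquare.pt false false)))).app N) ≫
      (D.sqR (prodCell' f (Shape.cospan Dia).toPoint)).app _ ≫
        (D.map (Shape.prodMap f (𝟭 (Shape.cospan Dia)))).map (cospanCone N) := by
  have h := map₂_swap (D := D) (p := Shape.prodMap f (𝟭 (Shape.cospan Dia)))
    (q := Shape.prodMap f (𝟭 (Shape.square Dia)))
    (β := Shape.prodWhiskerRight K (cospanCell Dia))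
    (α := Shape.prodWhiskerRight J (cospanCell Dia)) rfl rfl
    (by ext; simp; exact Subsingleton.elim _ _) N
    (map_map_eq (D := D) (u := Shape.prodMap f (𝟭 (Shape.cospan Dia))) (v := Shape.prodMap (𝟭 K) (𝟭 _ ⋙ Shape.cospanIncl Dia))
      (u' := Shape.prodMap (𝟭 J) (𝟭 _ ⋙ Shape.cospanIncl Dia)) (v' := Shape.prodMap f (𝟭 (Shape.square Dia))) rfl N)
    (map_map_eq (D := D) (u := Shape.prodMap f (𝟭 (Shape.cospan Dia)))
      (v := Shape.prodMap (𝟭 K) ((Shape.cospan Dia).toPoint ⋙ Shape.incl (K := .square Dia) (UnitSquare.pt false false)))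
      (u' := Shape.prodMap (𝟭 J) ((Shape.cospan Dia).toPoint ⋙ Shape.incl (K := .square Dia) (UnitSquare.pt false false)))
      (v' := Shape.prodMap f (𝟭 (Shape.square Dia))) rfl N)
  have h1 := sqL_app_of_eq_id (D := D) (prodCell' f (Shape.cospanIncl Dia)) rfl rfl N
  have h2 := sqL_app_of_eq_id (D := D)
    (prodCell' f (Shape.incl (K := .square Dia) (UnitSquare.pt false false))) rfl rfl N
  have h3 := sqR_app_of_eq_id (D := D) (prodCell' f (Shape.cospan Dia).toPoint) rfl rfl
    ((D.map (Shape.prodMap (𝟭 K) (Shape.incl (K := .square Dia) (UnitSquare.pt false false)))).obj N)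
  rw [h1, h2, h3]
  unfold cospanCone mapComp
  simp only [Functor.map_comp, eqToHom_map, eqToHom_app, eqToIso.inv]
  exact eqToHom_conj_swap _ _ _ _ _ h

theorem _root_.Shape.isFinite_cospan : (Shape.cospan Dia).IsFinite where
  finite_obj := inferInstanceAs (Finite {s : ULift (Bool × Bool) // s ≠ UnitSquare.pt false false})
  finite_hom _ _ := inferInstance
  eq_id f g := ⟨le_antisymm (leOfHom f) (leOfHom g), Subsingleton.elim _ _⟩

/-- In a regular derivator, filtered colimits of cartesian squares are cartesian. -/
theorem IsCartesianAt.lan [IsDerivator D] (hr : D.IsRegular) {C : Shape Dia} (hC : IsFiltered C)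
    {M : D.obj (C.prod (.square Dia))} (hM : IsCartesianAt M) :
    IsCartesianAt ((D.lan (Shape.prodMap C.toPoint (𝟭 (Shape.square Dia)))).obj M) := by
  let u := Shape.prodMap C.toPoint (𝟭 (Shape.square Dia))
  let M' := (D.lan u).obj M
  let ζ : M ⟶ (D.map u).obj M' := (D.lanAdj u).unit.app M
  have hζ : IsLan u ζ := isLan_unit M
  have hd := isExact_prodCell' (D := D) C.toPoint (Shape.cospanIncl Dia) ζ hζ
  have hb := isExact_prodCell' (D := D) C.toPoint
    (Shape.incl (K := .square Dia) (UnitSquare.pt false false)) ζ hζ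
  refine (isCartesianAt_iff_isRan M').2 ?_
  refine isRan_of_isRegular hr hC Shape.isFinite_cospan ((isCartesianAt_iff_isRan M).1 hM) hb hd ?_
  have h1 := cospanCone_naturality ζ
  have h2 := cospanCone_map C.toPoint M'
  unfold bcL
  rw [reassoc_of% h1]
  refine (congr_arg (fun f => _ ≫ f) h2).trans ?_
  simp only [Functor.map_comp, Category.assoc]

end Prederivator

namespace Prederivator
variable {Dia : DiagramDomain.{w}} {D : Prederivator.{w, v, u} Dia} {J K : Shape Dia}

/-! ### Spectrification -/

/-- The variant of `isExact_of_poset_slice` for thin categories, needed because products of shapes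
with the point are thin without being presented as posets. -/
theorem isExact_of_thin_slice [IsDerivator D] {J' K' : Shape Dia} {u : J ⥤ K} {v : J' ⥤ J}
    {u' : J' ⥤ K'} {t : K' ⥤ K} (δ : v ⋙ u ⟶ u' ⋙ t) [Quiver.IsThin J] [Quiver.IsThin K]
    [Quiver.IsThin J'] [Quiver.IsThin K'] (g : K' → J → J')
    (hg : ∀ x ρ, (u.obj ρ ⟶ t.obj x) → Nonempty (u'.obj (g x ρ) ⟶ x))
    (hg' : ∀ x ρ c, (u.obj ρ ⟶ t.obj x) → (u'.obj c ⟶ x) →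
      (Nonempty (ρ ⟶ v.obj c) ↔ Nonempty (g x ρ ⟶ c))) :
    D.IsExact δ := by
  let T (x : K') : Shape.slice u' x ⥤ Shape.slice u (t.obj x) :=
    { obj c := CostructuredArrow.mk (Y := v.obj c.left) (δ.app c.left ≫ t.map c.hom)
      map f := CostructuredArrow.homMk (v.map f.left) (Subsingleton.elim _ _)
      map_id _ := CostructuredArrow.hom_ext _ _ (Subsingleton.elim _ _)
      map_comp _ _ := CostructuredArrow.hom_ext _ _ (Subsingleton.elim _ _) }
  have hsub (x : K') (a b : Shape.slice u' x) : Subsingleton (a ⟶ b) :=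
    ⟨fun f g => CostructuredArrow.hom_ext _ _ (Subsingleton.elim _ _)⟩
  have hsub' (x : K') (a b : Shape.slice u (t.obj x)) : Subsingleton (a ⟶ b) :=
    ⟨fun f g => CostructuredArrow.hom_ext _ _ (Subsingleton.elim _ _)⟩
  let R (x : K') : Shape.slice u (t.obj x) ⥤ Shape.slice u' x :=
    { obj ρ := CostructuredArrow.mk (Y := g x ρ.left) (hg x _ ρ.hom).some
      map {ρ ρ'} f := CostructuredArrow.homMk ((hg' x ρ.left _ ρ.hom
        (hg x ρ'.left ρ'.hom).some).1 ⟨f.left ≫ ((hg' x _ _ ρ'.hom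
        (hg x ρ'.left ρ'.hom).some).2 ⟨𝟙 _⟩).some⟩).some (Subsingleton.elim _ _)
      map_id _ := Subsingleton.elim _ _
      map_comp _ _ := Subsingleton.elim _ _ }
  have adj (x : K') : R x ⊣ T x := Adjunction.mkOfHomEquiv
    { homEquiv ρ c :=
        { toFun f := CostructuredArrow.homMk ((hg' x _ _ ρ.hom c.hom).2 ⟨f.left⟩).some
            (Subsingleton.elim _ _)
          invFun f := CostructuredArrow.homMk ((hg' x _ _ ρ.hom c.hom).1 ⟨f.left⟩).some
            (Subsingleton.elim _ _)
          left_inv f := Subsingleton.elim _ _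
          right_inv f := Subsingleton.elim _ _ }
      homEquiv_naturality_left_symm _ _ := Subsingleton.elim _ _
      homEquiv_naturality_right _ _ := Subsingleton.elim _ _ }
  exact isExact_of_comparison δ T (fun x => ⟨_, ⟨adj x⟩⟩)
    (fun x => CategoryTheory.Functor.ext (fun _ => rfl) fun _ _ _ => Subsingleton.elim _ _)
    fun x c => Subsingleton.elim _ _

theorem IsCartesianAt.map [IsDerivator D] {Y : D.obj (K.prod (.square Dia))} (h : IsCartesianAt Y)
    (u : J ⥤ K) : IsCartesianAt ((D.map (Shape.prodMap u (𝟭 (Shape.square Dia)))).obj Y) := by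
  have : IsIso _ := h
  exact (isCartesianAt_map_iff u Y).2 inferInstance

theorem isCartesianAt_of_incl [IsDerivator D] {Y : D.obj (K.prod (.square Dia))}
    (h : ∀ k : K, IsCartesianAt
      ((D.map (Shape.prodMap (Shape.incl k) (𝟭 (Shape.square Dia)))).obj Y)) : IsCartesianAt Y :=
  IsDerivator.der2 _ fun k => (isCartesianAt_map_iff (Shape.incl k) Y).1 (h k)

theorem IsLan.isZero [HasKan D] (hD : D.IsPointed) {u : J ⥤ K} {X : D.obj J} {Y : D.obj K}
    {c : X ⟶ (D.map u).obj Y} (h : IsLan u c) (hX : IsZero X) : IsZero Y :=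
  hD.isZero_of_unique_to fun Z => by
    obtain ⟨i⟩ := hX.unique_to ((D.map u).obj Z)
    exact ⟨(Equiv.ofBijective _ (h Z)).unique⟩

theorem IsLan.iso [HasKan D] {u : J ⥤ K} {X : D.obj J} {Y : D.obj K}
    {c : X ⟶ (D.map u).obj Y} (h : IsLan u c) : Nonempty ((D.lan u).obj X ≅ Y) := by
  obtain ⟨f, hf⟩ := (isLan_unit (u := u) X Y).surjective c
  dsimp only at hf
  have : IsIso f := (isLan_unit X).isIso (by rwa [hf])
  exact ⟨asIso f⟩

/-- The natural numbers as a shape. -/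
abbrev _root_.Shape.nat (Dia : DiagramDomain.{w}) : Shape Dia := .poset Dia (ULift.{w} ℕ)

instance : IsFiltered (Shape.nat Dia) :=
  inferInstanceAs (IsFiltered (ULift.{w} ℕ))

/-- The functor `(n, b) ↦ (n + m, f b)`. -/
noncomputable abbrev _root_.Shape.towerShift {B : Type w} [PartialOrder B] [Countable B]
    (f : Shape.poset Dia B ⥤ Shape.band Dia) (m : ℕ) :
    (Shape.nat Dia).prod (.poset Dia B) ⥤ (Shape.point Dia).prod (.tower Dia) :=
  Shape.prodLift (P := Tower.{w}) (Shape.fst _ _ ⋙ (Shape.nat Dia).toPoint)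
    (fun x => (⟨x.1.down + m⟩, f.obj x.2))
    fun g => ⟨Nat.add_le_add_right (leOfHom g.1 : _ ≤ _) m, leOfHom (f.map g.2)⟩

theorem isThin_prod {P Q : Shape Dia} (hP : Quiver.IsThin P) (hQ : Quiver.IsThin Q) :
    Quiver.IsThin (P.prod Q) :=
  fun _ _ => ⟨fun _ _ => Prod.ext ((hP _ _).elim _ _) ((hQ _ _).elim _ _)⟩

theorem isThin_point : Quiver.IsThin (Shape.point Dia) := fun _ _ => inferInstance

/-- The stages of the tower beyond any given one are cofinal. -/
theorem exists_isExact_towerShift [IsDerivator D] {B : Type w} [PartialOrder B] [Countable B]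
    (f : Shape.poset Dia B ⥤ Shape.band Dia) (m : ℕ) (k : K) (g : B → Band.{w} → B)
    (hg : ∀ b y, y ≤ f.obj b → g b y ≤ b)
    (hg' : ∀ b y b', y ≤ f.obj b → b' ≤ b → (y ≤ f.obj b' ↔ g b y ≤ b')) :
    ∃ δ : (Shape.towerShift f m ⋙ Shape.prodMap (Shape.incl k) (𝟭 (Shape.tower Dia))) ⋙
        Shape.prodMap (𝟭 K) (Shape.towerProj Dia) ⟶
      Shape.prodMap (Shape.nat Dia).toPoint (𝟭 (Shape.poset Dia B)) ⋙
        (Shape.prodMap (𝟭 (Shape.point Dia)) f ⋙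
          Shape.prodMap (Shape.incl k) (𝟭 (Shape.band Dia))), D.IsExact δ := by
  let δ' : Shape.towerShift f m ⋙ Shape.prodMap (𝟭 (Shape.point Dia)) (Shape.towerProj Dia) ⟶
    Shape.prodMap (Shape.nat Dia).toPoint (𝟭 (Shape.poset Dia B)) ⋙
      Shape.prodMap (𝟭 (Shape.point Dia)) f :=
    { app x := 𝟙 _
      naturality _ _ _ := Prod.ext (Subsingleton.elim _ _) (Subsingleton.elim _ _) }
  have t {B : Type w} [PartialOrder B] [Countable B] : Quiver.IsThin (Shape.poset Dia B) :=
    fun _ _ => inferInstance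
  have h1 : D.IsExact δ' := by
    have i1 := isThin_prod (isThin_point (Dia := Dia)) (t (B := Tower.{w}))
    have i2 := isThin_prod (isThin_point (Dia := Dia)) (t (B := Band.{w}))
    have i3 := isThin_prod (t (B := ULift.{w} ℕ)) (t (B := B))
    have i4 := isThin_prod (isThin_point (Dia := Dia)) (t (B := B))
    -- Truncated subtraction is left adjoint to `n ↦ n + m` on `ℕ`, and `g` provides the least
    -- element in the second factor.
    refine isExact_of_thin_slice δ'
      (fun x ρ => (⟨ρ.2.1.down - m⟩, g x.2 ρ.2.2)) (fun x ρ h => ?_) fun x ρ c h h' => ?_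
    · exact ⟨(𝟙 _, homOfLE (hg _ _ (leOfHom h.2)))⟩
    · have h3 := hg' x.2 ρ.2.2 c.2 (leOfHom h.2) (leOfHom h'.2)
      have h4 := Nat.sub_le_iff_le_add (a := ρ.2.1.down) (b := m) (c := c.1.down)
      refine ⟨fun ⟨a⟩ => ⟨(homOfLE ?_, homOfLE (h3.1 (leOfHom a.2).2))⟩,
        fun ⟨a⟩ => ⟨(eqToHom (Subsingleton.elim _ _), homOfLE ⟨?_, h3.2 (leOfHom a.2)⟩)⟩⟩
      · exact h4.2 (leOfHom a.2).1
      · exact h4.1 (leOfHom a.1 : (_ : ULift ℕ) ≤ _)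
  exact ⟨_, isExact_paste _ δ' _ rfl (isExact_prodCell (Shape.incl k) (Shape.towerProj Dia)) h1⟩

/-- At a boundary element `x` the value is the colimit over `n` of the values at `(n,x)`. These
elements are kept, so the localisation there agrees with `X`, which vanishes. -/
theorem isPrespectrum_spectrify [IsDerivator D] (hD : D.IsPointed)
    {X : D.obj (K.prod (.band Dia))} (hX : IsPrespectrum X) : IsPrespectrum (spectrify X) := by
  have := Shape.prodMap_full (𝟭 K) (Shape.keptIncl Dia)
  have := Shape.prodMap_faithful (𝟭 K) (Shape.keptIncl Dia)
  rw [isPrespectrum_iff hD] at hX ⊢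
  intro k x hx
  let f : Shape.poset Dia PUnit.{w + 1} ⥤ Shape.band Dia :=
    Monotone.functor (f := fun _ => x) fun _ _ _ => le_rfl
  obtain ⟨δ, hδ⟩ := exists_isExact_towerShift (D := D) f 0 k (fun b _ => b) (fun _ _ _ => le_rfl)
    fun b y b' h _ => ⟨fun _ => le_rfl, fun _ => h⟩
  have h1 := hδ _ (isLan_unit ((D.ran (Shape.prodMap (𝟭 K) (Shape.keptIncl Dia))).obj
      ((D.map (Shape.prodMap (𝟭 K) (Shape.keptIncl Dia))).obj
        ((D.map (Shape.prodMap (𝟭 K) (Shape.towerProj Dia))).obj X))))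
  have h2 := h1.isZero hD (isZero_of_incl hD fun ⟨n, b⟩ => ?_)
  · have h3 := isZero_map (Shape.incl (K := (Shape.point Dia).prod (.poset Dia PUnit.{w + 1}))
      (⟨⟨⟩⟩, PUnit.unit)) h2
    rw [← isZero_map_comp_iff] at h3
    exact (isZero_map_congr_iff (Discrete.natIso fun _ => Iso.refl _) _).1 h3
  · let y : {x : Tower.{w} // x.Kept} := ⟨(⟨n.down + 0⟩, x), Or.inl hx⟩
    rw [← isZero_map_comp_iff]
    have e : Shape.incl (n, b) ⋙ (Shape.towerShift f 0 ⋙ Shape.prodMap (Shape.incl k)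
      (𝟭 (Shape.tower Dia))) ≅ Shape.incl (K := K.prod (.kept Dia)) (k, y) ⋙
        Shape.prodMap (𝟭 K) (Shape.keptIncl Dia) := Discrete.natIso fun _ => Iso.refl _
    rw [isZero_map_congr_iff e, isZero_map_comp_iff]
    have h4 := (isRan_counit (u := Shape.prodMap (𝟭 K) (Shape.keptIncl Dia))
      ((D.map (Shape.prodMap (𝟭 K) (Shape.keptIncl Dia))).obj
        ((D.map (Shape.prodMap (𝟭 K) (Shape.towerProj Dia))).obj X))).isIso_of_fullyFaithful
    refine IsZero.of_iso ?_ ((D.map _).mapIso (@asIso _ _ _ _ _ h4))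
    dsimp only [Functor.id_obj]
    rw [← isZero_map_comp_iff, ← isZero_map_comp_iff]
    refine (isZero_map_congr_iff ?_ X).1 (hX k x hx)
    exact Discrete.natIso fun _ => Iso.refl _

/-- The square at `(i,i)` is a sequential colimit of squares at `(n,i,i)`, which are pullbacks as
soon as `n > i`. Filtered colimits of pullbacks are pullbacks by regularity. -/
theorem isOmegaSpectrum_spectrify [IsDerivator D] (hD : D.IsPointed) (hr : D.IsRegular)
    {X : D.obj (K.prod (.band Dia))} (hX : IsPrespectrum X) :
    IsOmegaSpectrum hD (spectrify X) := by
  have := Shape.prodMap_full (𝟭 K) (Shape.keptIncl Dia)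
  have := Shape.prodMap_faithful (𝟭 K) (Shape.keptIncl Dia)
  refine (isOmegaSpectrum_iff_diag hD _).2 ⟨isPrespectrum_spectrify hD hX, fun i => ?_⟩
  refine isCartesianAt_of_incl fun k => ?_
  -- The least vertex of the square at `(i,i)` whose image lies above `y`, provided there is one: a
  -- coordinate has to be raised exactly when that of `y` exceeds `i`.
  let g (_ : UnitSquare.{w}) (y : Band.{w}) : UnitSquare.{w} :=
    UnitSquare.pt (decide (i + 1 ≤ y.down.1.1)) (decide (i + 1 ≤ y.down.1.2))
  have hg : ∀ b y, y ≤ (Shape.diagSquare Dia i).obj b → g b y ≤ b := by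
    rintro ⟨⟨a, b⟩⟩ ⟨⟨⟨j, k⟩, hjk⟩⟩ h
    obtain ⟨h2, h3⟩ : j ≤ (bif a then i + 1 else i) ∧ k ≤ (bif b then i + 1 else i) := h
    change decide (i + 1 ≤ j) ≤ a ∧ decide (i + 1 ≤ k) ≤ b
    cases a <;> cases b <;> simp [Bool.le_iff_imp] at * <;> omega
  have hg' : ∀ b y b', y ≤ (Shape.diagSquare Dia i).obj b → b' ≤ b →
      (y ≤ (Shape.diagSquare Dia i).obj b' ↔ g b y ≤ b') := by
    rintro ⟨⟨a, b⟩⟩ ⟨⟨⟨j, k⟩, hjk⟩⟩ ⟨⟨c, d⟩⟩ h -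
    obtain ⟨h2, h3⟩ : j ≤ (bif a then i + 1 else i) ∧ k ≤ (bif b then i + 1 else i) := h
    have h2' : j ≤ i + 1 := by cases a <;> simp at h2 <;> omega
    have h3' : k ≤ i + 1 := by cases b <;> simp at h3 <;> omega
    change (j ≤ (bif c then i + 1 else i) ∧ k ≤ (bif d then i + 1 else i)) ↔
      decide (i + 1 ≤ j) ≤ c ∧ decide (i + 1 ≤ k) ≤ d
    cases c <;> cases d <;> simp [Bool.le_iff_imp] <;> omega
  -- The shift by `(i + 1).toNat` discards the early stages, so that every level occurring in the
  -- colimit is greater than `i`.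
  obtain ⟨δ, hδ⟩ := exists_isExact_towerShift (D := D) (Shape.diagSquare Dia i) (i + 1).toNat k g
    hg hg'
  have h1 := hδ _ (isLan_unit ((D.ran (Shape.prodMap (𝟭 K) (Shape.keptIncl Dia))).obj
    ((D.map (Shape.prodMap (𝟭 K) (Shape.keptIncl Dia))).obj
      ((D.map (Shape.prodMap (𝟭 K) (Shape.towerProj Dia))).obj X))))
  obtain ⟨e⟩ := h1.iso
  have h2 := (IsCartesianAt.lan hr inferInstance (isCartesianAt_of_incl fun n => ?_)).of_iso e
  · exact h2.of_iso (eqToIso (map_eq_map_map (D := D)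
      (u := Shape.prodMap (Shape.incl k) (𝟭 (Shape.square Dia)))
      (v := Shape.prodMap (𝟭 K) (Shape.diagSquare Dia i))
      (t := Shape.prodMap (𝟭 (Shape.point Dia))
      (Shape.diagSquare Dia i) ⋙ Shape.prodMap (Shape.incl k) (𝟭 (Shape.band Dia))) rfl
        (spectrify X)).symm)
  · have h3 := ((isIso_ran_unit_kept_iff _).1 (isIso_ran_unit_ran
      (Shape.prodMap (𝟭 K) (Shape.keptIncl Dia)) ((D.map (Shape.prodMap (𝟭 K)
        (Shape.keptIncl Dia))).obj ((D.map (Shape.prodMap (𝟭 K) (Shape.towerProj Dia))).obj X)))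
        (n.down + (i + 1).toNat) i (by omega)).map (Shape.incl k)
    refine h3.of_iso (eqToIso ?_)
    refine map_map_eq ?_ _
    exact CategoryTheory.Functor.ext (fun _ => rfl) fun _ _ f =>
      Prod.ext ((Category.id_comp _).trans (Category.comp_id _)).symm (Subsingleton.elim _ _)

/-! ### The derivator of spectra -/

variable [IsDerivator D]

theorem isOmegaSpectrum_of_incl {hD : D.IsPointed} {X : D.obj (K.prod (.band Dia))}
    (h : ∀ k : K, IsOmegaSpectrum hD
      ((D.map (Shape.prodMap (Shape.incl k) (𝟭 (Shape.band Dia)))).obj X)) :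
    IsOmegaSpectrum hD X := by
  simp only [isOmegaSpectrum_iff] at h
  refine (isOmegaSpectrum_iff hD X).2 ⟨(isPrespectrum_iff hD X).2 fun k x hx => ?_, ?_⟩
  · have h1 := (h k).1.isZero_map (Shape.incl (K := (Shape.point Dia).prod (.band Dia)) (⟨⟨⟩⟩, x))
      fun _ => (Band.abs_eq_one_iff x).2 hx
    rw [← isZero_map_comp_iff] at h1
    exact (isZero_map_congr_iff (Discrete.natIso fun _ => Iso.refl _) X).1 h1
  · refine isCartesianAt_of_incl (D := D.shift (.band Dia)) fun k => ?_
    refine (h k).2.of_iso (D := D.shift (.band Dia)) (eqToIso ?_)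
    exact map_map_eq (D := D) (u := (Shape.point Dia).bandSquare)
      (v := Shape.prodMap (Shape.incl k) (𝟭 (Shape.band Dia)))
      (u' := Shape.prodMap (Shape.prodMap (Shape.incl k) (𝟭 (Shape.square Dia)))
        (𝟭 (Shape.band Dia))) (v' := K.bandSquare) rfl X

theorem IsOmegaSpectrum.of_iso {hD : D.IsPointed} {X Y : D.obj (K.prod (.band Dia))}
    (h : IsOmegaSpectrum hD X) (e : X ≅ Y) : IsOmegaSpectrum hD Y := by
  rw [isOmegaSpectrum_iff] at h ⊢
  exact ⟨h.1.of_iso ((D.map _).mapIso e.symm),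
    h.2.of_iso (D := D.shift (.band Dia)) ((D.map K.bandSquare).mapIso e)⟩

/-- The left Kan extension of spectra is the spectrification of `u_! X`, which is a prespectrum
because `u_!` preserves vanishing on the boundary. -/
theorem isDerivator_St (hD : D.IsPointed) (hr : D.IsRegular) : (D.St hD).IsDerivator := by
  refine isDerivator_full (E := D.shift (.band Dia)) (hiso := fun K => ⟨fun e h => h.of_iso e⟩)
    (fun X h => isOmegaSpectrum_of_incl h) (fun u X hX => hX.ran u) fun {J K} u X hX => ?_
  obtain ⟨e, he⟩ := exists_hom_spectrify hD
    ((D.lan (Shape.prodMap u (𝟭 (Shape.band Dia)))).obj X)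
  exact ⟨_, e, isOmegaSpectrum_spectrify hD hr (hX.1.lan hD u), he⟩

theorem isPointed_St (hD : D.IsPointed) : (D.St hD).IsPointed := by
  obtain ⟨Z, hZ⟩ := hD.exists_isZero ((Shape.point Dia).prod (.band Dia))
  exact ⟨⟨Z, isOmegaSpectrum_of_isZero hD hZ⟩, St.isZero_of_isZero hZ⟩

end Prederivator

namespace Prederivator
variable {Dia : DiagramDomain.{w}}

/-! ### Adjunctions of morphisms from universal arrows -/

section adjunction
variable {D E : Prederivator.{w, v, u} Dia} {Φ : Morphism D E} {Ψ : Morphism E D}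

theorem Morphism.comp_γ_hom_app {F : Prederivator.{w, v, u} Dia} (Φ : Morphism D E)
    (Ψ : Morphism E F) {J K : Shape Dia} (u : J ⥤ K) (X : D.obj K) :
    ((Φ.comp Ψ).γ u).hom.app X =
      (Ψ.app J).map ((Φ.γ u).hom.app X) ≫ (Ψ.γ u).hom.app ((Φ.app K).obj X) := by
  simp [Morphism.comp]

/-- A universal unit extends to an adjunction. -/
theorem exists_morphismAdjunction
    (η : ∀ (K : Shape Dia) (X : D.obj K), X ⟶ (Ψ.app K).obj ((Φ.app K).obj X))
    (hη : ∀ {K : Shape Dia} {X Y : D.obj K} (f : X ⟶ Y),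
      f ≫ η K Y = η K X ≫ (Ψ.app K).map ((Φ.app K).map f))
    (hη' : ∀ {J K : Shape Dia} (u : J ⥤ K) (X : D.obj K),
      η J ((D.map u).obj X) ≫ (Ψ.app J).map ((Φ.γ u).hom.app X) ≫
        (Ψ.γ u).hom.app ((Φ.app K).obj X) = (D.map u).map (η K X))
    (h : ∀ (K : Shape Dia) (X : D.obj K) (Z : E.obj K),
      Function.Bijective fun f : (Φ.app K).obj X ⟶ Z => η K X ≫ (Ψ.app K).map f) :
    Nonempty (MorphismAdjunction Φ Ψ) := by
  -- The counit is the preimage of the identity under the universal property. Its naturality and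
  -- compatibility with restriction hold after composition with the unit, hence hold.
  choose c hc using fun (K : Shape Dia) (Z : E.obj K) =>
    (h K ((Ψ.app K).obj Z) Z).surjective (𝟙 _)
  dsimp only at hc
  have hinj {K : Shape Dia} {X : D.obj K} {Z : E.obj K} {f g : (Φ.app K).obj X ⟶ Z}
      (hfg : η K X ≫ (Ψ.app K).map f = η K X ≫ (Ψ.app K).map g) : f = g :=
    (h K X Z).injective hfg
  have hnat {K : Shape Dia} {X Y : E.obj K} (f : X ⟶ Y) :
      (Φ.app K).map ((Ψ.app K).map f) ≫ c K Y = c K X ≫ f := by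
    apply hinj
    rw [Functor.map_comp, Functor.map_comp, ← reassoc_of% hη, hc, reassoc_of% hc, Category.comp_id]
  have hmod {J K : Shape Dia} (u : J ⥤ K) (Z : E.obj K) :
      c J ((E.map u).obj Z) = (Φ.app J).map ((Ψ.γ u).hom.app Z) ≫
        (Φ.γ u).hom.app ((Ψ.app K).obj Z) ≫ (E.map u).map (c K Z) := by
    apply hinj
    have h1 := hη' u ((Ψ.app K).obj Z)
    have h2 := (Ψ.γ u).hom.naturality (c K Z)
    dsimp only [Functor.comp_map] at h2
    have h3 : (Ψ.app J).map ((E.map u).map (c K Z)) =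
        (Ψ.γ u).hom.app _ ≫ (D.map u).map ((Ψ.app K).map (c K Z)) ≫ (Ψ.γ u).inv.app Z := by
      rw [← reassoc_of% h2, Iso.hom_inv_id_app]
      exact (Category.comp_id _).symm
    rw [hc, Functor.map_comp, Functor.map_comp, h3, ← reassoc_of% hη]
    dsimp only [Functor.comp_obj] at h1 ⊢
    rw [reassoc_of% h1, ← Functor.map_comp_assoc, hc, CategoryTheory.Functor.map_id, Category.id_comp,
      Iso.hom_inv_id_app]
    rfl
  refine ⟨{ unit :=
              { app := fun K => { app := η K, naturality := fun _ _ f => hη f }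
                naturality := fun {J K} u X => ?_ }
            counit :=
              { app := fun K => { app := c K, naturality := fun _ _ f => hnat f }
                naturality := fun {J K} u Z => ?_ }
            left_triangle := fun K X => ?_
            right_triangle := hc }⟩
  · rw [Morphism.comp_γ_hom_app]
    exact (hη' u X).trans (Category.id_comp _).symm
  · rw [Morphism.comp_γ_hom_app]
    exact (Category.comp_id _).trans ((hmod u Z).trans (Category.assoc _ _ _).symm)
  · change (Φ.app K).map (η K X) ≫ c K ((Φ.app K).obj X) = _
    apply hinj
    rw [Functor.map_comp, ← reassoc_of% hη, hc, CategoryTheory.Functor.map_id]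

end adjunction

/-! ### The comparison with the loop functor -/

section loop
variable {D : Prederivator.{w, v, u} Dia} {J K : Shape Dia}

theorem cornerCell_eq (K : Shape Dia) :
    K.fst (.point Dia) ⋙ K.sect (A := .square Dia) (UnitSquare.pt true true) =
      Shape.prodMap (𝟭 K) (Shape.cospanPt Dia) ⋙ Shape.prodMap (𝟭 K) (Shape.cospanIncl Dia) :=
  CategoryTheory.Functor.ext (fun _ => rfl) fun _ _ _ =>
    Prod.ext ((Category.id_comp _).trans (Category.comp_id _)).symm (Subsingleton.elim _ _)

theorem sqL_cornerCell (Y : D.obj (K.prod (.square Dia)))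
    (h : (D.map (K.fst (.point Dia))).obj (vertex Y true true) =
      (D.map (Shape.prodMap (𝟭 K) (Shape.cospanPt Dia))).obj
        ((D.map (Shape.prodMap (𝟭 K) (Shape.cospanIncl Dia))).obj Y)) :
    (D.sqL (cornerCell K).hom).app Y = eqToHom h := by
  refine sqL_app_of_eq_id _ (cornerCell_eq K) (NatTrans.ext (funext fun x => ?_)) Y
  rw [eqToHom_app]
  exact (eqToHom_refl _ _).symm

/-- Strictness of the 2-functor identifies the two composite restrictions; this is the naturality of
that identification, used to move arrows between equal but not definitionally equal functors. -/
theorem map_map_naturality {I J J' K : Shape Dia} {u : I ⥤ J} {v : J ⥤ K} {u' : I ⥤ J'} {v' : J' ⥤ K}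
    (h : u ⋙ v = u' ⋙ v') {X Y : D.obj K} (f : X ⟶ Y) :
    (D.map u).map ((D.map v).map f) ≫ eqToHom (map_map_eq h Y) =
      eqToHom (map_map_eq h X) ≫ (D.map u').map ((D.map v').map f) := by
  have h1 := (D.sqL (eqToHom h)).naturality f
  rwa [sqL_app_of_eq_id _ h rfl, sqL_app_of_eq_id _ h rfl] at h1

theorem const_γ_hom_app (P : Shape Dia) (u : J ⥤ K) (X : D.obj K) :
    ((D.const P).γ u).hom.app X = eqToHom (map_map_eq (D := D) (u := J.fst P) (v := u)
      (u' := Shape.prodMap u (𝟭 P)) (v' := K.fst P) rfl X) := by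
  have h : D.map u ⋙ D.map (J.fst P) = D.map (K.fst P) ⋙ D.map (Shape.prodMap u (𝟭 P)) :=
    (D.map_comp (J.fst P) u).symm.trans (D.map_comp (Shape.prodMap u (𝟭 P)) (K.fst P))
  exact eqToHom_app h _

theorem eval_γ_hom_app {P : Shape Dia} (p : P) (u : J ⥤ K) (X : D.obj (K.prod P)) :
    ((D.eval p).γ u).hom.app X = eqToHom (map_map_eq (D := D) (u := J.sect p)
      (v := Shape.prodMap u (𝟭 P)) (u' := u) (v' := K.sect p) rfl X) := by
  have h : D.map (Shape.prodMap u (𝟭 P)) ⋙ D.map (J.sect p) = D.map (K.sect p) ⋙ D.map u :=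
    (D.map_comp (J.sect p) (Shape.prodMap u (𝟭 P))).symm.trans (D.map_comp u (K.sect p))
  exact eqToHom_app h _

variable [IsDerivator D]

theorem unit_cospanComparison (Y : D.obj (K.prod (.square Dia))) :
    (D.lanAdj (Shape.prodMap (𝟭 K) (Shape.cospanPt Dia))).unit.app _ ≫
      (D.map (Shape.prodMap (𝟭 K) (Shape.cospanPt Dia))).map (cospanComparison Y) =
        (D.sqL (cornerCell K).hom).app Y := by
  have h := ((D.lanAdj (Shape.prodMap (𝟭 K) (Shape.cospanPt Dia))).homEquiv _ _).apply_symm_apply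
    ((D.sqL (cornerCell K).hom).app Y)
  rwa [Adjunction.homEquiv_unit] at h

theorem cospanComparison_naturality {Y Y' : D.obj (K.prod (.square Dia))} (f : Y ⟶ Y') :
    cospanComparison Y ≫ (D.map (Shape.prodMap (𝟭 K) (Shape.cospanIncl Dia))).map f =
      (D.lan (Shape.prodMap (𝟭 K) (Shape.cospanPt Dia))).map ((D.map (K.fst (.point Dia))).map
        ((D.map (K.sect (UnitSquare.pt true true))).map f)) ≫ cospanComparison Y' := by
  apply lan_hom_ext
  have h := (D.lanAdj (Shape.prodMap (𝟭 K) (Shape.cospanPt Dia))).unit.naturality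
    ((D.map (K.fst (.point Dia))).map ((D.map (K.sect (UnitSquare.pt true true))).map f))
  have h1 := (D.sqL (cornerCell K).hom).naturality f
  dsimp only [Functor.comp_map, Functor.id_map] at h h1
  rw [Functor.map_comp, Functor.map_comp, ← Category.assoc, unit_cospanComparison]
  erw [← reassoc_of% h]
  rw [unit_cospanComparison, h1]

/-- Restriction along `u` carries the comparison with the extension by zero to the comparison for
the restricted square. It suffices to check this after the unit at `(1,1)`, where all arrows are
identifications. -/
theorem cospanComparison_map (u : J ⥤ K) (Y : D.obj (K.prod (.square Dia)))
    (e : (D.map (J.fst (.point Dia))).obj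
      (vertex ((D.map (Shape.prodMap u (𝟭 (Shape.square Dia)))).obj Y) true true) =
        (D.map (Shape.prodMap u (𝟭 (Shape.point Dia)))).obj
          ((D.map (K.fst (.point Dia))).obj (vertex Y true true)))
    (e' : (D.map (Shape.prodMap (𝟭 J) (Shape.cospanIncl Dia))).obj
        ((D.map (Shape.prodMap u (𝟭 (Shape.square Dia)))).obj Y) =
      (D.map (Shape.prodMap u (𝟭 (Shape.cospan Dia)))).obj
        ((D.map (Shape.prodMap (𝟭 K) (Shape.cospanIncl Dia))).obj Y)) :
    (D.lan (Shape.prodMap (𝟭 J) (Shape.cospanPt Dia))).map (eqToHom e) ≫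
      (D.lmate (prodCell u (Shape.cospanPt Dia))).app _ ≫
        (D.map (Shape.prodMap u (𝟭 (Shape.cospan Dia)))).map (cospanComparison Y) =
      cospanComparison ((D.map (Shape.prodMap u (𝟭 (Shape.square Dia)))).obj Y) ≫ eqToHom e' := by
  apply lan_hom_ext
  have h := (D.lanAdj (Shape.prodMap (𝟭 J) (Shape.cospanPt Dia))).unit.naturality (eqToHom e)
  have h1 := D.lmate_unit (prodCell u (Shape.cospanPt Dia))
    ((D.map (K.fst (.point Dia))).obj (vertex Y true true))
  have h2 := (D.sqL (prodCell u (Shape.cospanPt Dia))).naturality (cospanComparison Y)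
  have h3 := congr_arg (D.map (Shape.prodMap u (𝟭 (Shape.point Dia)))).map
    (unit_cospanComparison Y)
  have h4 := unit_cospanComparison ((D.map (Shape.prodMap u (𝟭 (Shape.square Dia)))).obj Y)
  have h5 := sqL_app_of_eq_id (D := D) (prodCell u (Shape.cospanPt Dia)) rfl rfl
    ((D.map (Shape.prodMap (𝟭 K) (Shape.cospanIncl Dia))).obj Y)
  rw [sqL_cornerCell _ (map_map_eq (cornerCell_eq _) _)] at h3 h4
  dsimp only [Functor.comp_map, Functor.id_map, Functor.comp_obj, Functor.id_obj] at h h1 h2 h3 h4 h5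
  rw [Functor.map_comp] at h3
  simp only [Functor.map_comp]
  rw [← reassoc_of% h]
  erw [reassoc_of% h1, ← h2, reassoc_of% h3, h5, reassoc_of% h4]
  simp only [eqToHom_map, eqToHom_trans]

/-- The canonical morphism from a square with zero corners to the cartesian square. -/
noncomputable def loopLift (hD : D.IsPointed) (Y : D.obj (K.prod (.square Dia)))
    (hY : HasZeroCorners Y) : Y ⟶ (D.ran (Shape.prodMap (𝟭 K) (Shape.cospanIncl Dia))).obj
      ((D.lan (Shape.prodMap (𝟭 K) (Shape.cospanPt Dia))).obj
        ((D.map (K.fst (.point Dia))).obj (vertex Y true true))) :=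
  have := isIso_cospanComparison hD Y hY
  (D.ranAdj (Shape.prodMap (𝟭 K) (Shape.cospanIncl Dia))).unit.app Y ≫
    (D.ran (Shape.prodMap (𝟭 K) (Shape.cospanIncl Dia))).map (inv (cospanComparison Y))

theorem loopLift_naturality (hD : D.IsPointed) {Y Y' : D.obj (K.prod (.square Dia))}
    (hY : HasZeroCorners Y) (hY' : HasZeroCorners Y') (f : Y ⟶ Y') :
    f ≫ loopLift hD Y' hY' = loopLift hD Y hY ≫
      (D.ran (Shape.prodMap (𝟭 K) (Shape.cospanIncl Dia))).map
        ((D.lan (Shape.prodMap (𝟭 K) (Shape.cospanPt Dia))).map ((D.map (K.fst (.point Dia))).map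
          ((D.map (K.sect (UnitSquare.pt true true))).map f))) := by
  have := isIso_cospanComparison hD Y hY
  have := isIso_cospanComparison hD Y' hY'
  have h := (D.ranAdj (Shape.prodMap (𝟭 K) (Shape.cospanIncl Dia))).unit.naturality f
  dsimp only [Functor.comp_map, Functor.id_map, Functor.comp_obj, Functor.id_obj] at h
  have h1 := cospanComparison_naturality f
  rw [← IsIso.eq_inv_comp, ← Category.assoc, ← IsIso.comp_inv_eq] at h1
  unfold loopLift
  dsimp only [Functor.comp_obj, Functor.id_obj]
  rw [reassoc_of% h, ← Functor.map_comp, Category.assoc, ← Functor.map_comp, h1]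

/-- The structure isomorphism of the loop square enters only as an arrow `γ` with property `hγ`:
composing it with the right mate gives the known left-hand part. As this mate is invertible, the
identity can be checked after it. -/
theorem loopLift_map (hD : D.IsPointed) (u : J ⥤ K) (Y : D.obj (K.prod (.square Dia)))
    (hY : HasZeroCorners Y)
    (hY' : HasZeroCorners ((D.map (Shape.prodMap u (𝟭 (Shape.square Dia)))).obj Y))
    (e : vertex ((D.map (Shape.prodMap u (𝟭 (Shape.square Dia)))).obj Y) true true =
      (D.map u).obj (vertex Y true true))
    (e₁ : (D.map (J.fst (.point Dia))).obj ((D.map u).obj (vertex Y true true)) =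
      (D.map (Shape.prodMap u (𝟭 (Shape.point Dia)))).obj
        ((D.map (K.fst (.point Dia))).obj (vertex Y true true)))
    (γ : (D.ran (Shape.prodMap (𝟭 J) (Shape.cospanIncl Dia))).obj
      ((D.lan (Shape.prodMap (𝟭 J) (Shape.cospanPt Dia))).obj
        ((D.map (J.fst (.point Dia))).obj ((D.map u).obj (vertex Y true true)))) ⟶
      (D.map (Shape.prodMap u (𝟭 (Shape.square Dia)))).obj
        ((D.ran (Shape.prodMap (𝟭 K) (Shape.cospanIncl Dia))).obj
          ((D.lan (Shape.prodMap (𝟭 K) (Shape.cospanPt Dia))).obj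
            ((D.map (K.fst (.point Dia))).obj (vertex Y true true)))))
    (hγ : γ ≫ (D.rmate (prodCell' u (Shape.cospanIncl Dia))).app _ =
      (D.ran (Shape.prodMap (𝟭 J) (Shape.cospanIncl Dia))).map
        ((D.lan (Shape.prodMap (𝟭 J) (Shape.cospanPt Dia))).map (eqToHom e₁) ≫
          (D.lmate (prodCell u (Shape.cospanPt Dia))).app _)) :
    loopLift hD _ hY' ≫ (D.ran (Shape.prodMap (𝟭 J) (Shape.cospanIncl Dia))).map
        ((D.lan (Shape.prodMap (𝟭 J) (Shape.cospanPt Dia))).map ((D.map (J.fst (.point Dia))).map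
          (eqToHom e))) ≫ γ =
      (D.map (Shape.prodMap u (𝟭 (Shape.square Dia)))).map (loopLift hD Y hY) := by
  have i1 := isIso_cospanComparison hD Y hY
  have i2 := isIso_cospanComparison hD _ hY'
  have e₂ : (D.map (Shape.prodMap (𝟭 J) (Shape.cospanIncl Dia))).obj
        ((D.map (Shape.prodMap u (𝟭 (Shape.square Dia)))).obj Y) =
      (D.map (Shape.prodMap u (𝟭 (Shape.cospan Dia)))).obj
        ((D.map (Shape.prodMap (𝟭 K) (Shape.cospanIncl Dia))).obj Y) :=
    map_map_eq (u := Shape.prodMap (𝟭 J) (Shape.cospanIncl Dia))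
      (v := Shape.prodMap u (𝟭 (Shape.square Dia))) (u' := Shape.prodMap u (𝟭 (Shape.cospan Dia)))
      (v' := Shape.prodMap (𝟭 K) (Shape.cospanIncl Dia)) rfl _
  have h2 := cospanComparison_map u Y ((congr_arg _ e).trans e₁) e₂
  have h3 := unit_rmate (prodCell' u (Shape.cospanIncl Dia)) Y
  have h4 := (D.rmate (prodCell' u (Shape.cospanIncl Dia))).naturality (inv (cospanComparison Y))
  have h5 := sqR_app_of_eq_id (D := D) (prodCell' u (Shape.cospanIncl Dia)) rfl rfl Y
  have i3 := isIso_rmate_prodCell' (D := D) (Shape.cospanIncl Dia) u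
  dsimp only [Functor.comp_map, Functor.id_map, Functor.comp_obj, Functor.id_obj] at h4 h2 h3 hγ
  have h6 : inv (cospanComparison ((D.map (Shape.prodMap u (𝟭 (Shape.square Dia)))).obj Y)) ≫
      (D.lan (Shape.prodMap (𝟭 J) (Shape.cospanPt Dia))).map
        ((D.map (J.fst (.point Dia))).map (eqToHom e) ≫ eqToHom e₁) ≫
      (D.lmate (prodCell u (Shape.cospanPt Dia))).app _ = eqToHom e₂ ≫
        (D.map (Shape.prodMap u (𝟭 (Shape.cospan Dia)))).map (inv (cospanComparison Y)) := by
    rw [IsIso.inv_comp_eq, eqToHom_map, eqToHom_trans, ← reassoc_of% h2, ← Functor.map_comp,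
      IsIso.hom_inv_id, CategoryTheory.Functor.map_id]
    exact (congr_arg _ (Category.comp_id _).symm)
  rw [← cancel_mono ((D.rmate (prodCell' u (Shape.cospanIncl Dia))).app _)]
  unfold loopLift
  simp only [Category.assoc, Functor.map_comp]
  dsimp only [Functor.comp_map, Functor.id_map, Functor.comp_obj, Functor.id_obj]
  rw [hγ, h4, reassoc_of% h3]
  rw [← Functor.map_comp, ← Functor.map_comp, ← Functor.map_comp]
  refine congr_arg (fun x => _ ≫ (D.ran (Shape.prodMap (𝟭 J) (Shape.cospanIncl Dia))).map x) ?_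
  rw [h5, ← h6, Functor.map_comp, Category.assoc]

theorem loopComparison_naturality (hD : D.IsPointed) {Y Y' : D.obj (K.prod (.square Dia))}
    (hY : HasZeroCorners Y) (hY' : HasZeroCorners Y') (f : Y ⟶ Y') :
    (D.map (K.sect (UnitSquare.pt false false))).map f ≫ loopComparison hD Y' hY' =
      loopComparison hD Y hY ≫ (D.loop.app K).map
        ((D.map (K.sect (UnitSquare.pt true true))).map f) := by
  have h := congr_arg (D.map (K.sect (UnitSquare.pt false false))).map
    (loopLift_naturality hD hY hY' f)
  rw [Functor.map_comp, Functor.map_comp] at h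
  exact h

/-- The comparison with loops is compatible with change of `K`. This makes both the unit of `Σ ⊣ Ω`
and the map `φ` into modifications. -/
theorem loopComparison_map (hD : D.IsPointed) (u : J ⥤ K) (Y : D.obj (K.prod (.square Dia)))
    (hY : HasZeroCorners Y)
    (hY' : HasZeroCorners ((D.map (Shape.prodMap u (𝟭 (Shape.square Dia)))).obj Y))
    (e : vertex ((D.map (Shape.prodMap u (𝟭 (Shape.square Dia)))).obj Y) true true =
      (D.map u).obj (vertex Y true true))
    (e' : vertex ((D.map (Shape.prodMap u (𝟭 (Shape.square Dia)))).obj Y) false false =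
      (D.map u).obj (vertex Y false false)) :
    loopComparison hD _ hY' ≫ (D.loop.app J).map (eqToHom e) ≫
      (D.loop.γ u).hom.app (vertex Y true true) =
        eqToHom e' ≫ (D.map u).map (loopComparison hD Y hY) := by
  have e₁ : (D.map (J.fst (.point Dia))).obj ((D.map u).obj (vertex Y true true)) =
      (D.map (Shape.prodMap u (𝟭 (Shape.point Dia)))).obj
        ((D.map (K.fst (.point Dia))).obj (vertex Y true true)) :=
    map_map_eq (u := J.fst (.point Dia)) (v := u) (u' := Shape.prodMap u (𝟭 (Shape.point Dia)))
      (v' := K.fst (.point Dia)) rfl _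
  let G := (((D.const (.point Dia)).comp (D.lanMor (Shape.cospanPt Dia))).comp
    (D.ranMor (Shape.cospanIncl Dia)))
  -- The structure isomorphism of the first three factors of `loop` is given its explicit source and
  -- target; the evaluation at `(0,0)` contributes only an identification.
  obtain ⟨γ, hγ⟩ : ∃ γ : (D.ran (Shape.prodMap (𝟭 J) (Shape.cospanIncl Dia))).obj
      ((D.lan (Shape.prodMap (𝟭 J) (Shape.cospanPt Dia))).obj
        ((D.map (J.fst (.point Dia))).obj ((D.map u).obj (vertex Y true true)))) ⟶
      (D.map (Shape.prodMap u (𝟭 (Shape.square Dia)))).obj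
        ((D.ran (Shape.prodMap (𝟭 K) (Shape.cospanIncl Dia))).obj
          ((D.lan (Shape.prodMap (𝟭 K) (Shape.cospanPt Dia))).obj
            ((D.map (K.fst (.point Dia))).obj (vertex Y true true)))),
      γ = (G.γ u).hom.app (vertex Y true true) := ⟨_, rfl⟩
  have hγ' : γ ≫ (D.rmate (prodCell' u (Shape.cospanIncl Dia))).app _ =
      (D.ran (Shape.prodMap (𝟭 J) (Shape.cospanIncl Dia))).map
        ((D.lan (Shape.prodMap (𝟭 J) (Shape.cospanPt Dia))).map (eqToHom e₁) ≫
          (D.lmate (prodCell u (Shape.cospanPt Dia))).app _) := by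
    subst hγ
    have h2 : (((D.const (.point Dia)).comp (D.lanMor (Shape.cospanPt Dia))).γ u).hom.app
        (vertex Y true true) = (D.lan (Shape.prodMap (𝟭 J) (Shape.cospanPt Dia))).map (eqToHom e₁) ≫
          (D.lmate (prodCell u (Shape.cospanPt Dia))).app _ := by
      refine (Morphism.comp_γ_hom_app _ _ u _).trans ?_
      refine congr_arg (fun x => (D.lan (Shape.prodMap (𝟭 J) (Shape.cospanPt Dia))).map x ≫ _) ?_
      exact const_γ_hom_app _ _ _
    have h3 := Morphism.comp_γ_hom_app ((D.const (.point Dia)).comp (D.lanMor (Shape.cospanPt Dia)))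
      (D.ranMor (Shape.cospanIncl Dia)) u (vertex Y true true)
    rw [h2] at h3
    refine (congr_arg (fun x => x ≫ (D.rmate (prodCell' u (Shape.cospanIncl Dia))).app _) h3).trans ?_
    refine (Category.assoc _ _ _).trans ?_
    have i3 := isIso_rmate_prodCell' (D := D) (Shape.cospanIncl Dia) u
    refine (congr_arg (fun x => _ ≫ x) ((asIso (D.rmate (prodCell' u (Shape.cospanIncl Dia)))).inv_hom_id_app _)).trans ?_
    exact Category.comp_id _
  have h1 := loopLift_map hD u Y hY hY' e e₁ γ hγ'
  have h2 := congr_arg (D.map (J.sect (UnitSquare.pt false false))).map h1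
  have h3 : (D.loop.γ u).hom.app (vertex Y true true) =
      (D.map (J.sect (UnitSquare.pt false false))).map γ ≫ eqToHom (map_map_eq (D := D)
        (u := J.sect (UnitSquare.pt false false)) (v := Shape.prodMap u (𝟭 (Shape.square Dia)))
        (u' := u) (v' := K.sect (UnitSquare.pt false false)) rfl _) := by
    subst hγ
    exact (Morphism.comp_γ_hom_app G (D.eval (UnitSquare.pt false false)) u
      (vertex Y true true)).trans (congr_arg (fun x => _ ≫ x)
        (eval_γ_hom_app (UnitSquare.pt false false) u ((G.app K).obj (vertex Y true true))))
  have h4 := map_map_naturality (D := D) (u := J.sect (UnitSquare.pt false false))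
    (v := Shape.prodMap u (𝟭 (Shape.square Dia))) (u' := u)
    (v' := K.sect (UnitSquare.pt false false)) rfl (loopLift hD Y hY)
  rw [← h2, Functor.map_comp, Functor.map_comp, Category.assoc, Category.assoc] at h4
  refine Eq.trans ?_ h4
  exact congr_arg (fun x => loopComparison hD _ hY' ≫ (D.loop.app J).map (eqToHom e) ≫ x) h3

end loop

end Prederivator

/-! ### Universal properties of the loop square and of the suspension square. -/

namespace Prederivator
variable {Dia : DiagramDomain.{w}} {D : Prederivator.{w, v, u} Dia} {J K : Shape Dia}

theorem eqToHom_rotate {C : Type*} [Category C] {A A' B B' Z : C} {f : A ⟶ B} {g : A' ⟶ B'}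
    {p : B = B'} {q : A = A'} (h : f ≫ eqToHom p = eqToHom q ≫ g) (r : B' = Z) (s : A' = A)
    (t : B = Z) : g ≫ eqToHom r = eqToHom s ≫ f ≫ eqToHom t := by
  subst p q r
  simpa using h.symm

theorem eqToHom_functor_naturality {C C' : Type*} [Category C] [Category C'] {F G : C ⥤ C'}
    (h : F = G) {X Y : C} (f : X ⟶ Y) : F.map f ≫ eqToHom (Functor.congr_obj h Y) =
      eqToHom (Functor.congr_obj h X) ≫ G.map f := by
  subst h
  simp

theorem _root_.Shape.isEquivalence_fst_point (K : Shape Dia) :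
    (K.fst (.point Dia)).IsEquivalence where
  faithful := ⟨fun h => Prod.ext h (Subsingleton.elim _ _)⟩
  full := ⟨fun f => ⟨(f, eqToHom (Subsingleton.elim _ _)), rfl⟩⟩
  essSurj := ⟨fun k => ⟨(k, ⟨PUnit.unit⟩), ⟨Iso.refl k⟩⟩⟩

theorem _root_.Shape.isEquivalence_sect_point (K : Shape Dia) (x : Shape.point Dia) :
    (K.sect x).IsEquivalence where
  faithful := ⟨fun h => congr_arg Prod.fst h⟩
  full := ⟨fun f => ⟨f.1, Prod.ext rfl (Subsingleton.elim _ _)⟩⟩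
  essSurj := ⟨fun k => ⟨k.1, ⟨eqToIso (Prod.ext rfl (Subsingleton.elim _ _))⟩⟩⟩

instance _root_.Shape.full_incl {P : Type w} [PartialOrder P] [Countable P] (p : P) :
    (Shape.incl (K := .poset Dia P) p).Full :=
  ⟨fun _ => ⟨eqToHom (Subsingleton.elim _ _), Subsingleton.elim _ _⟩⟩

instance _root_.Shape.faithful_incl {P : Type w} [PartialOrder P] [Countable P] (p : P) :
    (Shape.incl (K := .poset Dia P) p).Faithful :=
  ⟨fun _ => Subsingleton.elim _ _⟩

theorem bijective_map_of_isEquivalence (u : J ⥤ K) (hu : u.IsEquivalence) (X Y : D.obj K) :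
    Function.Bijective fun f : X ⟶ Y => (D.map u).map f :=
  have := isEquivalence_map_of_isEquivalence (D := D) u hu
  ⟨(D.map u).map_injective, (D.map u).map_surjective⟩

theorem map_fst_sect (X : D.obj K) (x : Shape.point Dia) :
    (D.map (K.sect x)).obj ((D.map (K.fst (.point Dia))).obj X) = X :=
  (Functor.congr_obj (D.map_comp (K.sect x) (K.fst (.point Dia))) X).symm.trans
    (Functor.congr_obj (D.map_id K) X)

theorem map_sect_spanPt (x : Shape.point Dia) : D.map (Shape.prodMap (𝟭 K) (Shape.spanIncl Dia)) ⋙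
    D.map (Shape.prodMap (𝟭 K) (Shape.spanPt Dia)) ⋙ D.map (K.sect x) =
      D.map (K.sect (A := .square Dia) (UnitSquare.pt false false)) := by
  rw [← D.map_comp, ← D.map_comp]
  rfl

variable [IsDerivator D]

theorem bijective_lan_map (u : J ⥤ K) [u.Full] [u.Faithful] (X Y : D.obj J) :
    Function.Bijective fun f : X ⟶ Y => (D.lan u).map f := by
  have (X : D.obj J) := isIso_unit (D := D) u X
  have : IsIso (D.lanAdj u).unit := NatIso.isIso_of_isIso_app _
  have h := (D.lanAdj u).fullyFaithfulLOfIsIsoUnit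
  exact ⟨fun _ _ hf => h.map_injective hf, fun g => ⟨h.preimage g, h.map_preimage g⟩⟩

/-- A square with zero corners maps to a cartesian square through its final vertex. -/
theorem bijective_loopLift (hD : D.IsPointed) (Y : D.obj (K.prod (.square Dia)))
    (hY : HasZeroCorners Y) (Z : D.obj K) :
    Function.Bijective fun f : vertex Y true true ⟶ Z => loopLift hD Y hY ≫
      (D.ran (Shape.prodMap (𝟭 K) (Shape.cospanIncl Dia))).map
        ((D.lan (Shape.prodMap (𝟭 K) (Shape.cospanPt Dia))).map
          ((D.map (K.fst (.point Dia))).map f)) := by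
  have := isIso_cospanComparison hD Y hY
  have := Shape.prodMap_full (𝟭 K) (Shape.cospanPt Dia)
  have := Shape.prodMap_faithful (𝟭 K) (Shape.cospanPt Dia)
  -- Maps `Y₁₁ ⟶ Z` are maps between their extensions by zero to the cospan, since `K × e ≃ K` and
  -- extension along a fully faithful functor is fully faithful. As `Y` restricts to the extension
  -- of `Y₁₁`, these are maps from `Y` to the loop square of `Z`.
  have h1 := bijective_map_of_isEquivalence (D := D) _ K.isEquivalence_fst_point (vertex Y true true) Z
  have h2 := bijective_lan_map (D := D) (Shape.prodMap (𝟭 K) (Shape.cospanPt Dia))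
    ((D.map (K.fst (.point Dia))).obj (vertex Y true true)) ((D.map (K.fst (.point Dia))).obj Z)
  have h3 := bijective_iso_comp (inv (cospanComparison Y))
    ((D.lan (Shape.prodMap (𝟭 K) (Shape.cospanPt Dia))).obj ((D.map (K.fst (.point Dia))).obj Z))
  have h4 := ((D.ranAdj (Shape.prodMap (𝟭 K) (Shape.cospanIncl Dia))).homEquiv Y
    ((D.lan (Shape.prodMap (𝟭 K) (Shape.cospanPt Dia))).obj
      ((D.map (K.fst (.point Dia))).obj Z))).bijective
  refine cast (congrArg Function.Bijective (funext fun g => ?_)) (((h4.comp h3).comp h2).comp h1)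
  simp only [Function.comp_apply, Adjunction.homEquiv_unit, Functor.map_comp]
  exact (Category.assoc _ _ _).symm

/-- Extension by zero from a minimal element: for `q ≠ p` no element `p` lies above `q`, so the
right extension vanishes there as `Y` does. -/
theorem isIso_ran_unit_of_isZero (hD : D.IsPointed) {P : Type w}
    [PartialOrder P] [Countable P] {p : P} (hp : ∀ q, q ≤ p → q = p)
    (Y : D.obj (K.prod (.poset Dia P)))
    (hY : ∀ q, q ≠ p → IsZero ((D.map (K.sect (A := .poset Dia P) q)).obj Y)) :
    IsIso ((D.ranAdj (Shape.prodMap (𝟭 K) (Shape.incl (K := .poset Dia P) p))).unit.app Y) := by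
  have := Shape.prodMap_full (𝟭 K) (Shape.incl (K := .poset Dia P) p)
  have := Shape.prodMap_faithful (𝟭 K) (Shape.incl (K := .poset Dia P) p)
  refine isIso_of_sect _ fun q => ?_
  by_cases hq : q = p
  · subst hq
    have e : K.sect (A := .poset Dia P) q ≅ K.sect (A := .point Dia) ⟨PUnit.unit⟩ ⋙
        Shape.prodMap (𝟭 K) (Shape.incl (K := .poset Dia P) q) :=
      NatIso.ofComponents (fun _ => Iso.refl _) fun f => by
        refine Prod.ext ?_ (Subsingleton.elim _ _)
        simp
    have := isIso_map_ran_unit (D := D) (Shape.prodMap (𝟭 K) (Shape.incl (K := .poset Dia P) q)) Y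
    rw [isIso_map_congr_iff e, isIso_map_comp_iff]
    infer_instance
  · refine isIso_of_isZero _ (hY q hq) (isZero_of_incl hD fun k => ?_)
    rw [← isZero_map_comp_iff]
    exact isZero_ran_of_isEmpty_coslice hD
      (Shape.prodMap (𝟭 K) (Shape.incl (K := .poset Dia P) p)) (k, q)
      ⟨fun x => hq (hp q (leOfHom x.hom.2))⟩ _

section susp
variable (A : D.obj (K.prod (.point Dia)))

/-- The cocartesian square on the extension by zero of an object placed at `(0,0)`. -/
noncomputable abbrev suspSquare (A : D.obj (K.prod (.point Dia))) :
    D.obj (K.prod (.square Dia)) :=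
  (D.lan (Shape.prodMap (𝟭 K) (Shape.spanIncl Dia))).obj
    ((D.ran (Shape.prodMap (𝟭 K) (Shape.spanPt Dia))).obj A)

theorem isIso_counit_spanPt : IsIso ((D.ranAdj (Shape.prodMap (𝟭 K) (Shape.spanPt Dia))).counit.app A) :=
  have := Shape.prodMap_full (𝟭 K) (Shape.spanPt Dia)
  have := Shape.prodMap_faithful (𝟭 K) (Shape.spanPt Dia)
  (isRan_counit A).isIso_of_fullyFaithful

/-- The identification of an object with the initial vertex of its suspension square. -/
noncomputable def suspUnit : A ⟶ (D.map (Shape.prodMap (𝟭 K) (Shape.spanPt Dia))).obj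
    ((D.map (Shape.prodMap (𝟭 K) (Shape.spanIncl Dia))).obj (suspSquare A)) :=
  have := isIso_counit_spanPt A
  inv ((D.ranAdj (Shape.prodMap (𝟭 K) (Shape.spanPt Dia))).counit.app A) ≫
    (D.map (Shape.prodMap (𝟭 K) (Shape.spanPt Dia))).map
      ((D.lanAdj (Shape.prodMap (𝟭 K) (Shape.spanIncl Dia))).unit.app
        ((D.ran (Shape.prodMap (𝟭 K) (Shape.spanPt Dia))).obj A))

theorem suspUnit_naturality {A B : D.obj (K.prod (.point Dia))} (f : A ⟶ B) :
    f ≫ suspUnit B = suspUnit A ≫ (D.map (Shape.prodMap (𝟭 K) (Shape.spanPt Dia))).map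
      ((D.map (Shape.prodMap (𝟭 K) (Shape.spanIncl Dia))).map
        ((D.lan (Shape.prodMap (𝟭 K) (Shape.spanIncl Dia))).map
          ((D.ran (Shape.prodMap (𝟭 K) (Shape.spanPt Dia))).map f))) := by
  have := isIso_counit_spanPt A
  have := isIso_counit_spanPt B
  have h1 := (D.ranAdj (Shape.prodMap (𝟭 K) (Shape.spanPt Dia))).counit.naturality f
  have h2 := (D.lanAdj (Shape.prodMap (𝟭 K) (Shape.spanIncl Dia))).unit.naturality
    ((D.ran (Shape.prodMap (𝟭 K) (Shape.spanPt Dia))).map f)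
  dsimp only [Functor.comp_map, Functor.id_map, Functor.comp_obj, Functor.id_obj] at h1 h2
  unfold suspUnit
  dsimp only [Functor.comp_map, Functor.id_map, Functor.comp_obj, Functor.id_obj]
  rw [Category.assoc, IsIso.eq_inv_comp, ← reassoc_of% h1, IsIso.hom_inv_id_assoc,
    ← Functor.map_comp, ← Functor.map_comp, h2]

/-- Maps out of the cocartesian square are maps of spans. The restriction of `Y` to the span is
extended by zero from `(0,0)`, so only the component at `(0,0)` remains. -/
theorem bijective_suspUnit (hD : D.IsPointed) (Y : D.obj (K.prod (.square Dia)))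
    (hY : HasZeroCorners Y) : Function.Bijective fun g : suspSquare A ⟶ Y =>
      suspUnit A ≫ (D.map (Shape.prodMap (𝟭 K) (Shape.spanPt Dia))).map
        ((D.map (Shape.prodMap (𝟭 K) (Shape.spanIncl Dia))).map g) := by
  have := isIso_counit_spanPt A
  have h := isIso_ran_unit_of_isZero (K := K) hD (P := UnitSquare.Span.{w})
    (p := ⟨UnitSquare.pt false false, by decide⟩)
    (Y := (D.map (Shape.prodMap (𝟭 K) (Shape.spanIncl Dia))).obj Y) (by
      rintro ⟨⟨⟨a, b⟩⟩, hs⟩ ⟨h4, h5⟩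
      have h6 : ∀ a b, a ≤ false → b ≤ false → a = false ∧ b = false := by decide
      obtain ⟨rfl, rfl⟩ := h6 a b h4 h5
      rfl) (by
      rintro ⟨⟨⟨a, b⟩⟩, hs⟩ hq
      have e : K.sect (A := .span Dia) ⟨⟨(a, b)⟩, hs⟩ ⋙
          Shape.prodMap (𝟭 K) (Shape.spanIncl Dia) ≅ K.sect (A := .square Dia) (UnitSquare.pt a b) :=
        NatIso.ofComponents (fun _ => Iso.refl _) fun f => by
          refine Prod.ext ?_ (Subsingleton.elim _ _)
          simp
      rw [← isZero_map_comp_iff, isZero_map_congr_iff e]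
      cases a <;> cases b
      · exact absurd rfl hq
      · exact hY.2
      · exact hY.1
      · exact absurd rfl hs)
  have h1 := ((D.lanAdj (Shape.prodMap (𝟭 K) (Shape.spanIncl Dia))).homEquiv
    ((D.ran (Shape.prodMap (𝟭 K) (Shape.spanPt Dia))).obj A) Y).bijective
  have h2 := bijective_map_of_isIso_ran_unit (D := D) (Shape.prodMap (𝟭 K) (Shape.spanPt Dia)) h
    ((D.ran (Shape.prodMap (𝟭 K) (Shape.spanPt Dia))).obj A)
  have h3 := bijective_iso_comp
    (inv ((D.ranAdj (Shape.prodMap (𝟭 K) (Shape.spanPt Dia))).counit.app A))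
    ((D.map (Shape.prodMap (𝟭 K) (Shape.spanPt Dia))).obj
      ((D.map (Shape.prodMap (𝟭 K) (Shape.spanIncl Dia))).obj Y))
  refine cast (congrArg Function.Bijective (funext fun g => ?_)) ((h3.comp h2).comp h1)
  simp only [Function.comp_apply, Adjunction.homEquiv_unit, Functor.map_comp]
  exact (Category.assoc _ _ _).symm

/-- The arrow `δ` is a right inverse of the mate, in place of the structure isomorphism of `ranMor`.
Both universal arrows in `suspUnit` are compatible with restriction by the mate identities. -/
theorem suspUnit_map (u : J ⥤ K)
    (δ : (D.ran (Shape.prodMap (𝟭 J) (Shape.spanPt Dia))).obj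
        ((D.map (Shape.prodMap u (𝟭 (Shape.point Dia)))).obj A) ⟶
      (D.map (Shape.prodMap u (𝟭 (Shape.span Dia)))).obj
        ((D.ran (Shape.prodMap (𝟭 K) (Shape.spanPt Dia))).obj A))
    (hδ : δ ≫ (D.rmate (prodCell' u (Shape.spanPt Dia))).app A = 𝟙 _) :
    suspUnit ((D.map (Shape.prodMap u (𝟭 (Shape.point Dia)))).obj A) ≫
        (D.map (Shape.prodMap (𝟭 J) (Shape.spanPt Dia))).map
          ((D.map (Shape.prodMap (𝟭 J) (Shape.spanIncl Dia))).map
            ((D.lan (Shape.prodMap (𝟭 J) (Shape.spanIncl Dia))).map δ ≫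
              (D.lmate (prodCell u (Shape.spanIncl Dia))).app _)) =
      (D.map (Shape.prodMap u (𝟭 (Shape.point Dia)))).map (suspUnit A) ≫
        eqToHom ((map_map_eq (D := D) (u := Shape.prodMap u (𝟭 (Shape.point Dia)))
          (v := Shape.prodMap (𝟭 K) (Shape.spanPt Dia))
          (u' := Shape.prodMap (𝟭 J) (Shape.spanPt Dia))
          (v' := Shape.prodMap u (𝟭 (Shape.span Dia))) rfl _).trans
          (congr_arg _ (map_map_eq (D := D) (u := Shape.prodMap u (𝟭 (Shape.span Dia)))
          (v := Shape.prodMap (𝟭 K) (Shape.spanIncl Dia))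
          (u' := Shape.prodMap (𝟭 J) (Shape.spanIncl Dia))
          (v' := Shape.prodMap u (𝟭 (Shape.square Dia))) rfl _))) := by
  have i1 := isIso_counit_spanPt A
  have i2 := isIso_counit_spanPt ((D.map (Shape.prodMap u (𝟭 (Shape.point Dia)))).obj A)
  have h1 := D.rmate_counit (prodCell' u (Shape.spanPt Dia)) A
  have h2 := D.lmate_unit (prodCell u (Shape.spanIncl Dia))
    ((D.ran (Shape.prodMap (𝟭 K) (Shape.spanPt Dia))).obj A)
  have h3 := (D.lanAdj (Shape.prodMap (𝟭 J) (Shape.spanIncl Dia))).unit.naturality δ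
  have h4 := sqL_app_of_eq_id (D := D) (prodCell u (Shape.spanIncl Dia)) rfl rfl (suspSquare A)
  have h5 := sqR_app_of_eq_id (D := D) (prodCell' u (Shape.spanPt Dia)) rfl rfl
    ((D.ran (Shape.prodMap (𝟭 K) (Shape.spanPt Dia))).obj A)
  have h6 := map_map_naturality (D := D) (u := Shape.prodMap u (𝟭 (Shape.point Dia)))
          (v := Shape.prodMap (𝟭 K) (Shape.spanPt Dia))
          (u' := Shape.prodMap (𝟭 J) (Shape.spanPt Dia))
          (v' := Shape.prodMap u (𝟭 (Shape.span Dia))) rfl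
          ((D.lanAdj (Shape.prodMap (𝟭 K) (Shape.spanIncl Dia))).unit.app
            ((D.ran (Shape.prodMap (𝟭 K) (Shape.spanPt Dia))).obj A))
  dsimp only [Functor.comp_map, Functor.id_map, Functor.comp_obj, Functor.id_obj] at h1 h2 h3 h4 h5 h6 hδ
  rw [h5] at h1
  rw [h4] at h2
  have h7 := congr_arg (fun x => (D.map (Shape.prodMap (𝟭 J) (Shape.spanPt Dia))).map δ ≫ x) h1
  dsimp only at h7
  rw [← Functor.map_comp_assoc, hδ, CategoryTheory.Functor.map_id, Category.id_comp] at h7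
  unfold suspUnit
  dsimp only [Functor.comp_map, Functor.id_map, Functor.comp_obj, Functor.id_obj]
  rw [Functor.map_comp, Category.assoc, ← Functor.map_comp]
  rw [← reassoc_of% h3, h2, IsIso.inv_comp_eq, h7]
  simp only [Functor.map_comp, Category.assoc, eqToHom_map]
  rw [Functor.map_inv]
  erw [IsIso.hom_inv_id_assoc]
  exact congr_arg (fun x => _ ≫ x) (eqToHom_rotate h6 _ _ _)

end susp

section adjunction

/-- The suspension square of a constant diagram. -/
noncomputable abbrev suspObj (X : D.obj K) : D.obj (K.prod (.square Dia)) :=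
  suspSquare ((D.map (K.fst (.point Dia))).obj X)

/-- The identification of an object with the initial vertex of its suspension square. -/
noncomputable def suspVertex (X : D.obj K) : X ⟶ vertex (suspObj X) false false :=
  eqToHom (map_fst_sect X ⟨PUnit.unit⟩).symm ≫ (D.map (K.sect (A := .point Dia) ⟨PUnit.unit⟩)).map
    (suspUnit ((D.map (K.fst (.point Dia))).obj X)) ≫
      eqToHom (Functor.congr_obj (map_sect_spanPt ⟨PUnit.unit⟩) (suspObj X))

theorem suspVertex_comp (X : D.obj K) {Y : D.obj (K.prod (.square Dia))} (g : suspObj X ⟶ Y) :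
    suspVertex X ≫ (D.map (K.sect (UnitSquare.pt false false))).map g =
      eqToHom (map_fst_sect X ⟨PUnit.unit⟩).symm ≫
        (D.map (K.sect (A := .point Dia) ⟨PUnit.unit⟩)).map
          (suspUnit ((D.map (K.fst (.point Dia))).obj X) ≫
            (D.map (Shape.prodMap (𝟭 K) (Shape.spanPt Dia))).map
              ((D.map (Shape.prodMap (𝟭 K) (Shape.spanIncl Dia))).map g)) ≫
          eqToHom (Functor.congr_obj (map_sect_spanPt ⟨PUnit.unit⟩) Y) := by
  have h := eqToHom_functor_naturality (map_sect_spanPt (D := D) (K := K) ⟨PUnit.unit⟩) g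
  dsimp only [Functor.comp_map, Functor.comp_obj] at h
  unfold suspVertex
  simp only [Category.assoc, Functor.map_comp]
  rw [h]

theorem suspVertex_naturality {X Y : D.obj K} (f : X ⟶ Y) :
    f ≫ suspVertex Y = suspVertex X ≫ (D.map (K.sect (UnitSquare.pt false false))).map
      ((D.lan (Shape.prodMap (𝟭 K) (Shape.spanIncl Dia))).map
          ((D.ran (Shape.prodMap (𝟭 K) (Shape.spanPt Dia))).map
            ((D.map (K.fst (.point Dia))).map f))) := by
  have h : D.map (K.fst (.point Dia)) ⋙ D.map (K.sect (A := .point Dia) ⟨PUnit.unit⟩) = 𝟭 _ :=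
    (D.map_comp (K.sect (A := .point Dia) ⟨PUnit.unit⟩) (K.fst (.point Dia))).symm.trans (D.map_id K)
  have h1 := eqToHom_functor_naturality h.symm f
  dsimp only [Functor.comp_map, Functor.comp_obj, Functor.id_map, Functor.id_obj] at h1
  rw [suspVertex_comp, ← suspUnit_naturality, Functor.map_comp]
  unfold suspVertex
  rw [Category.assoc, reassoc_of% h1]

/-- `bijective_suspUnit` transported along the equivalence of `K` with `K × e`. With `Y` the loop
square of `Z`, the right-hand side is the set of maps `X ⟶ Ω Z`. -/
theorem bijective_suspVertex (hD : D.IsPointed) (X : D.obj K) (Y : D.obj (K.prod (.square Dia)))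
    (hY : HasZeroCorners Y) : Function.Bijective fun g : suspObj X ⟶ Y =>
      suspVertex X ≫ (D.map (K.sect (UnitSquare.pt false false))).map g := by
  have h1 := bijective_suspUnit ((D.map (K.fst (.point Dia))).obj X) hD Y hY
  have h2 := bijective_map_of_isEquivalence (D := D) _ (K.isEquivalence_sect_point ⟨PUnit.unit⟩)
    ((D.map (K.fst (.point Dia))).obj X) ((D.map (Shape.prodMap (𝟭 K) (Shape.spanPt Dia))).obj
    ((D.map (Shape.prodMap (𝟭 K) (Shape.spanIncl Dia))).obj Y))
  have h3 := bijective_comp_iso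
    ((D.map (K.sect (A := .point Dia) ⟨PUnit.unit⟩)).obj ((D.map (K.fst (.point Dia))).obj X))
    (eqToHom (Functor.congr_obj (map_sect_spanPt (D := D) (K := K) ⟨PUnit.unit⟩) Y))
  have h4 := bijective_iso_comp (eqToHom (map_fst_sect (D := D) X ⟨PUnit.unit⟩).symm) (vertex Y false false)
  refine cast (congrArg Function.Bijective (funext fun g => ?_)) (((h4.comp h3).comp h2).comp h1)
  exact (suspVertex_comp X g).symm

theorem isZero_sect_lan_cospanPt (hD : D.IsPointed) (A : D.obj (K.prod (.point Dia)))
    (q : UnitSquare.Cospan.{w}) (hq : q.1 ≠ UnitSquare.pt true true) :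
    IsZero ((D.map (K.sect (A := .cospan Dia) q)).obj
      ((D.lan (Shape.prodMap (𝟭 K) (Shape.cospanPt Dia))).obj A)) := by
  refine isZero_of_incl hD fun k => ?_
  rw [← isZero_map_comp_iff]
  refine isZero_lan_of_isEmpty_slice hD (Shape.prodMap (𝟭 K) (Shape.cospanPt Dia)) (k, q)
      ⟨fun x => hq ?_⟩ _
  exact le_antisymm (show q.1 ≤ UnitSquare.pt true true from ⟨Bool.le_true _, Bool.le_true _⟩)
    (leOfHom x.hom.2)

theorem isZero_sect_ran_spanPt (hD : D.IsPointed) (A : D.obj (K.prod (.point Dia)))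
    (q : UnitSquare.Span.{w}) (hq : q.1 ≠ UnitSquare.pt false false) :
    IsZero ((D.map (K.sect (A := .span Dia) q)).obj
      ((D.ran (Shape.prodMap (𝟭 K) (Shape.spanPt Dia))).obj A)) := by
  refine isZero_of_incl hD fun k => ?_
  rw [← isZero_map_comp_iff]
  refine isZero_ran_of_isEmpty_coslice hD (Shape.prodMap (𝟭 K) (Shape.spanPt Dia)) (k, q)
      ⟨fun x => hq ?_⟩ _
  exact le_antisymm (leOfHom x.hom.2)
    (show UnitSquare.pt false false ≤ q.1 from ⟨Bool.false_le _, Bool.false_le _⟩)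

theorem hasZeroCorners_suspSquare (hD : D.IsPointed) (A : D.obj (K.prod (.point Dia))) :
    HasZeroCorners (suspSquare A) := by
  have := Shape.prodMap_full (𝟭 K) (Shape.spanIncl Dia)
  have := Shape.prodMap_faithful (𝟭 K) (Shape.spanIncl Dia)
  have := isIso_unit (D := D) (Shape.prodMap (𝟭 K) (Shape.spanIncl Dia))
    ((D.ran (Shape.prodMap (𝟭 K) (Shape.spanPt Dia))).obj A)
  have h (q : UnitSquare.Span.{w}) (hq : q.1 ≠ UnitSquare.pt false false) :
      IsZero ((D.map (K.sect (A := .square Dia) q.1)).obj (suspSquare A)) := by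
    have e : K.sect (A := .square Dia) q.1 ≅
      K.sect (A := .span Dia) q ⋙ Shape.prodMap (𝟭 K) (Shape.spanIncl Dia) := Iso.refl _
    rw [isZero_map_congr_iff e, isZero_map_comp_iff]
    exact (isZero_sect_ran_spanPt hD A q hq).of_iso
      ((D.map (K.sect (A := .span Dia) q)).mapIso (asIso ((D.lanAdj (Shape.prodMap (𝟭 K) (Shape.spanIncl Dia))).unit.app
        ((D.ran (Shape.prodMap (𝟭 K) (Shape.spanPt Dia))).obj A))).symm)
  exact ⟨h ⟨UnitSquare.pt true false, by decide⟩ (by decide),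
    h ⟨UnitSquare.pt false true, by decide⟩ (by decide)⟩

/-- The extension along the cospan keeps the values at `(1,0)` and `(0,1)`, where the extension by
zero from `(1,1)` vanishes. So loop squares are admissible targets for suspension squares. -/
theorem hasZeroCorners_ran_lan (hD : D.IsPointed) (A : D.obj (K.prod (.point Dia))) :
    HasZeroCorners ((D.ran (Shape.prodMap (𝟭 K) (Shape.cospanIncl Dia))).obj
      ((D.lan (Shape.prodMap (𝟭 K) (Shape.cospanPt Dia))).obj A)) := by
  have := Shape.prodMap_full (𝟭 K) (Shape.cospanIncl Dia)
  have := Shape.prodMap_faithful (𝟭 K) (Shape.cospanIncl Dia)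
  have := (isRan_counit (D := D) (u := Shape.prodMap (𝟭 K) (Shape.cospanIncl Dia))
    ((D.lan (Shape.prodMap (𝟭 K) (Shape.cospanPt Dia))).obj A)).isIso_of_fullyFaithful
  have h (q : UnitSquare.Cospan.{w}) (hq : q.1 ≠ UnitSquare.pt true true) :
      IsZero ((D.map (K.sect (A := .square Dia) q.1)).obj
        ((D.ran (Shape.prodMap (𝟭 K) (Shape.cospanIncl Dia))).obj
          ((D.lan (Shape.prodMap (𝟭 K) (Shape.cospanPt Dia))).obj A))) := by
    have e : K.sect (A := .square Dia) q.1 ≅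
      K.sect (A := .cospan Dia) q ⋙ Shape.prodMap (𝟭 K) (Shape.cospanIncl Dia) := Iso.refl _
    rw [isZero_map_congr_iff e, isZero_map_comp_iff]
    exact (isZero_sect_lan_cospanPt hD A q hq).of_iso
      ((D.map (K.sect (A := .cospan Dia) q)).mapIso (asIso ((D.ranAdj (Shape.prodMap (𝟭 K) (Shape.cospanIncl Dia))).counit.app
        ((D.lan (Shape.prodMap (𝟭 K) (Shape.cospanPt Dia))).obj A))))
  exact ⟨h ⟨UnitSquare.pt true false, by decide⟩ (by decide),
    h ⟨UnitSquare.pt false true, by decide⟩ (by decide)⟩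

end adjunction

end Prederivator

/-! ### The adjunction between suspension and loops. -/

namespace Prederivator
variable {Dia : DiagramDomain.{w}} {D : Prederivator.{w, v, u} Dia} [IsDerivator D] {J K : Shape Dia}

theorem suspVertex_map (u : J ⥤ K) (X : D.obj K)
    (e₁ : (D.map (J.fst (.point Dia))).obj ((D.map u).obj X) =
      (D.map (Shape.prodMap u (𝟭 (Shape.point Dia)))).obj ((D.map (K.fst (.point Dia))).obj X))
    (δ : (D.ran (Shape.prodMap (𝟭 J) (Shape.spanPt Dia))).obj
        ((D.map (Shape.prodMap u (𝟭 (Shape.point Dia)))).obj ((D.map (K.fst (.point Dia))).obj X)) ⟶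
      (D.map (Shape.prodMap u (𝟭 (Shape.span Dia)))).obj
        ((D.ran (Shape.prodMap (𝟭 K) (Shape.spanPt Dia))).obj ((D.map (K.fst (.point Dia))).obj X)))
    (hδ : δ ≫ (D.rmate (prodCell' u (Shape.spanPt Dia))).app _ = 𝟙 _)
    (e : vertex ((D.map (Shape.prodMap u (𝟭 (Shape.square Dia)))).obj (suspObj X)) false false =
      (D.map u).obj (vertex (suspObj X) false false)) :
    suspVertex ((D.map u).obj X) ≫ (D.map (J.sect (UnitSquare.pt false false))).map
      ((D.lan (Shape.prodMap (𝟭 J) (Shape.spanIncl Dia))).map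
        ((D.ran (Shape.prodMap (𝟭 J) (Shape.spanPt Dia))).map (eqToHom e₁)) ≫
          (D.lan (Shape.prodMap (𝟭 J) (Shape.spanIncl Dia))).map δ ≫
              (D.lmate (prodCell u (Shape.spanIncl Dia))).app _) ≫ eqToHom e =
      (D.map u).map (suspVertex X) := by
  have h1 := suspUnit_map ((D.map (K.fst (.point Dia))).obj X) u δ hδ
  have h2 := suspUnit_naturality (eqToHom e₁)
  have h3 := map_map_naturality (D := D) (u := J.sect (A := .point Dia) ⟨PUnit.unit⟩)
    (v := Shape.prodMap u (𝟭 (Shape.point Dia))) (u' := u)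
    (v' := K.sect (A := .point Dia) ⟨PUnit.unit⟩) rfl
    (suspUnit ((D.map (K.fst (.point Dia))).obj X))
  dsimp only [Functor.comp_obj] at h1 h2 h3
  rw [← Category.assoc, suspVertex_comp]
  have e₂ := (map_map_eq (D := D) (u := Shape.prodMap u (𝟭 (Shape.point Dia)))
    (v := Shape.prodMap (𝟭 K) (Shape.spanPt Dia)) (u' := Shape.prodMap (𝟭 J) (Shape.spanPt Dia))
    (v' := Shape.prodMap u (𝟭 (Shape.span Dia))) rfl
      ((D.map (Shape.prodMap (𝟭 K) (Shape.spanIncl Dia))).obj (suspObj X))).trans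
    (congr_arg _ (map_map_eq (D := D) (u := Shape.prodMap u (𝟭 (Shape.span Dia)))
      (v := Shape.prodMap (𝟭 K) (Shape.spanIncl Dia))
      (u' := Shape.prodMap (𝟭 J) (Shape.spanIncl Dia))
      (v' := Shape.prodMap u (𝟭 (Shape.square Dia))) rfl (suspObj X)))
  have h4 : suspUnit ((D.map (J.fst (.point Dia))).obj ((D.map u).obj X)) ≫
      (D.map (Shape.prodMap (𝟭 J) (Shape.spanPt Dia))).map
        ((D.map (Shape.prodMap (𝟭 J) (Shape.spanIncl Dia))).map
          ((D.lan (Shape.prodMap (𝟭 J) (Shape.spanIncl Dia))).map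
            ((D.ran (Shape.prodMap (𝟭 J) (Shape.spanPt Dia))).map (eqToHom e₁)) ≫
              (D.lan (Shape.prodMap (𝟭 J) (Shape.spanIncl Dia))).map δ ≫
                (D.lmate (prodCell u (Shape.spanIncl Dia))).app _)) =
      eqToHom e₁ ≫ (D.map (Shape.prodMap u (𝟭 (Shape.point Dia)))).map
        (suspUnit ((D.map (K.fst (.point Dia))).obj X)) ≫ eqToHom e₂ := by
    rw [Functor.map_comp, Functor.map_comp, ← reassoc_of% h2, h1]
  rw [h4, Functor.map_comp, Functor.map_comp, eqToHom_map, eqToHom_map]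
  unfold suspVertex
  rw [Functor.map_comp, Functor.map_comp, eqToHom_map, eqToHom_map]
  have h5 := eqToHom_rotate h3
    ((congr_arg (D.map u).obj (Functor.congr_obj (map_sect_spanPt ⟨PUnit.unit⟩) (suspObj X))))
    ((congr_arg (D.map u).obj (map_fst_sect X ⟨PUnit.unit⟩)).trans (map_fst_sect ((D.map u).obj X) ⟨PUnit.unit⟩).symm |>.trans
      (congr_arg (D.map (J.sect (A := .point Dia) ⟨PUnit.unit⟩)).obj e₁))
    ((congr_arg (D.map (J.sect (A := .point Dia) ⟨PUnit.unit⟩)).obj e₂).trans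
      ((Functor.congr_obj (map_sect_spanPt ⟨PUnit.unit⟩) _).trans e))
  rw [h5]
  simp only [Category.assoc, eqToHom_trans, eqToHom_trans_assoc]

/-- The structure isomorphism of `Σ` is the value at `(1,1)` of a map `θ` of suspension squares,
which at `(0,0)` respects the identification with `X`. Naturality of the loop comparison in `θ`
links the two vertices. -/
theorem susp_γ_hom_app (u : J ⥤ K) (X : D.obj K)
    (e : vertex ((D.map (Shape.prodMap u (𝟭 (Shape.square Dia)))).obj (suspObj X)) true true =
      (D.map u).obj (vertex (suspObj X) true true))
    (e' : vertex ((D.map (Shape.prodMap u (𝟭 (Shape.square Dia)))).obj (suspObj X)) false false =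
      (D.map u).obj (vertex (suspObj X) false false)) :
    ∃ θ : suspObj ((D.map u).obj X) ⟶ (D.map (Shape.prodMap u (𝟭 (Shape.square Dia)))).obj (suspObj X),
      (D.susp.γ u).hom.app X = (D.map (J.sect (UnitSquare.pt true true))).map θ ≫ eqToHom e ∧
      suspVertex ((D.map u).obj X) ≫ (D.map (J.sect (UnitSquare.pt false false))).map θ ≫
        eqToHom e' = (D.map u).map (suspVertex X) := by
  have e₁ : (D.map (J.fst (.point Dia))).obj ((D.map u).obj X) =
      (D.map (Shape.prodMap u (𝟭 (Shape.point Dia)))).obj ((D.map (K.fst (.point Dia))).obj X) :=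
    map_map_eq (u := J.fst (.point Dia)) (v := u) (u' := Shape.prodMap u (𝟭 (Shape.point Dia)))
      (v' := K.fst (.point Dia)) rfl _
  have i3 := isIso_rmate_prodCell' (D := D) (Shape.spanPt Dia) u
  obtain ⟨δ, hδ⟩ : ∃ δ : (D.ran (Shape.prodMap (𝟭 J) (Shape.spanPt Dia))).obj
        ((D.map (Shape.prodMap u (𝟭 (Shape.point Dia)))).obj ((D.map (K.fst (.point Dia))).obj X)) ⟶
      (D.map (Shape.prodMap u (𝟭 (Shape.span Dia)))).obj
        ((D.ran (Shape.prodMap (𝟭 K) (Shape.spanPt Dia))).obj ((D.map (K.fst (.point Dia))).obj X)),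
      δ = (((D.ranMor (Shape.spanPt Dia)).γ u).hom.app ((D.map (K.fst (.point Dia))).obj X)) :=
    ⟨_, rfl⟩
  have hδ' : δ ≫ (D.rmate (prodCell' u (Shape.spanPt Dia))).app _ = 𝟙 _ := by
    subst hδ
    exact (asIso (D.rmate (prodCell' u (Shape.spanPt Dia)))).inv_hom_id_app _
  refine ⟨(D.lan (Shape.prodMap (𝟭 J) (Shape.spanIncl Dia))).map
        ((D.ran (Shape.prodMap (𝟭 J) (Shape.spanPt Dia))).map (eqToHom e₁)) ≫
          (D.lan (Shape.prodMap (𝟭 J) (Shape.spanIncl Dia))).map δ ≫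
              (D.lmate (prodCell u (Shape.spanIncl Dia))).app _, ?_, suspVertex_map u X e₁ δ hδ' e'⟩
  rw [← Functor.map_comp_assoc]
  have h1 : (((D.const (.point Dia)).comp (D.ranMor (Shape.spanPt Dia))).γ u).hom.app X =
      (D.ran (Shape.prodMap (𝟭 J) (Shape.spanPt Dia))).map (eqToHom e₁) ≫ δ := by
    subst hδ
    refine (Morphism.comp_γ_hom_app _ _ u _).trans ?_
    refine congr_arg (fun x => (D.ran (Shape.prodMap (𝟭 J) (Shape.spanPt Dia))).map x ≫ _) ?_
    exact const_γ_hom_app _ _ _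
  have h2 : ((((D.const (.point Dia)).comp (D.ranMor (Shape.spanPt Dia))).comp
      (D.lanMor (Shape.spanIncl Dia))).γ u).hom.app X =
      (D.lan (Shape.prodMap (𝟭 J) (Shape.spanIncl Dia))).map
        ((D.ran (Shape.prodMap (𝟭 J) (Shape.spanPt Dia))).map (eqToHom e₁) ≫ δ) ≫
          (D.lmate (prodCell u (Shape.spanIncl Dia))).app _ := by
    refine (Morphism.comp_γ_hom_app _ _ u _).trans ?_
    exact congr_arg (fun x => (D.lan (Shape.prodMap (𝟭 J) (Shape.spanIncl Dia))).map x ≫ _) h1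
  rw [← h2]
  exact (Morphism.comp_γ_hom_app (((D.const (.point Dia)).comp (D.ranMor (Shape.spanPt Dia))).comp
      (D.lanMor (Shape.spanIncl Dia))) (D.eval (UnitSquare.pt true true)) u X).trans
    (congr_arg (fun x => _ ≫ x) (eval_γ_hom_app (UnitSquare.pt true true) u (suspObj X)))

/-- The unit of the adjunction between suspension and loops. -/
noncomputable def suspLoopUnit (hD : D.IsPointed) (X : D.obj K) :
    X ⟶ (D.loop.app K).obj (vertex (suspObj X) true true) :=
  suspVertex X ≫ loopComparison hD (suspObj X) (hasZeroCorners_suspSquare hD _)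

theorem suspLoopUnit_naturality (hD : D.IsPointed) {X Y : D.obj K} (f : X ⟶ Y) :
    f ≫ suspLoopUnit hD Y = suspLoopUnit hD X ≫ (D.loop.app K).map
      ((D.map (K.sect (UnitSquare.pt true true))).map
        ((D.lan (Shape.prodMap (𝟭 K) (Shape.spanIncl Dia))).map
          ((D.ran (Shape.prodMap (𝟭 K) (Shape.spanPt Dia))).map
            ((D.map (K.fst (.point Dia))).map f)))) := by
  unfold suspLoopUnit
  rw [← Category.assoc, suspVertex_naturality, Category.assoc, Category.assoc,
    ← loopComparison_naturality]

theorem suspLoopUnit_map (hD : D.IsPointed) (u : J ⥤ K) (X : D.obj K) :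
    ∃ γ : vertex (suspObj ((D.map u).obj X)) true true ⟶
        (D.map u).obj (vertex (suspObj X) true true),
      (D.susp.γ u).hom.app X = γ ∧
      suspLoopUnit hD ((D.map u).obj X) ≫ (D.loop.app J).map γ ≫
        (D.loop.γ u).hom.app (vertex (suspObj X) true true) = (D.map u).map (suspLoopUnit hD X) := by
  have e (a b : Bool) : vertex ((D.map (Shape.prodMap u (𝟭 (Shape.square Dia)))).obj (suspObj X)) a b =
      (D.map u).obj (vertex (suspObj X) a b) :=
    map_map_eq (D := D) (u := J.sect (UnitSquare.pt a b))
      (v := Shape.prodMap u (𝟭 (Shape.square Dia)))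
      (u' := u) (v' := K.sect (UnitSquare.pt a b)) rfl _
  obtain ⟨θ, h1, h2⟩ := susp_γ_hom_app u X (e _ _) (e _ _)
  have hz := hasZeroCorners_suspSquare hD ((D.map (K.fst (.point Dia))).obj X)
  have hz' : HasZeroCorners ((D.map (Shape.prodMap u (𝟭 (Shape.square Dia)))).obj (suspObj X)) :=
    ⟨(isZero_map u hz.1).of_iso (eqToIso (e _ _)), (isZero_map u hz.2).of_iso (eqToIso (e _ _))⟩
  have h3 := loopComparison_naturality hD
    (hasZeroCorners_suspSquare hD ((D.map (J.fst (.point Dia))).obj ((D.map u).obj X))) hz' θ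
  have h4 := loopComparison_map hD u (suspObj X) hz hz' (e _ _) (e _ _)
  refine ⟨_, h1, ?_⟩
  unfold suspLoopUnit
  rw [Functor.map_comp, Category.assoc, Category.assoc, ← reassoc_of% h3, h4, Functor.map_comp, ← h2,
    Category.assoc, Category.assoc]

/-- Both sides classify maps from the suspension square of `X` to the loop square of `Z`, by their
values at `(1,1)` and at `(0,0)` respectively. -/
theorem bijective_suspLoopUnit (hD : D.IsPointed) (X Z : D.obj K) :
    Function.Bijective fun f : vertex (suspObj X) true true ⟶ Z =>
      suspLoopUnit hD X ≫ (D.loop.app K).map f := by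
  have h1 := bijective_loopLift hD (suspObj X) (hasZeroCorners_suspSquare hD _) Z
  have h2 := bijective_suspVertex hD X _ (hasZeroCorners_ran_lan hD ((D.map (K.fst (.point Dia))).obj Z))
  refine cast (congrArg Function.Bijective (funext fun g => ?_)) (h2.comp h1)
  rw [Function.comp_apply, Functor.map_comp, ← Category.assoc]
  rfl

theorem exists_adjunction_susp_loop (hD : D.IsPointed) :
    Nonempty (MorphismAdjunction D.susp D.loop) :=
  exists_morphismAdjunction (Φ := D.susp) (Ψ := D.loop) (fun K X => suspLoopUnit hD X)
    (fun f => suspLoopUnit_naturality hD f)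
    (fun u X => by
      obtain ⟨γ, h1, h2⟩ := suspLoopUnit_map hD u X
      rw [h1]
      exact h2)
    fun K X Z => bijective_suspLoopUnit hD X Z

end Prederivator

/-! ### Loops and the shift on spectra. -/

namespace Prederivator
variable {Dia : DiagramDomain.{w}} {J K : Shape Dia}

section full
variable {E : Prederivator.{w, v, u} Dia} {P : ∀ K, ObjectProperty (E.obj K)}
  {hP : ∀ {J K : Shape Dia} (u : J ⥤ K) (X : E.obj K), P K X → P J ((E.map u).obj X)}

/-- A limit cone whose vertex and diagram lie in a full subcategory is a limit cone there. This
avoids comparing the chosen right Kan extensions of `St` with those of `D`. -/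
theorem isRan_full {u : J ⥤ K} {X : (E.full P hP).obj J} {Y : (E.full P hP).obj K}
    (c : ((E.full P hP).map u).obj Y ⟶ X) (h : IsRan (D := E) u c.hom) : IsRan u c := fun Z =>
  (Function.Bijective.of_comp_iff' (full_hom_bijective (((E.full P hP).map u).obj Z) X) _).1
    ((h Z.obj).comp (full_hom_bijective Z Y))

theorem full_cospanCone_hom (N : (E.full P hP).obj (K.prod (.square Dia))) :
    (cospanCone N).hom = cospanCone (D := E) N.obj :=
  congr_arg (fun x => x ≫ (E.map₂ (Shape.prodWhiskerRight K (cospanCell Dia))).app N.obj)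
    (full_mapComp_inv (hP := hP) (Shape.prodMap (𝟭 K) (Shape.cospan Dia).toPoint)
      (Shape.prodMap (𝟭 K) (Shape.incl (K := .square Dia) (UnitSquare.pt false false))) N)

theorem isCartesianAt_full [IsDerivator E] [IsDerivator (E.full P hP)]
    {N : (E.full P hP).obj (K.prod (.square Dia))} (h : IsCartesianAt (D := E) N.obj) :
    IsCartesianAt N := by
  rw [isCartesianAt_iff_isRan] at h ⊢
  refine isRan_full _ ?_
  rw [full_cospanCone_hom]
  exact h

end full

section comparison
variable {D : Prederivator.{w, v, u} Dia}

theorem map_bandSquare_false_false (K : Shape Dia) : 𝟭 (D.obj (K.prod (.band Dia))) =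
    D.map K.bandSquare ⋙ (D.shift (.band Dia)).map (K.sect (UnitSquare.pt false false)) := by
  refine (D.map_id _).symm.trans (Eq.trans ?_ (D.map_comp (Shape.prodMap (K.sect _) (𝟭 _)) _))
  refine congr_arg D.map (CategoryTheory.Functor.ext (fun _ => rfl) fun _ _ f => ?_)
  exact Prod.ext ((Category.id_comp _).trans (Category.comp_id _)).symm (Subsingleton.elim _ _)

theorem map_bandSquare_true_true (K : Shape Dia) :
    D.map K.bandSquare ⋙ (D.shift (.band Dia)).map (K.sect (UnitSquare.pt true true)) =
      D.bandShift K := by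
  refine (D.map_comp (Shape.prodMap (K.sect _) (𝟭 _)) _).symm.trans ?_
  refine congr_arg D.map (CategoryTheory.Functor.ext (fun _ => rfl) fun _ _ f => ?_)
  exact Prod.ext ((Category.id_comp _).trans (Category.comp_id _)).symm (Subsingleton.elim _ _)

variable [IsDerivator D]

theorem squareComparison_naturality (hD : D.IsPointed) {Y Y' : D.obj (K.prod (.square Dia))}
    (hY : HasZeroCorners Y) (hY' : HasZeroCorners Y') {A B A' B' : D.obj K}
    (hA : A = vertex Y false false) (hB : vertex Y true true = B)
    (hA' : A' = vertex Y' false false) (hB' : vertex Y' true true = B')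
    (g : Y ⟶ Y') (f : A ⟶ A') (f' : B ⟶ B')
    (hf : f ≫ eqToHom hA' = eqToHom hA ≫ (D.map (K.sect (UnitSquare.pt false false))).map g)
    (hf' : (D.map (K.sect (UnitSquare.pt true true))).map g ≫ eqToHom hB' = eqToHom hB ≫ f') :
    f ≫ squareComparison hD Y' hY' hA' hB' = squareComparison hD Y hY hA hB ≫
      (D.loop.app K).map f' := by
  subst hA hB hA' hB'
  simp only [eqToHom_refl, Category.id_comp, Category.comp_id] at hf hf'
  subst hf hf'
  simpa [squareComparison] using loopComparison_naturality hD hY hY' g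

theorem squareComparison_map (hD : D.IsPointed) (u : J ⥤ K) {Y : D.obj (K.prod (.square Dia))}
    (hY : HasZeroCorners Y) {A B : D.obj K}
    (hA : A = vertex Y false false) (hB : vertex Y true true = B)
    {Y' : D.obj (J.prod (.square Dia))}
    (e : Y' = (D.map (Shape.prodMap u (𝟭 (Shape.square Dia)))).obj Y)
    (hY' : HasZeroCorners Y') {A' B' : D.obj J}
    (hA' : A' = vertex Y' false false) (hB' : vertex Y' true true = B')
    (eA : A' = (D.map u).obj A) (eB : B' = (D.map u).obj B) :
    squareComparison hD Y' hY' hA' hB' ≫ (D.loop.app J).map (eqToHom eB) ≫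
        (D.loop.γ u).hom.app B = eqToHom eA ≫ (D.map u).map (squareComparison hD Y hY hA hB) := by
  subst e hA hB hA' hB'
  simpa [squareComparison] using loopComparison_map hD u Y hY hY' eB eA

end comparison

namespace St
variable {D : Prederivator.{w, v, u} Dia} [IsDerivator D] {hD : D.IsPointed}

/-- An endofunctor of `V` that permutes the diagonal squares among themselves, without flipping
them, and preserves the boundary only reindexes the conditions of `isOmegaSpectrum_iff_diag`. -/
theorem isOmegaSpectrum_map_equivalence {X : D.obj (K.prod (.band Dia))}
    (e : Shape.band Dia ⥤ Shape.band Dia) (f : ℤ → ℤ)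
    (he : ∀ i, Shape.diagSquare Dia i ⋙ e = Shape.diagSquare Dia (f i))
    (he' : ∀ x : Band.{w}, |x.down.1.1 - x.down.1.2| = 1 →
      |(e.obj x).down.1.1 - (e.obj x).down.1.2| = 1)
    (hX : IsOmegaSpectrum hD X) : IsOmegaSpectrum hD ((D.map (Shape.prodMap (𝟭 K) e)).obj X) := by
  rw [isOmegaSpectrum_iff_diag] at hX ⊢
  refine ⟨hX.1.map _ fun x hx => he' _ hx, fun i => ?_⟩
  have h := map_eq_map_map (D := D) (u := Shape.prodMap (𝟭 K) (Shape.diagSquare Dia i))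
    (v := Shape.prodMap (𝟭 K) e) (t := Shape.prodMap (𝟭 K) (Shape.diagSquare Dia (f i)))
    (by rw [← he]; rfl) X
  rw [h]
  exact hX.2 (f i)

/-- The map `(i, j) ↦ (i - 2, j - 2)` of the band. -/
def _root_.Band.shiftBack : Band.{w} →o Band.{w} where
  toFun x := Band.shift.symm (Band.shift.symm x)
  monotone' _ _ h := Band.shift.symm.monotone (Band.shift.symm.monotone h)

/-- The automorphism `σ` gives an equivalence on all of `D (K × V)`, hence full faithfulness on
spectra. What needs proof is that a preimage of a spectrum can be chosen to be a spectrum. -/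
theorem isEquivalence_bandShift (K : Shape Dia) : ((bandShift D hD).app K).IsEquivalence := by
  have h1 : (Shape.prodMap (𝟭 K) (Shape.bandShift Dia)).IsEquivalence :=
    Shape.prodMap_isEquivalence inferInstance (Shape.isEquivalence_orderIso Band.shift)
  have h2 := isEquivalence_map_of_isEquivalence (D := D) _ h1
  have h3 : ((omegaSpectra hD K).ι ⋙ D.bandShift K).Full := inferInstance
  have h4 : ((omegaSpectra hD K).ι ⋙ D.bandShift K).Faithful := inferInstance
  refine
    { faithful := inferInstanceAs ((omegaSpectra hD K).lift ((omegaSpectra hD K).ι ⋙ D.bandShift K)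
        fun X => X.property.bandShift).Faithful
      full := inferInstanceAs ((omegaSpectra hD K).lift ((omegaSpectra hD K).ι ⋙ D.bandShift K)
        fun X => X.property.bandShift).Full
      essSurj := ⟨fun Y => ?_⟩ }
  -- The functor `σ` exchanges the coordinates, whereas `σ⁻²` is a translation and carries diagonal
  -- squares to diagonal squares. The preimage of `Y` is therefore taken to be `σ^* (σ⁻²)^* Y`.
  let e : Shape.band Dia ⥤ Shape.band Dia := Band.shiftBack.monotone.functor
  have h5 : IsOmegaSpectrum hD ((D.map (Shape.prodMap (𝟭 K) e)).obj Y.obj) := by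
    refine isOmegaSpectrum_map_equivalence e (fun i => i - 2) (fun i => ?_) (fun x hx => ?_) Y.property
    · refine CategoryTheory.Functor.ext (fun s => ?_) fun _ _ _ => Subsingleton.elim _ _
      obtain ⟨⟨a, b⟩⟩ := s
      refine ULift.ext _ _ (Subtype.ext (Prod.ext ?_ ?_))
      · change (bif a then i + 1 else i) - 1 - 1 = bif a then i - 2 + 1 else i - 2
        cases a <;> simp <;> omega
      · change (bif b then i + 1 else i) - 1 - 1 = bif b then i - 2 + 1 else i - 2
        cases b <;> simp <;> omega
    · change |x.down.1.1 - 1 - 1 - (x.down.1.2 - 1 - 1)| = 1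
      rw [show x.down.1.1 - 1 - 1 - (x.down.1.2 - 1 - 1) = x.down.1.1 - x.down.1.2 by ring]
      exact hx
  refine ⟨⟨_, h5.bandShift⟩, ⟨(omegaSpectra hD K).isoMk (eqToIso ?_)⟩⟩
  change (D.bandShift K).obj ((D.bandShift K).obj ((D.map (Shape.prodMap (𝟭 K) e)).obj Y.obj)) = Y.obj
  have h6 : Shape.bandShift Dia ⋙ Shape.bandShift Dia ⋙ e = 𝟭 (Shape.band Dia) := by
    refine CategoryTheory.Functor.ext (fun x => ?_) fun _ _ _ => Subsingleton.elim _ _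
    change Band.shift.symm (Band.shift.symm (Band.shift (Band.shift x))) = x
    simp
  have h7 : Shape.prodMap (𝟭 K) (Shape.bandShift Dia) ⋙ Shape.prodMap (𝟭 K) (Shape.bandShift Dia) ⋙
      Shape.prodMap (𝟭 K) e = 𝟭 (K.prod (.band Dia)) :=
    congr_arg (fun f => Shape.prodMap (𝟭 K) f) h6
  exact (congr_arg (D.bandShift K).obj (map_eq_map_map (D := D)
    (u := Shape.prodMap (𝟭 K) (Shape.bandShift Dia)) (v := Shape.prodMap (𝟭 K) e) rfl Y.obj)).trans
      ((map_eq_map_map (D := D) (u := Shape.prodMap (𝟭 K) (Shape.bandShift Dia)) h7 Y.obj).trans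
        (Functor.congr_obj (D.map_id _) Y.obj))

variable [IsDerivator (D.St hD)] (hS : (D.St hD).IsPointed)

/-- The square `w^* X` is cartesian in `K ↦ D (K × V)`, and all of its vertices are spectra, so it
is cartesian in `St`. -/
theorem isIso_comparison (X : (D.St hD).obj K) : IsIso (comparison hS X) :=
  have : ((D.shift (.band Dia)).full (omegaSpectra hD) fun u _ hX => hX.map u).IsDerivator :=
    inferInstanceAs (D.St hD).IsDerivator
  (isIso_squareComparison_iff hS _ _ _ _).2
    (isCartesianAt_full (E := D.shift (.band Dia)) ((isOmegaSpectrum_iff hD _).1 X.property).2)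

theorem comparison_naturality {X X' : (D.St hD).obj K} (f : X ⟶ X') :
    f ≫ comparison hS X' = comparison hS X ≫
      ((D.St hD).loop.app K).map (((bandShift D hD).app K).map f) := by
  let g : square X ⟶ square X' := ObjectProperty.homMk ((D.map K.bandSquare).map f.hom)
  refine squareComparison_naturality hS (hasZeroCorners X) (hasZeroCorners X') _ _ _ _ g f _ ?_ ?_
  · refine full_swap (omegaSpectra hD K) _ _ _ _ ?_
    exact eqToHom_functor_naturality (map_bandSquare_false_false (D := D) K) f.hom
  · refine full_swap (omegaSpectra hD K) _ _ _ _ ?_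
    exact eqToHom_functor_naturality (map_bandSquare_true_true (D := D) K) f.hom

/-- Forming `w^* X` commutes strictly with restriction in `K`, so the compatibility of `φ` reduces
to that of the loop comparison. -/
theorem comparison_map (u : J ⥤ K) (X : (D.St hD).obj K) :
    comparison hS (((D.St hD).map u).obj X) ≫
      ((D.St hD).loop.app J).map (((bandShift D hD).γ u).hom.app X) ≫
        ((D.St hD).loop.γ u).hom.app (((bandShift D hD).app K).obj X) =
      ((D.St hD).map u).map (comparison hS X) := by
  have h1 : Prederivator.bandSquare ((D.map (Shape.prodMap u (𝟭 (Shape.band Dia)))).obj X.obj) =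
      ((D.shift (.band Dia)).map (Shape.prodMap u (𝟭 (Shape.square Dia)))).obj
        (Prederivator.bandSquare X.obj) :=
    map_map_eq (D := D) (u := J.bandSquare) (v := Shape.prodMap u (𝟭 (Shape.band Dia)))
      (u' := Shape.prodMap (Shape.prodMap u (𝟭 (Shape.square Dia))) (𝟭 (Shape.band Dia)))
      (v' := K.bandSquare) rfl X.obj
  have h2 : square (((D.St hD).map u).obj X) =
      ((D.St hD).map (Shape.prodMap u (𝟭 (Shape.square Dia)))).obj (square X) :=
    ObjectProperty.FullSubcategory.ext h1
  have hσ : (D.St hD).map u ⋙ (bandShift D hD).app J = (bandShift D hD).app K ⋙ (D.St hD).map u :=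
    lift_eqToHom (omegaSpectra hD K) (omegaSpectra hD J)
      (F := D.map (Shape.prodMap u (𝟭 (Shape.band Dia))) ⋙ D.bandShift J)
      (F' := D.bandShift K ⋙ D.map (Shape.prodMap u (𝟭 (Shape.band Dia))))
      ((D.map_comp (Shape.prodMap (𝟭 J) (Shape.bandShift Dia)) (Shape.prodMap u (𝟭 _))).symm.trans
        (D.map_comp (Shape.prodMap u (𝟭 _)) (Shape.prodMap (𝟭 K) (Shape.bandShift Dia))))
      (fun X hX => (hX.map u).bandShift) (fun X hX => hX.bandShift.map u)
  have h := squareComparison_map hS u (hasZeroCorners X)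
    (A := X) (B := ((bandShift D hD).app K).obj X)
    (A' := ((D.St hD).map u).obj X)
    (B' := ((bandShift D hD).app J).obj (((D.St hD).map u).obj X))
    (ObjectProperty.FullSubcategory.ext (vertex_bandSquare_false_false X.obj))
    (ObjectProperty.FullSubcategory.ext (vertex_bandSquare_true_true X.obj)) h2
    (hasZeroCorners (((D.St hD).map u).obj X))
    (ObjectProperty.FullSubcategory.ext (vertex_bandSquare_false_false _))
    (ObjectProperty.FullSubcategory.ext (vertex_bandSquare_true_true _)) rfl
    (Functor.congr_obj hσ X)
  have h3 : ((bandShift D hD).γ u).hom.app X = eqToHom (Functor.congr_obj hσ X) := eqToHom_app hσ _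
  rw [h3]
  exact h.trans (Category.id_comp _)

/-- The comparison as an isomorphism of functors. -/
noncomputable def comparisonIso (K : Shape Dia) :
    𝟭 ((D.St hD).obj K) ≅ (bandShift D hD).app K ⋙ (D.St hD).loop.app K :=
  NatIso.ofComponents (fun X => @asIso _ _ _ _ (comparison hS X) (isIso_comparison hS X))
    fun f => comparison_naturality hS f

/-- The isomorphism `φ` shows that `σ^*` followed by `Ω` is the identity, and `σ^*` is an
equivalence. -/
theorem isEquivalence_loop (hS : (D.St hD).IsPointed) (K : Shape Dia) :
    ((D.St hD).loop.app K).IsEquivalence := by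
  have := isEquivalence_bandShift (D := D) (hD := hD) K
  have h := comparisonIso (D := D) hS K
  have : ((bandShift D hD).app K ⋙ (D.St hD).loop.app K).IsEquivalence :=
    Functor.isEquivalence_of_iso h
  exact Functor.isEquivalence_of_comp_left ((bandShift D hD).app K) _

end St

/-! ### Adjoint equivalences and mates for morphisms of prederivators. -/

section adjunction
variable {D E : Prederivator.{w, v, u} Dia} {Φ : Morphism D E} {Ψ : Morphism E D}

/-- The adjunction at a shape underlying an adjunction of morphisms. -/
def MorphismAdjunction.adj (adj : MorphismAdjunction Φ Ψ) (K : Shape Dia) : Φ.app K ⊣ Ψ.app K where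
  unit := adj.unit.app K
  counit := adj.counit.app K
  left_triangle_components := adj.left_triangle K
  right_triangle_components := adj.right_triangle K

theorem MorphismAdjunction.isEquivalence_of_right (adj : MorphismAdjunction Φ Ψ)
    (h : ∀ K, (Ψ.app K).IsEquivalence) : adj.IsEquivalence where
  isIso_unit K := by
    have := h K
    exact inferInstanceAs (IsIso (adj.adj K).unit)
  isIso_counit K := by
    have := h K
    exact inferInstanceAs (IsIso (adj.adj K).counit)

/-- An invertible transformation to the composite with the right adjoint identifies the left
adjoint. -/
theorem MorphismAdjunction.exists_modification (adj : MorphismAdjunction Φ Ψ)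
    (hadj : adj.IsEquivalence) (Θ : Morphism D E)
    (φ : ∀ (K : Shape Dia) (X : D.obj K), X ⟶ (Ψ.app K).obj ((Θ.app K).obj X))
    (hφ : ∀ K X, IsIso (φ K X))
    (hφ' : ∀ {K : Shape Dia} {X Y : D.obj K} (f : X ⟶ Y),
      f ≫ φ K Y = φ K X ≫ (Ψ.app K).map ((Θ.app K).map f))
    (hφ'' : ∀ {J K : Shape Dia} (u : J ⥤ K) (X : D.obj K),
      φ J ((D.map u).obj X) ≫ (Ψ.app J).map ((Θ.γ u).hom.app X) ≫
        (Ψ.γ u).hom.app ((Θ.app K).obj X) = (D.map u).map (φ K X)) :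
    ∃ θ : Modification Φ Θ, (∀ K, IsIso (θ.app K)) ∧ ∀ (K : Shape Dia) (X : D.obj K),
      (adj.unit.app K).app X ≫ (Ψ.app K).map ((θ.app K).app X) = φ K X := by
  -- The only possible choice: the adjunct of `φ`. Naturality and the modification identity are
  -- checked after the unit, where they become those of `φ`.
  let θ (K : Shape Dia) (X : D.obj K) : (Φ.app K).obj X ⟶ (Θ.app K).obj X :=
    ((adj.adj K).homEquiv _ _).symm (φ K X)
  have hη (K : Shape Dia) (X : D.obj K) :
      (adj.adj K).unit.app X ≫ (Ψ.app K).map (θ K X) = φ K X :=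
    ((adj.adj K).homEquiv_unit ..).symm.trans (((adj.adj K).homEquiv _ _).apply_symm_apply _)
  have hinj {K : Shape Dia} {X : D.obj K} {Z : E.obj K} {f g : (Φ.app K).obj X ⟶ Z}
      (h : (adj.adj K).unit.app X ≫ (Ψ.app K).map f =
        (adj.adj K).unit.app X ≫ (Ψ.app K).map g) : f = g := by
    apply ((adj.adj K).homEquiv X Z).injective
    rw [Adjunction.homEquiv_unit, Adjunction.homEquiv_unit]
    exact h
  have hu {J K : Shape Dia} (u : J ⥤ K) (X : D.obj K) :
      (adj.adj J).unit.app ((D.map u).obj X) ≫ (Ψ.app J).map ((Φ.γ u).hom.app X) ≫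
        (Ψ.γ u).hom.app ((Φ.app K).obj X) = (D.map u).map ((adj.adj K).unit.app X) := by
    have h := adj.unit.naturality u X
    rw [Morphism.comp_γ_hom_app] at h
    exact h.trans (Category.id_comp _)
  refine ⟨{
    app := fun K =>
      { app := fun X => θ K X
        naturality := fun X Y f => hinj ?_ }
    naturality := fun {J K} u X => hinj ?_ }, fun K => ?_, fun K X => hη K X⟩
  · have h := congr_arg (fun g => g ≫ (Ψ.app K).map (θ K Y)) ((adj.adj K).unit_naturality f)
    rw [Category.assoc, Category.assoc, hη] at h
    rw [(Ψ.app K).map_comp, (Ψ.app K).map_comp, reassoc_of% hη K X]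
    exact h.trans (hφ' f)
  · have h : (Ψ.app J).map ((E.map u).map (θ K X)) ≫ (Ψ.γ u).hom.app ((Θ.app K).obj X) =
        (Ψ.γ u).hom.app ((Φ.app K).obj X) ≫ (D.map u).map ((Ψ.app K).map (θ K X)) :=
      (Ψ.γ u).hom.naturality (θ K X)
    rw [← cancel_mono ((Ψ.γ u).hom.app ((Θ.app K).obj X))]
    have h' := congr_arg (fun g => g ≫ (D.map u).map ((Ψ.app K).map (θ K X))) (hu u X)
    rw [← (D.map u).map_comp, hη, Category.assoc, Category.assoc, ← h] at h'
    dsimp only [Functor.comp_obj, Functor.comp_map] at h' ⊢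
    rw [(Ψ.app J).map_comp, (Ψ.app J).map_comp, reassoc_of% hη J ((D.map u).obj X)]
    simp only [Category.assoc]
    exact (h'.trans (hφ'' u X).symm).symm
  -- The adjunct is the image of the invertible `φ` under `Φ`, followed by the counit, which is
  -- invertible for an adjoint equivalence.
  · have (X : D.obj K) : IsIso (θ K X) := by
      have := hφ K X
      have : IsIso ((adj.adj K).counit) := hadj.isIso_counit K
      dsimp only [θ]
      rw [Adjunction.homEquiv_counit]
      infer_instance
    exact NatIso.isIso_of_isIso_app _

end adjunction

end Prederivator

/-! ### Stability of the derivator of spectra and the identification of suspension with the shift.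
-/

theorem mainTheorem6 (Dia : DiagramDomain.{w}) (D : Prederivator.{w, v, u} Dia) [D.IsDerivator]
    (hp : D.IsPointed) (hr : D.IsRegular) :
    ∃ _ : (D.St hp).IsDerivator, ∃ hS : (D.St hp).IsStable,
      ∀ adj : Prederivator.MorphismAdjunction (D.St hp).susp (D.St hp).loop,
        ∃ θ : Prederivator.Modification (D.St hp).susp (Prederivator.St.bandShift D hp),
          (∀ K, IsIso (θ.app K)) ∧
          ∀ (K : Shape Dia) (X : (D.St hp).obj K),
            (adj.unit.app K).app X ≫ ((D.St hp).loop.app K).map ((θ.app K).app X) =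
              Prederivator.St.comparison hS.isPointed X := by
  have hd := Prederivator.isDerivator_St hp hr
  have hS := Prederivator.isPointed_St hp
  have hadj (adj : Prederivator.MorphismAdjunction (D.St hp).susp (D.St hp).loop) :
      adj.IsEquivalence := adj.isEquivalence_of_right (Prederivator.St.isEquivalence_loop hS)
  refine ⟨hd, ⟨hS, Prederivator.exists_adjunction_susp_loop hS, hadj⟩, fun adj => ?_⟩
  exact adj.exists_modification (hadj adj) (Prederivator.St.bandShift D hp)
    (fun K X => Prederivator.St.comparison hS X)
    (fun K X => Prederivator.St.isIso_comparison hS X)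
    (Prederivator.St.comparison_naturality hS) (Prederivator.St.comparison_map hS)
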